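/- Let $\mathbf H$ be the upper half-plane, $\tau=u+iv$, $d\mu=du\,dv/v^2$. Let $\Gamma\subseteq \mathrm{SL}_2(\mathbf Z)$ be a subgroup of finite index, $\kappa$ a weight, and $S$ a finite-dimensional space of cusp forms of weight $\kappa$ for $\Gamma$, with the non-normalized Petersson product $\langle f,g\rangle=\int_{\Gamma\backslash\mathbf H} f\,\overline g\,v^{\kappa}\,d\mu$. For an orthonormal basis $B$ of $S$ put $$\sup(S)=\sup_{\tau\in\mathbf H}\ \sum_{f\in B} v^{\kappa}|f(\tau)|^2 .$$ For an integer $k$ let $S_k(\Gamma)$ be the space of holomorphic cusp forms of weight $k$ for $\Gamma$. For $\kappa\in\frac12+\mathbf Z$ let $S_\kappa(4N)$ be the space of holomorphic functions $f$ on $\mathbf H$ that satisfy $f(\gamma\tau)=\left(\frac cd\right)^{2\kappa}\varepsilon_d^{-2\kappa}(c\tau+d)^\kappa f(\tau)$ for all $\gamma=\left(\begin{smallmatrix}a&b\\c&d\end{smallmatrix}\right)\in\Gamma_0(4N)$ and vanish at all cusps. Here $(c\tau+d)^\kappa$ is the principal power, $\varepsilon_d=1$ if $d\equiv1$ and $\varepsilon_d=i$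 if $d\equiv-1\pmod 4$, and $\left(\frac cd\right)$ is the Jacobi symbol $\left(\frac c{|d|}\right)$, multiplied by $-1$ if $c<0$ and $d<0$. **Theorem.** All the spaces below are finite-dimensional, and the following hold. 1. For every integer $k>2$ there are constants $c,C>0$ depending only on $k$ such that for all $N\ge1$ one has $\sup(S_k(\Gamma_0(N)))\le C$, and $\sup(S_k(\Gamma_0(N)))\ge c$ whenever $S_k(\Gamma_0(N))\neq0$. If $k$ is even, then $S_k(\Gamma_0(N))\ne0$ for all sufficiently large $N$ (depending on $k$). (If $k$ is odd, $S_k(\Gamma_0(N))=0$.) 2. For every integer $k>2$ there are constants $c,C>0$ depending only on $k$ such that for all $N\ge1$ one has $\sup(S_k(\Gamma(N)))\le C$, and $\sup(S_k(\Gamma(N)))\ge c$ whenever $S_k(\Gamma(N))\neq0$. Moreover $S_k(\Gamma(N))\ne0$ for all sufficiently large $N$ (depending on $k$). 3. For every $\kappa\in\frac12+\mathbf Z$ with $\kappa\ge\frac52$ there are constants $c,C>0$ depending only on $\kappa$ such that for all square-free $N\ge1$ one has $\sup(S_\kappa(4N))\le C$, and $\sup(S_\kappa(4N))\ge c$ whenever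 $S_\kappa(4N)\neq0$. Moreover $S_\kappa(4N)\ne0$ for all sufficiently large square-free $N$ (depending on $\kappa$). That is, $\sup(S)\asymp_\kappa 1$ for the nonzero spaces $S$ in each of these three families. -/

import Mathlib

open UpperHalfPlane MeasureTheory CongruenceSubgroup
open scoped MatrixGroups Manifold Modular ComplexConjugate ENNReal

noncomputable section

/-- The (non-normalized) Petersson product of weight `κ`,
`⟨f, g⟩ = ∫_{Γ \ ℍ} f(τ) \overline{g(τ)} (Im τ)^κ dμ(τ)` with `dμ = du dv / v ^ 2` (this measure is
Mathlib's `volume` on `ℍ`), for a finite index subgroup `Γ` of `SL(2, ℤ)`.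
The integral is taken over the fundamental domain `⋃_σ σ • 𝒟` of `Γ`, where `𝒟` is the standard
fundamental domain of `SL(2, ℤ)` and `σ` runs over representatives of `±Γ \ SL(2, ℤ)`: these are the
inverses of representatives of `SL(2, ℤ) / ±Γ`. When `f` and `g` are automorphic forms of weight `κ`
for `Γ` with the same unitary multiplier, the integrand is `Γ`-invariant, and the representatives do
not matter. -/
def peterssonProduct (κ : ℝ) (Γ : Subgroup SL(2, ℤ)) (f g : ℍ → ℂ) : ℂ :=
  ∑ᶠ q : SL(2, ℤ) ⧸ (Γ ⊔ Subgroup.zpowers (-1 : SL(2, ℤ))),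
    ∫ τ in 𝒟, f (q.out⁻¹ • τ) * conj (g (q.out⁻¹ • τ)) * (((q.out⁻¹ • τ).im ^ κ : ℝ) : ℂ)

/-- `B` is a (finite) orthonormal basis of the space `S` of functions on `ℍ`, with respect to the
Petersson product of weight `κ` for `Γ`. -/
structure IsPeterssonOrthonormalBasis (κ : ℝ) (Γ : Subgroup SL(2, ℤ)) (S : Submodule ℂ (ℍ → ℂ))
    (B : Finset (ℍ → ℂ)) : Prop where
  span_eq : Submodule.span ℂ (B : Set (ℍ → ℂ)) = S
  linearIndependent : LinearIndependent ℂ (fun f : B ↦ (f : ℍ → ℂ))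
  product_self : ∀ f ∈ B, peterssonProduct κ Γ f f = 1
  product_ne : ∀ f ∈ B, ∀ g ∈ B, f ≠ g → peterssonProduct κ Γ f g = 0

/-- The Bergman kernel on the diagonal, `∑_{f ∈ B} v ^ κ |f(τ)| ^ 2` with `v = Im τ`. -/
def bergmanKernel (κ : ℝ) (B : Finset (ℍ → ℂ)) (τ : ℍ) : ℝ :=
  ∑ f ∈ B, τ.im ^ κ * ‖f τ‖ ^ 2

/-- The supremum over `ℍ` of the Bergman kernel (`∞` if the kernel is unbounded). -/
def bergmanSup (κ : ℝ) (B : Finset (ℍ → ℂ)) : ℝ≥0∞ :=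
  ⨆ τ : ℍ, ENNReal.ofReal (bergmanKernel κ B τ)

/-- The space `S_k(Γ)` of holomorphic cusp forms of integral weight `k` for `Γ`, as a space of
functions on `ℍ`. -/
def cuspSpace (Γ : Subgroup SL(2, ℤ)) (k : ℤ) : Submodule ℂ (ℍ → ℂ) where
  carrier := {f | ∃ F : CuspForm (Γ : Subgroup (GL (Fin 2) ℝ)) k, (F : ℍ → ℂ) = f}
  zero_mem' := ⟨0, rfl⟩
  add_mem' := by
    rintro _ _ ⟨F, rfl⟩ ⟨G, rfl⟩
    exact ⟨F + G, rfl⟩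
  smul_mem' := by
    rintro a _ ⟨F, rfl⟩
    exact ⟨a • F, rfl⟩

/-- The quadratic residue symbol `(c/d)` for odd `d`, extended to negative `d` in the way usual for
half-integral weights: `(c/d) = (c/|d|)`, unless `c` and `d` are both negative, when
`(c/d) = -(c/|d|)`; here `(c/|d|)` is the Jacobi symbol. In particular `(0/±1) = 1`. -/
def thetaSymbol (c d : ℤ) : ℤ :=
  if c < 0 ∧ d < 0 then -jacobiSym c d.natAbs else jacobiSym c d.natAbs

/-- For odd `d`: `ε_d = 1` if `d ≡ 1 mod 4`, and `ε_d = i` if `d ≡ -1 mod 4`. -/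
def thetaEpsilon (d : ℤ) : ℂ :=
  if d % 4 = 1 then 1 else Complex.I

/-- The factor of automorphy `(c/d)^{2κ} ε_d^{-2κ} (cτ + d)^κ` of weight `κ = k + 1/2`, where
`(c, d)` is the lower row of `γ`; the power is the principal one. -/
def thetaFactor (k : ℕ) (γ : SL(2, ℤ)) (τ : ℍ) : ℂ :=
  (thetaSymbol (γ 1 0) (γ 1 1) : ℂ) ^ (2 * k + 1) * (thetaEpsilon (γ 1 1))⁻¹ ^ (2 * k + 1) *
    ((γ 1 0 : ℂ) * (τ : ℂ) + (γ 1 1 : ℂ)) ^ ((k : ℂ) + 1 / 2)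

/-- The space `S_{k + 1/2}(4N)` of holomorphic cusp forms of weight `k + 1/2` for `Γ₀(4N)`. Every
cusp is `σ∞` for some `σ` in `SL(2, ℤ)`, and the form has to vanish there; which branch of
`(cτ + d)^{-k - 1/2}` is taken does not matter for this. -/
def halfCuspSpace (k N : ℕ) : Submodule ℂ (ℍ → ℂ) where
  carrier := {f | MDifferentiable 𝓘(ℂ) 𝓘(ℂ) f ∧
    (∀ γ ∈ Gamma0 (4 * N), ∀ τ : ℍ, f (γ • τ) = thetaFactor k γ τ * f τ) ∧
    ∀ σ : SL(2, ℤ), IsZeroAtImInfty fun τ : ℍ ↦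
      ((σ 1 0 : ℂ) * (τ : ℂ) + (σ 1 1 : ℂ)) ^ (-((k : ℂ) + 1 / 2)) * f (σ • τ)}
  zero_mem' := by
    refine ⟨mdifferentiable_const, by simp, fun σ ↦ ?_⟩
    simp only [Pi.zero_apply, mul_zero]
    exact (zeroAtImInftySubmodule ℂ).zero_mem
  add_mem' := by
    rintro f g ⟨hf, hf', hf''⟩ ⟨hg, hg', hg''⟩
    refine ⟨hf.add hg, fun γ hγ τ ↦ ?_, fun σ ↦ ?_⟩
    · simp only [Pi.add_apply, hf' γ hγ τ, hg' γ hγ τ, mul_add]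
    · simpa only [Pi.add_apply, mul_add] using!
        (zeroAtImInftySubmodule ℂ).add_mem (hf'' σ) (hg'' σ)
  smul_mem' := by
    rintro a f ⟨hf, hf', hf''⟩
    refine ⟨hf.const_smul a, fun γ hγ τ ↦ ?_, fun σ ↦ ?_⟩
    · simp only [Pi.smul_apply, smul_eq_mul, hf' γ hγ τ]
      ring
    · simp only [Pi.smul_apply, smul_eq_mul, mul_left_comm _ a]
      exact (zeroAtImInftySubmodule ℂ).smul_mem a (hf'' σ)

end

noncomputable section

open scoped ModularForm

/-! ### The invariant measure -/

/-! Write κ = w/2. Then `weightedNorm (w / 2) (f ^ 2)` is v^κ|f|² and `weightedNorm (w / 4) f` is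
its square root. All three families are treated at once through an abstract factor of automorphy J
with J⁴ = (cτ + d)^(2w).

Upper bound, uniform in the group. By the sub-mean value property, v^κ|f|² at a point is at most a
constant times its integral over the hyperbolic unit ball there. Around σz with Im z ≥ 1/2, such a
ball meets an orbit in O(Im z/h + 1) points, h being the width of the cusp σ∞
(`exists_encard_smul_mem_ball_le`). So for Im z ≤ h the value is O(‖f‖²). For Im z ≥ h the Schwarz
lemma in q = e(z/h), applied to f⁴|σ, carries the bound upwards
(`exists_weightedNorm_sq_le_peterssonNormSq`). Applied to the function representing evaluation at τ,
this bounds the Bergman kernel, and integrating the kernel gives finite dimension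
(`exists_bergmanKernel_le`).

Lower bound. Let P be the Poincaré series of an integrable seed, with all norms weighted. Then
‖P‖_∞² ≤ sup(S)·‖P‖₂² ≤ sup(S)·‖P‖_∞·‖P‖₁, and unfolding gives ‖P‖₁ ≤ 20‖seed‖₁. Hence |P(z)| at any
point, times its weight, is O(sup(S)) (`weightedNorm_poincareSeries_le_bergmanSup`). As the level
grows, P(z) tends by dominated convergence to the series over the limit group: the trivial group for
Γ(N), the upper triangular matrices for Γ₀(N). There it is visibly nonzero at a suitable z. This
gives nonvanishing and the lower bound for large N; the finitely many remaining N are harmless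
(`exists_bergmanSup_bounds`).

In half-integral weight it remains to see that the theta multiplier is a cocycle on Γ₀(4). This is
checked on the generators -1, T and (1, 0; 4, 1), where it amounts to quadratic reciprocity and a
comparison of branches of the square root. -/

lemma measurePreserving_SL2Z_smul (γ : SL(2, ℤ)) :
    MeasurePreserving (fun z : ℍ ↦ γ • z) volume volume :=
  measurePreserving_smul (γ : GL (Fin 2) ℝ) (volume : Measure ℍ)

lemma measurable_SL2Z_smul (γ : SL(2, ℤ)) : Measurable (fun z : ℍ ↦ γ • z) :=
  (measurePreserving_SL2Z_smul γ).measurable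

lemma continuous_SL2Z_smul (γ : SL(2, ℤ)) : Continuous (fun z : ℍ ↦ γ • z) :=
  continuous_const_smul (γ : GL (Fin 2) ℝ)

lemma lintegral_SL2Z_smul (γ : SL(2, ℤ)) {f : ℍ → ℝ≥0∞} (hf : Measurable f) :
    ∫⁻ z, f (γ • z) = ∫⁻ z, f z :=
  (measurePreserving_SL2Z_smul γ).lintegral_comp hf

lemma dist_SL2Z_smul (γ : SL(2, ℤ)) (z w : ℍ) : dist (γ • z) (γ • w) = dist z w :=
  dist_smul (Matrix.SpecialLinearGroup.map (Int.castRingHom ℝ) γ : SL(2, ℝ)) z w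

lemma UpperHalfPlane.lintegral_eq {f : ℍ → ℝ≥0∞} (hf : Measurable f) :
    ∫⁻ z, f z = ∫⁻ z in upperHalfPlaneSet,
      f (ofComplex z) * ENNReal.ofReal ((1 / z.im) ^ 2) := by
  have hmp : MeasurePreserving UpperHalfPlane.coe (volume.comap UpperHalfPlane.coe)
      (volume.restrict (.range UpperHalfPlane.coe)) :=
    ⟨measurable_coe, by rw [measurableEmbedding_coe.map_comap]⟩
  have hr : Set.range UpperHalfPlane.coe = upperHalfPlaneSet := by
    ext z
    exact ⟨fun ⟨w, hw⟩ ↦ hw ▸ w.im_pos, fun h ↦ ⟨⟨z, h⟩, rfl⟩⟩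
  rw [volume_def, lintegral_withDensity_eq_lintegral_mul _ _ hf, ← hr,
    ← hmp.lintegral_comp_emb measurableEmbedding_coe]
  · refine lintegral_congr fun z ↦ ?_
    simp only [Pi.mul_apply, ofComplex_apply, coe_im]
    rw [mul_comm]
    congr 1
    rw [ENNReal.ofReal, ENNReal.coe_inj, ← NNReal.coe_inj,
      Real.coe_toNNReal _ (by positivity)]
    simp
  · refine Measurable.coe_nnreal_ennreal ?_
    refine Measurable.pow_const ?_ _
    refine measurable_const.div ?_
    exact (UpperHalfPlane.continuous_im.subtype_mk _).measurable

/-- The density `|g(τ)| (Im τ) ^ s` on the upper half-plane. -/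
def weightedNorm (s : ℝ) (g : ℍ → ℂ) (τ : ℍ) : ℝ≥0∞ := ‖g τ‖ₑ * ENNReal.ofReal (τ.im ^ s)

lemma measurable_weightedNorm (s : ℝ) {g : ℍ → ℂ} (hg : Continuous g) :
    Measurable (weightedNorm s g) := by
  unfold weightedNorm
  refine hg.measurable.enorm.mul (ENNReal.measurable_ofReal.comp ?_)
  exact (UpperHalfPlane.continuous_im.measurable).pow_const s

/-! ### The sub-mean value property -/

lemma ofReal_two_pi_mul_enorm_le_lintegral {f : ℂ → ℂ} {c : ℂ} {r : ℝ}
    (hf : DiffContOnCl ℂ f (Metric.ball c |r|)) :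
    ENNReal.ofReal (2 * Real.pi) * ‖f c‖ₑ ≤
      ∫⁻ θ in Set.Ioo (-Real.pi) Real.pi, ‖f (circleMap c r θ)‖ₑ := by
  have h := hf.circleAverage
  rw [Real.circleAverage_def] at h
  have hp : Function.Periodic (fun θ ↦ f (circleMap c r θ)) (2 * Real.pi) := fun θ ↦ by
    simp [periodic_circleMap c r θ]
  -- Circle averages run over (0, 2π), polar coordinates over (-π, π).
  have h2 : ∫ θ in (0 : ℝ)..2 * Real.pi, f (circleMap c r θ) =
      ∫ θ in (-Real.pi)..Real.pi, f (circleMap c r θ) := by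
    have := hp.intervalIntegral_add_eq 0 (-Real.pi)
    rw [zero_add] at this
    rw [this]
    congr 1
    ring
  rw [h2, intervalIntegral.integral_of_le (by linarith [Real.pi_pos])] at h
  rw [← h, enorm_smul, ← mul_assoc, Real.enorm_eq_ofReal (by positivity),
    ← ENNReal.ofReal_mul (by positivity), mul_inv_cancel₀ (by positivity), ENNReal.ofReal_one,
    one_mul, ← restrict_Ioo_eq_restrict_Ioc]
  exact enorm_integral_le_lintegral_enorm _

/-- Integrate the inequality on circles against r dr. Extending by zero to the plane makes polar
coordinates applicable. -/
lemma ofReal_area_mul_enorm_le_lintegral {f : ℂ → ℂ} {c : ℂ} {R : ℝ} (hR : 0 < R)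
    (hf : DifferentiableOn ℂ f (Metric.ball c R)) :
    ENNReal.ofReal (Real.pi * R ^ 2) * ‖f c‖ₑ ≤ ∫⁻ z in Metric.ball c R, ‖f z‖ₑ := by
  set F : ℂ → ℝ≥0∞ := (Metric.ball c R).indicator (fun z ↦ ‖f z‖ₑ) with hF
  have hFm : Measurable F := by
    have : ContinuousOn (fun z ↦ ‖f z‖ₑ) (Metric.ball c R) := hf.continuousOn.enorm
    rw [hF]
    classical
    rw [← Set.piecewise_eq_indicator]
    exact this.measurable_piecewise continuousOn_const Metric.isOpen_ball.measurableSet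
  rw [← lintegral_indicator Metric.isOpen_ball.measurableSet,
    ← lintegral_add_left_eq_self _ c, ← Complex.lintegral_comp_polarCoord_symm]
  have ht : polarCoord.target = Set.Ioi (0 : ℝ) ×ˢ Set.Ioo (-Real.pi) Real.pi := rfl
  rw [ht, Measure.volume_eq_prod, ← Measure.prod_restrict, lintegral_prod]
  swap
  · refine Measurable.aemeasurable ?_
    refine (ENNReal.measurable_ofReal.comp measurable_fst).smul ?_
    refine hFm.comp ?_
    refine measurable_const.add ?_
    have : Continuous fun p : ℝ × ℝ ↦ Complex.polarCoord.symm p := by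
      simp only [Complex.polarCoord_symm_apply]
      fun_prop
    exact this.measurable
  calc ENNReal.ofReal (Real.pi * R ^ 2) * ‖f c‖ₑ
      = ∫⁻ r in Set.Ioo 0 R, ENNReal.ofReal r * (ENNReal.ofReal (2 * Real.pi) * ‖f c‖ₑ) := by
        rw [lintegral_mul_const _ ENNReal.measurable_ofReal,
          ← ofReal_integral_eq_lintegral_ofReal, ← integral_Ioc_eq_integral_Ioo,
          ← intervalIntegral.integral_of_le hR.le, integral_id, ← mul_assoc,
          ← ENNReal.ofReal_mul (show (0 : ℝ) ≤ (R ^ 2 - 0 ^ 2) / 2 by simp; positivity)]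
        · congr 2
          ring
        · exact (continuous_id.integrableOn_Icc (a := 0) (b := R)).mono_set Set.Ioo_subset_Icc_self
        · filter_upwards [ae_restrict_mem measurableSet_Ioo] with r hr using hr.1.le
    _ ≤ ∫⁻ r in Set.Ioo 0 R, ENNReal.ofReal r *
          ∫⁻ θ in Set.Ioo (-Real.pi) Real.pi, ‖f (circleMap c r θ)‖ₑ := by
        refine setLIntegral_mono' measurableSet_Ioo fun r hr ↦ ?_
        gcongr
        refine ofReal_two_pi_mul_enorm_le_lintegral ?_
        rw [abs_of_pos hr.1]
        refine DifferentiableOn.diffContOnCl (hf.mono ?_)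
        exact Metric.closure_ball_subset_closedBall.trans (Metric.closedBall_subset_ball hr.2)
    _ ≤ ∫⁻ r in Set.Ioo 0 R, ∫⁻ θ in Set.Ioo (-Real.pi) Real.pi,
          ENNReal.ofReal r • F (c + Complex.polarCoord.symm (r, θ)) := by
        refine setLIntegral_mono' measurableSet_Ioo fun r hr ↦ ?_
        rw [← lintegral_const_mul' _ _ ENNReal.ofReal_ne_top]
        refine lintegral_mono fun θ ↦ ?_
        rw [smul_eq_mul]
        have h1 : c + Complex.polarCoord.symm (r, θ) = circleMap c r θ := by
          simp [circleMap, Complex.exp_mul_I]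
        rw [h1, hF, Set.indicator_of_mem]
        rw [Metric.mem_ball, dist_eq_norm]
        simp [circleMap, abs_of_pos hr.1, hr.2]
    _ ≤ _ := lintegral_mono_set Set.Ioo_subset_Ioi_self

lemma coe_mem_ball_dist_lt_one {τ : ℍ} {z : ℂ} (hz : z ∈ Metric.ball (τ : ℂ) (τ.im / 4)) :
    3 / 4 * τ.im ≤ z.im ∧ z.im ≤ 5 / 4 * τ.im ∧
      (ofComplex z) ∈ Metric.ball τ 1 := by
  rw [Metric.mem_ball, Complex.dist_eq] at hz
  have h1 : |z.im - τ.im| < τ.im / 4 := by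
    have := (Complex.abs_im_le_norm (z - τ)).trans_lt hz
    simpa using this
  rw [abs_lt] at h1
  have h2 := τ.im_pos
  have h3 : 0 < z.im := by linarith
  refine ⟨by linarith, by linarith, ?_⟩
  rw [Metric.mem_ball, ofComplex_apply_of_im_pos h3]
  set w : ℍ := ⟨z, h3⟩
  have hw : w.im = z.im := rfl
  have h4 := UpperHalfPlane.cosh_dist w τ
  have h5 : dist (w : ℂ) τ = ‖z - τ‖ := Complex.dist_eq _ _
  -- cosh d = 1 + |z - τ|²/(2 Im z Im τ) ≤ 1 + (1/16)/(2 · 3/4) = 1 + 1/24, and cosh 1 > e/2 is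
  -- larger.
  have h6 : Real.cosh (dist w τ) < Real.cosh 1 := by
    have h7 : dist (w : ℂ) τ ^ 2 / (2 * w.im * τ.im) ≤ 1 / 24 := by
      rw [div_le_iff₀ (by positivity), h5, hw]
      have := mul_self_le_mul_self (norm_nonneg _) hz.le
      nlinarith
    have h8 := Real.exp_one_gt_d9
    have h9 := Real.exp_pos (-1)
    have h10 := Real.cosh_eq 1
    linarith
  rw [Real.cosh_lt_cosh] at h6
  simpa using! h6

/-- The sub-mean value property, in hyperbolic balls, of the weighted norm of a holomorphic
function. -/
lemma exists_weightedNorm_le_lintegral_ball (s : ℝ) :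
    ∃ C : ℝ≥0∞, C ≠ ⊤ ∧ ∀ (f : ℍ → ℂ), MDifferentiable 𝓘(ℂ) 𝓘(ℂ) f → ∀ τ : ℍ,
      weightedNorm s f τ ≤ C * ∫⁻ z in Metric.ball τ 1, weightedNorm s f z := by
  -- The exponent s - 2 joins the weight to the density v⁻². On the Euclidean disc Im z / Im τ lies
  -- in [3/4, 5/4]; the sign of s - 2 decides which end is the worse one.
  set m : ℝ := min ((3 / 4 : ℝ) ^ (s - 2)) ((5 / 4 : ℝ) ^ (s - 2)) with hm
  have hm0 : 0 < m := lt_min (by positivity) (by positivity)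
  set a : ℝ := Real.pi * (1 / 4) ^ 2 * m with ha
  have ha0 : 0 < a := by positivity
  refine ⟨(ENNReal.ofReal a)⁻¹, by simpa using ha0, fun f hf τ ↦ ?_⟩
  rw [mul_comm, ← div_eq_mul_inv, ENNReal.le_div_iff_mul_le (.inl (by simpa using ha0))
    (.inl ENNReal.ofReal_ne_top)]
  have hv := τ.im_pos
  have hd : DifferentiableOn ℂ (f ∘ ofComplex) (Metric.ball (τ : ℂ) (τ.im / 4)) :=
    (UpperHalfPlane.mdifferentiable_iff.mp hf).mono fun z hz ↦ by
      have := (coe_mem_ball_dist_lt_one hz).1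
      change 0 < z.im
      linarith
  have key := ofReal_area_mul_enorm_le_lintegral (by positivity : 0 < τ.im / 4) hd
  have hw := measurable_weightedNorm s hf.continuous
  rw [← lintegral_indicator Metric.isOpen_ball.measurableSet,
    UpperHalfPlane.lintegral_eq (hw.indicator Metric.isOpen_ball.measurableSet)]
  have hsub : Metric.ball (τ : ℂ) (τ.im / 4) ⊆ upperHalfPlaneSet := fun z hz ↦ by
    have := (coe_mem_ball_dist_lt_one hz).1
    change 0 < z.im
    linarith
  refine le_trans ?_ (lintegral_mono_set hsub)
  have hpt : ∀ z ∈ Metric.ball (τ : ℂ) (τ.im / 4),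
      ENNReal.ofReal (m * τ.im ^ (s - 2)) * ‖(f ∘ ofComplex) z‖ₑ ≤
      (Metric.ball τ 1).indicator (weightedNorm s f) (ofComplex z) *
        ENNReal.ofReal ((1 / z.im) ^ 2) := by
    intro z hz
    obtain ⟨h1, h2, h3⟩ := coe_mem_ball_dist_lt_one hz
    have h4 : 0 < z.im := by linarith
    rw [Set.indicator_of_mem h3, weightedNorm, mul_comm, Function.comp_apply, mul_assoc,
      ← ENNReal.ofReal_mul (Real.rpow_nonneg (ofComplex z).im_pos.le _)]
    refine mul_le_mul' le_rfl (ENNReal.ofReal_le_ofReal ?_)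
    rw [ofComplex_apply_of_im_pos h4]
    change _ ≤ z.im ^ s * (1 / z.im) ^ 2
    have h5 : z.im ^ s * (1 / z.im) ^ 2 = z.im ^ (s - 2) := by
      rw [Real.rpow_sub h4, one_div, inv_pow, div_eq_mul_inv]
      norm_cast
    rw [h5]
    rcases le_total 0 (s - 2) with h6 | h6
    · calc m * τ.im ^ (s - 2) ≤ (3 / 4 : ℝ) ^ (s - 2) * τ.im ^ (s - 2) := by
            gcongr
            exact min_le_left _ _
        _ = (3 / 4 * τ.im) ^ (s - 2) := (Real.mul_rpow (by norm_num) hv.le).symm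
        _ ≤ _ := Real.rpow_le_rpow (by positivity) h1 h6
    · calc m * τ.im ^ (s - 2) ≤ (5 / 4 : ℝ) ^ (s - 2) * τ.im ^ (s - 2) := by
            gcongr
            exact min_le_right _ _
        _ = (5 / 4 * τ.im) ^ (s - 2) := (Real.mul_rpow (by norm_num) hv.le).symm
        _ ≤ _ := Real.rpow_le_rpow_of_nonpos h4 h2 h6
  refine le_trans ?_ (setLIntegral_mono' Metric.isOpen_ball.measurableSet hpt)
  rw [lintegral_const_mul' _ _ ENNReal.ofReal_ne_top]
  refine le_trans (le_of_eq ?_) (mul_le_mul' le_rfl key)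
  rw [weightedNorm, ← mul_assoc, ← ENNReal.ofReal_mul (by positivity), Function.comp_apply,
    ofComplex_apply, mul_comm, mul_comm (‖f τ‖ₑ), ← mul_assoc, ← ENNReal.ofReal_mul (by positivity)]
  congr 2
  have : τ.im ^ s = τ.im ^ (s - 2) * τ.im ^ 2 := by
    rw [← Real.rpow_natCast, ← Real.rpow_add hv]
    norm_num
  rw [this, ha]
  ring

/-! ### Finiteness of integrals over ℍ -/

lemma UpperHalfPlane.lintegral_le_mul {f : ℍ → ℝ≥0∞} {a b : ℝ → ℝ≥0∞} (hf : Measurable f)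
    (ha : Measurable a) (hb : Measurable b) (h : ∀ z : ℍ, f z ≤ a z.re * b z.im) :
    ∫⁻ z, f z ≤ (∫⁻ x, a x) * ∫⁻ y in Set.Ioi 0, b y * ENNReal.ofReal ((1 / y) ^ 2) := by
  have hb' : Measurable fun y ↦ (Set.Ioi (0 : ℝ)).indicator
      (fun y ↦ b y * ENNReal.ofReal ((1 / y) ^ 2)) y :=
    (hb.mul (by fun_prop)).indicator measurableSet_Ioi
  have hm : MeasurableSet upperHalfPlaneSet := isOpen_upperHalfPlaneSet.measurableSet
  rw [UpperHalfPlane.lintegral_eq hf, ← lintegral_indicator measurableSet_Ioi,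
    ← lintegral_prod_mul ha.aemeasurable hb'.aemeasurable, ← Measure.volume_eq_prod,
    ← Complex.volume_preserving_equiv_real_prod.lintegral_comp_emb
      Complex.measurableEquivRealProd.measurableEmbedding, ← lintegral_indicator hm]
  refine lintegral_mono fun z ↦ ?_
  by_cases hz : z ∈ upperHalfPlaneSet
  · have hz' : 0 < z.im := hz
    rw [Set.indicator_of_mem hz, Complex.measurableEquivRealProd_apply,
      Set.indicator_of_mem (by exact hz'), ← mul_assoc, ofComplex_apply_of_im_pos hz']
    gcongr
    exact h _
  · rw [Set.indicator_of_notMem hz]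
    exact zero_le

lemma lintegral_rpow_Ioi_ne_top {c p : ℝ} (hc : 0 < c) (hp : p < -1) :
    ∫⁻ y in Set.Ioi c, ENNReal.ofReal (y ^ p) ≠ ⊤ :=
  ((integrableOn_Ioi_rpow_of_lt hp hc).lintegral_lt_top).ne

lemma volume_fd_ne_top : (volume : Measure ℍ) 𝒟 ≠ ⊤ := by
  rw [← lintegral_indicator_one ModularGroup.isClosed_fd.measurableSet]
  refine ne_top_of_le_ne_top ?_ (UpperHalfPlane.lintegral_le_mul
    (a := (Set.Icc (-1 / 2 : ℝ) (1 / 2)).indicator 1) (b := (Set.Ioi (1 / 2 : ℝ)).indicator 1)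
    (measurable_one.indicator ModularGroup.isClosed_fd.measurableSet)
    (measurable_one.indicator measurableSet_Icc)
    (measurable_one.indicator measurableSet_Ioi) fun z ↦ ?_)
  · rw [lintegral_indicator_one measurableSet_Icc]
    refine ENNReal.mul_ne_top (by simp) ?_
    refine ne_top_of_le_ne_top
      (lintegral_rpow_Ioi_ne_top (c := 1 / 2) (p := -2) (by norm_num) (by norm_num)) ?_
    rw [← lintegral_indicator measurableSet_Ioi, ← lintegral_indicator measurableSet_Ioi]
    refine lintegral_mono fun y ↦ ?_
    by_cases hy : y ∈ Set.Ioi (1 / 2 : ℝ)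
    · have : (0 : ℝ) < y := lt_trans (by norm_num) (Set.mem_Ioi.mp hy)
      rw [Set.indicator_of_mem (by exact this), Set.indicator_of_mem hy, Set.indicator_of_mem hy]
      rw [Real.rpow_neg this.le]
      norm_num
    · by_cases hy0 : y ∈ Set.Ioi (0 : ℝ)
      · rw [Set.indicator_of_mem hy0, Set.indicator_of_notMem hy]
        simp
      · rw [Set.indicator_of_notMem hy0]
        exact zero_le
  · by_cases hz : z ∈ 𝒟
    · have h1 := ModularGroup.three_le_four_mul_im_sq_of_mem_fd hz
      have h2 := abs_le.mp hz.2
      have h3 := z.im_pos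
      rw [Set.indicator_of_mem hz, Set.indicator_of_mem (by constructor <;> linarith),
        Set.indicator_of_mem (by change 1 / 2 < z.im; nlinarith)]
      simp
    · rw [Set.indicator_of_notMem hz]
      exact zero_le

/-- The seed `(τ + i/4)⁻ʷ⁻²` of the Poincaré series. -/
def poincareSeed (w : ℕ) (τ : ℍ) : ℂ := ((τ : ℂ) + Complex.I / 4)⁻¹ ^ (w + 2)

lemma add_I_div_four_ne_zero (τ : ℍ) : (τ : ℂ) + Complex.I / 4 ≠ 0 := by
  intro h
  have := congrArg Complex.im h
  simp at this
  linarith [τ.im_pos]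

lemma mdifferentiable_poincareSeed (w : ℕ) : MDifferentiable 𝓘(ℂ) 𝓘(ℂ) (poincareSeed w) := by
  rw [UpperHalfPlane.mdifferentiable_iff]
  have : DifferentiableOn ℂ (fun z : ℂ ↦ (z + Complex.I / 4)⁻¹ ^ (w + 2)) {z | 0 < z.im} := by
    intro z hz
    refine DifferentiableAt.differentiableWithinAt ?_
    have h0 : z + Complex.I / 4 ≠ 0 := add_I_div_four_ne_zero ⟨z, hz⟩
    have h1 : DifferentiableAt ℂ (fun z : ℂ ↦ z + Complex.I / 4) z := by fun_prop
    exact (h1.inv h0).pow _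
  refine this.congr fun z hz ↦ ?_
  simp [poincareSeed, ofComplex_apply_of_im_pos hz]

/-- Two of the w + 2 powers give decay 16/(1 + x²) in x. The other w leave an integral in y that
behaves like y^(w/4 - 2) at 0, which converges exactly for w > 4: this is the restriction on the
weight. The pole at -i/4 is outside ℍ, so the seed itself causes no trouble near the real line. -/
lemma lintegral_weightedNorm_poincareSeed_ne_top {w : ℕ} (hw : 5 ≤ w) :
    ∫⁻ z, weightedNorm (w / 4) (poincareSeed w) z ≠ ⊤ := by
  have hw' : (5 : ℝ) ≤ w := by exact_mod_cast hw
  refine ne_top_of_le_ne_top ?_ (UpperHalfPlane.lintegral_le_mul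
    (a := fun x ↦ ENNReal.ofReal (16 * (1 + x ^ 2)⁻¹))
    (b := fun y ↦ ENNReal.ofReal ((y + 1 / 4)⁻¹ ^ w * y ^ ((w : ℝ) / 4)))
    (measurable_weightedNorm _ (mdifferentiable_poincareSeed w).continuous)
    (by fun_prop) (by fun_prop) fun z ↦ ?_)
  · refine ENNReal.mul_ne_top ?_ ?_
    · exact ((integrable_inv_one_add_sq.const_mul 16).lintegral_lt_top).ne
    · rw [← Set.Ioc_union_Ioi_eq_Ioi zero_le_one]
      refine ne_top_of_le_ne_top ?_ (lintegral_union_le _ _ _)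
      refine ENNReal.add_ne_top.mpr ⟨?_, ?_⟩
      · have h1 : IntegrableOn (fun y : ℝ ↦ 4 ^ w * y ^ ((w : ℝ) / 4 - 2)) (Set.Ioc 0 1) := by
          refine Integrable.const_mul ?_ _
          rw [← IntegrableOn, ← intervalIntegrable_iff_integrableOn_Ioc_of_le zero_le_one]
          exact intervalIntegral.intervalIntegrable_rpow' (by linarith)
        refine ne_top_of_le_ne_top h1.lintegral_lt_top.ne
          (setLIntegral_mono' measurableSet_Ioc fun y hy ↦ ?_)
        have hy0 : 0 < y := hy.1
        rw [← ENNReal.ofReal_mul (by positivity)]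
        refine ENNReal.ofReal_le_ofReal ?_
        rw [mul_assoc]
        have h2 : y ^ ((w : ℝ) / 4) * (1 / y) ^ 2 = y ^ ((w : ℝ) / 4 - 2) := by
          rw [Real.rpow_sub hy0, one_div, inv_pow, div_eq_mul_inv]
          norm_cast
        rw [h2]
        gcongr
        rw [inv_le_comm₀ (by positivity) (by norm_num)]
        linarith
      · refine ne_top_of_le_ne_top (lintegral_rpow_Ioi_ne_top (c := 1) (p := -2) (by norm_num)
          (by norm_num)) (setLIntegral_mono' measurableSet_Ioi fun y hy ↦ ?_)
        have hy1 : 1 < y := hy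
        have hy0 : 0 < y := by linarith
        rw [← ENNReal.ofReal_mul (by positivity)]
        refine ENNReal.ofReal_le_ofReal ?_
        have h3 : (1 / y) ^ 2 = y ^ (-2 : ℝ) := by
          rw [Real.rpow_neg hy0.le, one_div, inv_pow]
          norm_cast
        rw [h3]
        refine mul_le_of_le_one_left (by positivity) ?_
        rw [inv_pow, inv_mul_le_one₀ (by positivity)]
        calc y ^ ((w : ℝ) / 4) ≤ y ^ (w : ℝ) :=
              Real.rpow_le_rpow_of_exponent_le hy1.le (by linarith)
          _ = y ^ w := Real.rpow_natCast _ _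
          _ ≤ _ := by gcongr; linarith
  · have hv := z.im_pos
    rw [← ENNReal.ofReal_mul (by positivity), weightedNorm, poincareSeed, ← mul_assoc,
      ENNReal.ofReal_mul (by positivity), ← ofReal_norm]
    gcongr
    rw [norm_pow, norm_inv, pow_add, mul_comm]
    set n := ‖(z : ℂ) + Complex.I / 4‖ with hn
    have hn2 : n ^ 2 = z.re ^ 2 + (z.im + 1 / 4) ^ 2 := by
      rw [hn, Complex.sq_norm, Complex.normSq_apply]
      simp
      ring
    have hn0 : 0 < n := norm_pos_iff.mpr (add_I_div_four_ne_zero z)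
    refine mul_le_mul ?_ ?_ (by positivity) (by positivity)
    · rw [inv_pow, hn2, ← div_eq_mul_inv, ← one_div, div_le_div_iff₀ (by positivity) (by positivity)]
      nlinarith [sq_nonneg z.re]
    · gcongr
      exact abs_le_of_sq_le_sq' (by nlinarith [sq_nonneg z.re]) hn0.le |>.2

/-! ### Unfolding -/

instance : Countable SL(2, ℤ) :=
  have : Countable (Matrix (Fin 2) (Fin 2) ℤ) := inferInstanceAs (Countable (Fin 2 → Fin 2 → ℤ))
  Subtype.countable

/-- Substitute z ↦ gᵢz in each term. The sum on the right counts the i with gᵢz in A, so bounds on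
this count become bounds on integrals, in both directions. -/
lemma lintegral_fd_tsum_eq {ι : Type*} [Countable ι] {F : ℍ → ℝ≥0∞} (hF : Measurable F)
    {A : Set ℍ} (hA : MeasurableSet A) (g : ι → SL(2, ℤ)) :
    ∑' i, ∫⁻ z in A, F ((g i)⁻¹ • z) = ∫⁻ z, F z * ∑' i, A.indicator 1 (g i • z) := by
  have h1 : ∀ i, ∫⁻ z in A, F ((g i)⁻¹ • z) = ∫⁻ z, F z * A.indicator 1 (g i • z) := fun i ↦ by
    have hm : Measurable fun z ↦ F ((g i)⁻¹ • z) := hF.comp (measurable_SL2Z_smul _)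
    rw [← lintegral_indicator hA, ← lintegral_SL2Z_smul (g i) (hm.indicator hA)]
    refine lintegral_congr fun z ↦ ?_
    by_cases hz : g i • z ∈ A
    · rw [Set.indicator_of_mem hz, Set.indicator_of_mem hz, inv_smul_smul, Pi.one_apply, mul_one]
    · rw [Set.indicator_of_notMem hz, Set.indicator_of_notMem hz, mul_zero]
  simp_rw [h1, ← ENNReal.tsum_mul_left]
  refine (lintegral_tsum fun i ↦ ?_).symm
  exact (hF.mul ((measurable_one.indicator hA).comp (measurable_SL2Z_smul (g i)))).aemeasurable

lemma lintegral_le_lintegral_fd_tsum {F : ℍ → ℝ≥0∞} (hF : Measurable F) :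
    ∫⁻ z, F z ≤ ∫⁻ z in 𝒟, ∑' β : SL(2, ℤ), F (β⁻¹ • z) := by
  have hD := ModularGroup.isClosed_fd.measurableSet
  have h0 : ∀ β : SL(2, ℤ), AEMeasurable (fun z ↦ F (β⁻¹ • z)) (volume.restrict 𝒟) :=
    fun β ↦ (hF.comp (measurable_SL2Z_smul _)).aemeasurable
  rw [lintegral_tsum h0, lintegral_fd_tsum_eq hF hD fun β ↦ β]
  refine lintegral_mono fun z ↦ ?_
  obtain ⟨g, hg⟩ := ModularGroup.exists_smul_mem_fd z
  refine le_trans ?_ (mul_le_mul' le_rfl (ENNReal.le_tsum g))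
  rw [Set.indicator_of_mem hg, Pi.one_apply, mul_one]

lemma tsum_indicator_one_eq_encard {α : Type*} (s : Set α) :
    ∑' a, s.indicator (1 : α → ℝ≥0∞) a = (s.encard : ℝ≥0∞) := by
  rw [← tsum_subtype s (1 : α → ℝ≥0∞)]
  simp only [Pi.one_apply]
  exact ENNReal.tsum_set_one s

/-- The sum of a function over the translates by representatives of `SL(2, ℤ) / G`. -/
def cosetSum (G : Subgroup SL(2, ℤ)) (ψ : ℍ → ℝ≥0∞) (z : ℍ) : ℝ≥0∞ :=
  ∑' q : SL(2, ℤ) ⧸ G, ψ (q.out⁻¹ • z)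

lemma measurable_cosetSum (G : Subgroup SL(2, ℤ)) {ψ : ℍ → ℝ≥0∞} (hψ : Measurable ψ) :
    Measurable (cosetSum G ψ) :=
  have : Countable (SL(2, ℤ) ⧸ G) := Quotient.countable
  Measurable.tsum fun _ ↦ hψ.comp (measurable_SL2Z_smul _)

lemma tsum_inv_smul_eq (G : Subgroup SL(2, ℤ)) (F : ℍ → ℝ≥0∞) (z : ℍ) :
    ∑' β : SL(2, ℤ), F (β⁻¹ • z) =
      ∑' q : SL(2, ℤ) ⧸ G, ∑' γ : G, F ((γ : SL(2, ℤ)) • q.out⁻¹ • z) := by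
  -- Every β is uniquely the chosen representative of its coset times an element of G.
  have hb : Function.Bijective fun p : (SL(2, ℤ) ⧸ G) × G ↦ p.1.out * (p.2 : SL(2, ℤ)) := by
    refine ⟨fun p p' h ↦ ?_, fun β ↦ ?_⟩
    · have h1 : p.1 = p'.1 := by
        have := congrArg (QuotientGroup.mk : SL(2, ℤ) → SL(2, ℤ) ⧸ G) h
        simpa using this
      simp only [h1, mul_right_inj] at h
      exact Prod.ext h1 (Subtype.ext h)
    · obtain ⟨γ, hγ⟩ := QuotientGroup.mk_out_eq_mul G β
      refine ⟨((β : SL(2, ℤ) ⧸ G), γ⁻¹), ?_⟩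
      simp [hγ]
  rw [← (Equiv.ofBijective _ hb).tsum_eq]
  simp_rw [Equiv.ofBijective_apply]
  rw [ENNReal.tsum_prod']
  refine tsum_congr fun q ↦ ?_
  rw [← (Equiv.inv G).tsum_eq]
  refine tsum_congr fun γ ↦ ?_
  simp [mul_smul]

/-- A function invariant under `G` is integrated over a set which meets each `G`-orbit in at most
`m` points, counted with multiplicity. -/
lemma setLIntegral_le_mul_lintegral_fd_cosetSum {G : Subgroup SL(2, ℤ)} {ψ : ℍ → ℝ≥0∞}
    (hψ : Measurable ψ) (hG : ∀ γ ∈ G, ∀ z, ψ (γ • z) = ψ z) {A : Set ℍ} (hA : MeasurableSet A)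
    {m : ℝ≥0∞} (hm : ∀ z, ({γ | γ ∈ G ∧ γ • z ∈ A}.encard : ℝ≥0∞) ≤ m) :
    ∫⁻ z in A, ψ z ≤ m * ∫⁻ z in 𝒟, cosetSum G ψ z := by
  rw [← lintegral_indicator hA, ← lintegral_const_mul _ (measurable_cosetSum G hψ)]
  refine (lintegral_le_lintegral_fd_tsum (hψ.indicator hA)).trans (lintegral_mono fun z ↦ ?_)
  rw [tsum_inv_smul_eq G, cosetSum, ← ENNReal.tsum_mul_left]
  refine ENNReal.tsum_le_tsum fun q ↦ ?_
  have h1 : ∀ γ : G, A.indicator ψ ((γ : SL(2, ℤ)) • q.out⁻¹ • z) =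
      {γ : G | (γ : SL(2, ℤ)) • q.out⁻¹ • z ∈ A}.indicator 1 γ * ψ (q.out⁻¹ • z) := by
    intro γ
    by_cases h : (γ : SL(2, ℤ)) • q.out⁻¹ • z ∈ A
    · rw [Set.indicator_of_mem h, Set.indicator_of_mem (by exact h), hG _ γ.2, Pi.one_apply,
        one_mul]
    · rw [Set.indicator_of_notMem h, Set.indicator_of_notMem (by exact h), zero_mul]
  simp_rw [h1]
  rw [ENNReal.tsum_mul_right, tsum_indicator_one_eq_encard]
  gcongr
  refine le_trans (le_of_eq ?_) (hm (q.out⁻¹ • z))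
  rw [← Subtype.val_injective.encard_image]
  congr 2
  ext γ
  simp
  tauto

lemma lintegral_tsum_inv_smul_le {F : ℍ → ℝ≥0∞} (hF : Measurable F) {A : Set ℍ}
    (hA : MeasurableSet A) {m : ℝ≥0∞}
    (hm : ∀ z, ({γ : SL(2, ℤ) | γ • z ∈ A}.encard : ℝ≥0∞) ≤ m) :
    ∑' β : SL(2, ℤ), ∫⁻ z in A, F (β⁻¹ • z) ≤ m * ∫⁻ z, F z := by
  rw [lintegral_fd_tsum_eq hF hA fun β ↦ β, ← lintegral_const_mul _ hF]
  refine lintegral_mono fun z ↦ ?_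
  rw [mul_comm]
  gcongr
  refine le_trans (le_of_eq ?_) (hm z)
  rw [← tsum_indicator_one_eq_encard]
  rfl

open ModularGroup in
-- If one γ₀ moves z into 𝒟, every other such γ is δγ₀ with δ moving a point of 𝒟 into 𝒟. Up to sign
-- there are ten candidates for δ, listed in `E`.
lemma encard_smul_mem_fd_le (z : ℍ) : ({γ : SL(2, ℤ) | γ • z ∈ 𝒟}.encard : ℝ≥0∞) ≤ 20 := by
  rcases Set.eq_empty_or_nonempty {γ : SL(2, ℤ) | γ • z ∈ 𝒟} with h | ⟨γ₀, h₀⟩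
  · rw [h]
    simp
  let E : List SL(2, ℤ) := [1, -1, T, -T, T⁻¹, -T⁻¹, S, -S, T * S, -(T * S), T⁻¹ * S * T⁻¹,
    -(T⁻¹ * S * T⁻¹), S * T⁻¹, -(S * T⁻¹), S * T, -(S * T), T * S * T, -(T * S * T),
    T⁻¹ * S, -(T⁻¹ * S)]
  have hsub : {γ : SL(2, ℤ) | γ • z ∈ 𝒟} ⊆ (fun δ ↦ δ * γ₀) '' (E.toFinset : Set SL(2, ℤ)) := by
    intro γ hγ
    refine ⟨γ * γ₀⁻¹, ?_, by simp⟩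
    have h1 : (γ * γ₀⁻¹) • γ₀ • z ∈ 𝒟 := by
      rw [smul_smul, inv_mul_cancel_right]
      exact hγ
    have := cases_of_mem_fd_smul_mem_fd h₀ h1
    generalize γ * γ₀⁻¹ = δ at this
    rw [Finset.mem_coe, List.mem_toFinset]
    simp only [E, List.mem_cons]
    rcases this with (h | h) | ⟨h | h, -⟩ | ⟨h | h, -⟩ | ⟨h | h, -⟩ | ⟨h | h, -⟩ | ⟨h | h, -⟩ |
      ⟨h | h, -⟩ | ⟨h | h, -⟩ | ⟨h | h, -⟩ | ⟨h | h, -⟩ <;>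
      simp only [h, true_or, or_true]
  have h2 : {γ : SL(2, ℤ) | γ • z ∈ 𝒟}.encard ≤ 20 := by
    refine (Set.encard_le_encard hsub).trans ((Set.encard_image_le _ _).trans ?_)
    rw [Set.encard_coe_eq_coe_finsetCard]
    have := E.toFinset_card_le
    exact_mod_cast this
  calc _ ≤ (((20 : ℕ∞) : ℕ∞) : ℝ≥0∞) := ENat.toENNReal_mono h2
    _ = 20 := by simp

/-! ### Counting translates in hyperbolic balls -/

open ModularGroup in
lemma exists_eq_T_zpow_mul {δ δ' : SL(2, ℤ)} (hc : δ 1 0 = δ' 1 0) (hd : δ 1 1 = δ' 1 1) :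
    ∃ j : ℤ, δ' = T ^ j * δ := by
  have h1 := Matrix.det_fin_two δ.1 ▸ δ.2
  have h2 := Matrix.det_fin_two δ'.1 ▸ δ'.2
  refine ⟨δ' 0 1 * δ 0 0 - δ' 0 0 * δ 0 1, ?_⟩
  ext i k
  rw [Matrix.SpecialLinearGroup.coe_mul, coe_T_zpow, Matrix.mul_apply]
  fin_cases i <;> fin_cases k <;> simp [Fin.sum_univ_two]
  · linear_combination (-(δ' 0 0)) * h1 + δ 0 0 * h2 - δ 0 0 * (δ' 0 1 * hc - δ' 0 0 * hd)
  · linear_combination (-(δ' 0 1)) * h1 + δ 0 1 * h2 - δ 0 1 * (δ' 0 1 * hc - δ' 0 0 * hd)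
  · exact hc.symm
  · exact hd.symm

/-- Imaginary parts in the ball agree with Im z up to a factor exp R, so |cy + d|² = Im y / Im δy ≤
exp(2R). The imaginary part of cy + d then bounds c, because Im z ≥ 1/2. -/
lemma abs_lowerRow_le {y z : ℍ} {δ : SL(2, ℤ)} {R : ℝ} (hz : 1 / 2 ≤ z.im)
    (hy : y ∈ Metric.ball z R) (hδ : δ • y ∈ Metric.ball z R) :
    |(δ 1 0 : ℝ)| ≤ 2 * Real.exp R ^ 2 ∧ |δ 1 0 * y.re + δ 1 1| ≤ Real.exp R := by
  have hyR : Real.exp (dist y z) ≤ Real.exp R := Real.exp_le_exp.mpr (Metric.mem_ball.mp hy).le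
  have hyR' : Real.exp (dist (δ • y) z) ≤ Real.exp R :=
    Real.exp_le_exp.mpr (Metric.mem_ball.mp hδ).le
  have h1 : y.im ≤ z.im * Real.exp R := (im_le_im_mul_exp_dist y z).trans (by gcongr)
  have h2 : z.im ≤ y.im * Real.exp R :=
    (im_le_im_mul_exp_dist z y).trans (by rw [dist_comm]; gcongr)
  have h3 : z.im ≤ (δ • y).im * Real.exp R :=
    (im_le_im_mul_exp_dist z _).trans (by rw [dist_comm]; gcongr)
  have hE := Real.exp_pos R
  set E := Real.exp R
  have hy0 := y.im_pos
  have hz0 := z.im_pos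
  rw [ModularGroup.im_smul_eq_div_normSq, ModularGroup.denom_apply] at h3
  set n := Complex.normSq ((δ 1 0 : ℂ) * y + δ 1 1) with hn
  have hn' : n = (δ 1 0 * y.re + δ 1 1) ^ 2 + (δ 1 0 * y.im) ^ 2 := by
    rw [hn, Complex.normSq_apply]
    simp
    ring
  have hn0 : 0 < n := by
    have := UpperHalfPlane.normSq_denom_pos (δ : GL (Fin 2) ℝ) y.im_ne_zero
    rwa [ModularGroup.denom_apply] at this
  have h4 : n ≤ E ^ 2 := by
    rw [div_mul_eq_mul_div, le_div_iff₀ hn0] at h3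
    have h5 : z.im * n ≤ z.im * E ^ 2 := by nlinarith
    exact le_of_mul_le_mul_left h5 hz0
  refine ⟨?_, abs_le_of_sq_le_sq (by nlinarith [sq_nonneg ((δ 1 0 : ℝ) * y.im)]) hE.le⟩
  have h6 : |(δ 1 0 : ℝ) * y.im| ≤ E :=
    abs_le_of_sq_le_sq (by nlinarith [sq_nonneg ((δ 1 0 : ℝ) * y.re + δ 1 1)]) hE.le
  rw [abs_mul, abs_of_pos hy0] at h6
  have h7 : |(δ 1 0 : ℝ)| * z.im ≤ E * E := by
    calc _ ≤ |(δ 1 0 : ℝ)| * (y.im * E) := by gcongr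
      _ = |(δ 1 0 : ℝ)| * y.im * E := by ring
      _ ≤ _ := by gcongr
  nlinarith [abs_nonneg (δ 1 0 : ℝ)]

lemma abs_re_sub_re_le {y z : ℍ} {R : ℝ} (hy : y ∈ Metric.ball z R) :
    |y.re - z.re| ≤ z.im * Real.exp R := by
  have h1 : |((y : ℂ) - z).re| ≤ dist (y : ℂ) z := by
    rw [Complex.dist_eq]
    exact Complex.abs_re_le_norm _
  have h2 := UpperHalfPlane.dist_coe_le y z
  have hyR : Real.exp (dist y z) ≤ Real.exp R := Real.exp_le_exp.mpr (Metric.mem_ball.mp hy).le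
  have hz0 := z.im_pos
  simp only [Complex.sub_re, coe_re] at h1
  refine (h1.trans h2).trans ?_
  gcongr
  linarith

open ModularGroup in
-- The element δ is determined by three integers: c, d + ⌊c Re y⌋ and ⌊Re(δy)/h⌋. Indeed, equal
-- lower rows force a difference T^j with h ∣ j, which shifts the last integer by j/h. The first two
-- take O(1) values, the third O(Im z/h + 1).
lemma exists_encard_conj_smul_mem_ball_le (R : ℝ) :
    ∃ C : ℝ, 0 ≤ C ∧ ∀ (G : Subgroup SL(2, ℤ)) (h : ℕ), 1 ≤ h →
      (∀ j : ℤ, T ^ j ∈ G → (h : ℤ) ∣ j) → ∀ z : ℍ, 1 / 2 ≤ z.im → ∀ y ∈ Metric.ball z R,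
      ({δ | δ ∈ G ∧ δ • y ∈ Metric.ball z R}.encard : ℝ≥0∞) ≤
        ENNReal.ofReal (C * (z.im / h + 1)) := by
  set E := Real.exp R with hE
  have hE0 : 0 < E := Real.exp_pos R
  set A : ℤ := ⌈2 * E ^ 2⌉ with hA
  -- The added 1 absorbs the rounding in ⌊c Re y⌋.
  set B : ℤ := ⌈E⌉ + 1 with hB
  have hA0 : 0 ≤ A := Int.ceil_nonneg (by positivity)
  have hB0 : 0 ≤ B := by have := Int.ceil_nonneg hE0.le; omega
  have hA0' : (0 : ℝ) ≤ A := by exact_mod_cast hA0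
  have hB0' : (0 : ℝ) ≤ B := by exact_mod_cast hB0
  refine ⟨(2 * A + 1) * (2 * B + 1) * (2 * E + 2), by positivity,
    fun G h hh hT z hz y hy ↦ ?_⟩
  have hh0 : (0 : ℝ) < h := by exact_mod_cast hh
  have hz0 := z.im_pos
  set l : ℤ := ⌊(z.re - z.im * E) / h⌋ with hl
  set u : ℤ := ⌊(z.re + z.im * E) / h⌋ with hu
  have hlu : l ≤ u := Int.floor_le_floor (by gcongr; nlinarith)
  let g : SL(2, ℤ) → ℤ × ℤ × ℤ := fun δ ↦
    (δ 1 0, δ 1 1 + ⌊δ 1 0 * y.re⌋, ⌊(δ • y).re / h⌋)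
  let box : Finset (ℤ × ℤ × ℤ) := Finset.Icc (-A) A ×ˢ Finset.Icc (-B) B ×ˢ Finset.Icc l u
  have hmaps : Set.MapsTo g {δ | δ ∈ G ∧ δ • y ∈ Metric.ball z R} box := by
    rintro δ ⟨-, hδ⟩
    obtain ⟨h1, h2⟩ := abs_lowerRow_le hz hy hδ
    have h3 := abs_re_sub_re_le hδ
    rw [abs_le] at h1 h2 h3
    have f1 := Int.floor_le ((δ 1 0 : ℝ) * y.re)
    have f2 := Int.lt_floor_add_one ((δ 1 0 : ℝ) * y.re)
    have c1 := Int.le_ceil E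
    have c2 := Int.le_ceil (2 * E ^ 2)
    simp only [box, g, Finset.coe_product, Set.mem_prod, Finset.coe_Icc, Set.mem_Icc]
    refine ⟨⟨?_, ?_⟩, ⟨?_, ?_⟩, ?_, ?_⟩
    · have : -(A : ℝ) ≤ δ 1 0 := by linarith
      exact_mod_cast this
    · have : (δ 1 0 : ℝ) ≤ A := by linarith
      exact_mod_cast this
    · have : -(B : ℝ) ≤ δ 1 1 + ⌊(δ 1 0 : ℝ) * y.re⌋ := by
        rw [hB]; push_cast; linarith
      exact_mod_cast this
    · have : (δ 1 1 : ℝ) + ⌊(δ 1 0 : ℝ) * y.re⌋ ≤ B := by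
        rw [hB]; push_cast; linarith
      exact_mod_cast this
    · exact Int.floor_le_floor (by gcongr; linarith)
    · exact Int.floor_le_floor (by gcongr; linarith)
  have hinj : Set.InjOn g {δ | δ ∈ G ∧ δ • y ∈ Metric.ball z R} := by
    rintro δ ⟨hδG, -⟩ δ' ⟨hδG', -⟩ hg
    simp only [g, Prod.mk.injEq] at hg
    obtain ⟨h1, h2, h3⟩ := hg
    rw [h1] at h2
    obtain ⟨j, rfl⟩ := exists_eq_T_zpow_mul h1 (by omega)
    have hj : T ^ j ∈ G := by
      have := G.mul_mem hδG' (G.inv_mem hδG)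
      rwa [mul_inv_cancel_right] at this
    obtain ⟨i, rfl⟩ := hT j hj
    rw [mul_smul, re_T_zpow_smul, add_div] at h3
    have h4 : ((((h : ℤ) * i : ℤ) : ℝ)) / h = i := by
      push_cast
      field_simp
    rw [h4, Int.floor_add_intCast] at h3
    have : i = 0 := by omega
    simp [this]
  have h5 : {δ | δ ∈ G ∧ δ • y ∈ Metric.ball z R}.encard ≤ (box.card : ℕ∞) := by
    rw [← Set.encard_coe_eq_coe_finsetCard]
    exact Set.encard_le_encard_of_injOn hmaps hinj
  refine (ENat.toENNReal_mono h5).trans ?_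
  rw [ENat.toENNReal_coe, ← ENNReal.ofReal_natCast]
  refine ENNReal.ofReal_le_ofReal ?_
  simp only [box, Finset.card_product, Int.card_Icc]
  push_cast
  have e1 : (((A + 1 - -A).toNat : ℕ) : ℝ) = 2 * A + 1 := by
    have : (((A + 1 - -A).toNat : ℕ) : ℤ) = 2 * A + 1 := by omega
    exact_mod_cast this
  have e2 : (((B + 1 - -B).toNat : ℕ) : ℝ) = 2 * B + 1 := by
    have : (((B + 1 - -B).toNat : ℕ) : ℤ) = 2 * B + 1 := by omega
    exact_mod_cast this
  have e3 : (((u + 1 - l).toNat : ℕ) : ℝ) = u + 1 - l := by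
    have : (((u + 1 - l).toNat : ℕ) : ℤ) = u + 1 - l := by omega
    exact_mod_cast this
  rw [e1, e2, e3, mul_assoc, mul_assoc]
  gcongr
  have f1 := Int.floor_le ((z.re + z.im * E) / h)
  have f2 := Int.lt_floor_add_one ((z.re - z.im * E) / h)
  rw [← hu] at f1
  rw [← hl] at f2
  have f3 : (z.re + z.im * E) / h - (z.re - z.im * E) / h = 2 * E * (z.im / h) := by ring
  have f4 : 0 ≤ z.im / h := by positivity
  nlinarith

open ModularGroup in
/-- In a ball around `σ • z` with `z` high up, the number of points in a `G`-orbit is bounded by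
`O(Im z / h + 1)`, where `h` is the width of the cusp `σ∞` of `G`. -/
lemma exists_encard_smul_mem_ball_le (R : ℝ) :
    ∃ C : ℝ, 0 ≤ C ∧ ∀ (G : Subgroup SL(2, ℤ)) (σ : SL(2, ℤ)) (h : ℕ), 1 ≤ h →
      (∀ j : ℤ, σ * T ^ j * σ⁻¹ ∈ G → (h : ℤ) ∣ j) → ∀ z : ℍ, 1 / 2 ≤ z.im → ∀ y : ℍ,
      ({γ | γ ∈ G ∧ γ • y ∈ Metric.ball (σ • z) R}.encard : ℝ≥0∞) ≤
        ENNReal.ofReal (C * (z.im / h + 1)) := by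
  obtain ⟨C, hC, H⟩ := exists_encard_conj_smul_mem_ball_le R
  refine ⟨C, hC, fun G σ h hh hT z hz y ↦ ?_⟩
  rcases Set.eq_empty_or_nonempty {γ | γ ∈ G ∧ γ • y ∈ Metric.ball (σ • z) R} with he | ⟨γ₀, hγ₀, h₀⟩
  · rw [he]
    simp
  have hb : ∀ x : ℍ, x ∈ Metric.ball (σ • z) R ↔ σ⁻¹ • x ∈ Metric.ball z R := fun x ↦ by
    rw [Metric.mem_ball, Metric.mem_ball, ← dist_SL2Z_smul σ (σ⁻¹ • x) z, smul_inv_smul]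
  -- Conjugation by σ moves the cusp to ∞. Dividing by one fixed γ₀ of the set replaces y by a point
  -- of the ball.
  let G' : Subgroup SL(2, ℤ) := G.comap (MulAut.conj σ).toMonoidHom
  have hG' : ∀ δ, δ ∈ G' ↔ σ * δ * σ⁻¹ ∈ G := fun δ ↦ Iff.rfl
  refine le_trans (ENat.toENNReal_mono ?_)
    (H G' h hh (fun j hj ↦ hT j hj) z hz (σ⁻¹ • γ₀ • y) ((hb _).mp h₀))
  refine Set.encard_le_encard_of_injOn (f := fun γ ↦ σ⁻¹ * γ * γ₀⁻¹ * σ) ?_ ?_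
  · rintro γ ⟨hγ, hγ'⟩
    refine ⟨?_, ?_⟩
    · rw [hG']
      have := G.mul_mem hγ (G.inv_mem hγ₀)
      convert this using 1
      group
    · rw [hb] at hγ'
      simp only [smul_smul] at hγ' ⊢
      convert hγ' using 2
      group
  · intro γ _ γ' _ h
    simpa using h

/-! ### Cusp forms for an automorphy factor -/

/-- In the variable q = e(τ/h) the line Im τ = h is the circle |q| = r = exp(-2π). The maximum
principle bounds g by K inside it, and since g vanishes at q = 0 the Schwarz lemma gains the factor
|q|/r. -/
lemma norm_le_exp_mul_of_periodic {g : ℍ → ℂ} {h : ℝ} (hh : 0 < h)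
    (hper : Function.Periodic (g ∘ ofComplex) h) (hg : MDifferentiable 𝓘(ℂ) 𝓘(ℂ) g)
    (h0 : IsZeroAtImInfty g) {K : ℝ} (hK : ∀ τ : ℍ, τ.im = h → ‖g τ‖ ≤ K) {τ : ℍ}
    (hτ : h ≤ τ.im) : ‖g τ‖ ≤ K * Real.exp (-2 * Real.pi * (τ.im / h - 1)) := by
  rcases hτ.eq_or_lt with hτ | hτ
  · rw [← hτ, div_self hh.ne']
    simpa using hK τ hτ.symm
  have hG : ∀ q : ℂ, ‖q‖ < 1 → DifferentiableAt ℂ (cuspFunction h g) q := fun q hq ↦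
    differentiableAt_cuspFunction hh hper hg h0.isBoundedAtImInfty hq
  have hG0 : cuspFunction h g 0 = 0 := h0.cuspFunction_apply_zero hh
  set r := Real.exp (-2 * Real.pi) with hr
  have hr0 : 0 < r := Real.exp_pos _
  have hr1 : r < 1 := by
    rw [hr, Real.exp_lt_one_iff]
    linarith [Real.pi_pos]
  have hball : ∀ q ∈ closure (Metric.ball (0 : ℂ) r), ‖cuspFunction h g q‖ ≤ K := by
    intro q hq
    refine Complex.norm_le_of_forall_mem_frontier_norm_le Metric.isBounded_ball ?_ ?_ hq
    · refine DifferentiableOn.diffContOnCl fun q hq ↦ (hG q ?_).differentiableWithinAt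
      rw [closure_ball _ hr0.ne', mem_closedBall_zero_iff] at hq
      linarith
    · intro q hq
      rw [frontier_ball _ hr0.ne', mem_sphere_zero_iff_norm] at hq
      have hq0 : q ≠ 0 := norm_ne_zero_iff.mp (by rw [hq]; exact hr0.ne')
      have him : (Function.Periodic.invQParam h q).im = h := by
        rw [Function.Periodic.im_invQParam, hq, hr, Real.log_exp]
        field_simp
      have hpos : 0 < (Function.Periodic.invQParam h q).im := by rw [him]; exact hh
      rw [← Function.Periodic.qParam_right_inv hh.ne' hq0]
      have := eq_cuspFunction ⟨_, hpos⟩ hh.ne' hper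
      rw [UpperHalfPlane.coe_mk] at this
      rw [this]
      exact hK _ him
  have hq : ‖Function.Periodic.qParam h (τ : ℂ)‖ = Real.exp (-2 * Real.pi * τ.im / h) := by
    rw [Function.Periodic.norm_qParam]
    rfl
  have hqr : ‖Function.Periodic.qParam h (τ : ℂ)‖ < r := by
    rw [hq, hr]
    refine Real.exp_lt_exp.mpr ?_
    rw [div_lt_iff₀ hh]
    nlinarith [Real.pi_pos]
  have := Complex.dist_le_div_mul_dist_of_mapsTo_ball (f := cuspFunction h g) (c := 0)
    (R₁ := r) (R₂ := K) (z := Function.Periodic.qParam h (τ : ℂ))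
    (fun q hq ↦ (hG q (by rw [mem_ball_zero_iff] at hq; linarith)).differentiableWithinAt)
    (fun q hq ↦ by
      rw [hG0, mem_closedBall_zero_iff]
      exact hball q (subset_closure hq)) (by simpa using hqr)
  rw [hG0, dist_zero_right, dist_zero_right, eq_cuspFunction τ hh.ne' hper, hq] at this
  refine this.trans (le_of_eq ?_)
  rw [hr, div_mul_eq_mul_div, mul_div_assoc, ← Real.exp_sub]
  congr 2
  ring

/-- A system of holomorphic factors of automorphy of weight `w / 2` on `Γ`. -/
structure IsAutomorphyFactor (Γ : Subgroup SL(2, ℤ)) (w : ℕ) (J : SL(2, ℤ) → ℍ → ℂ) : Prop where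
  mdifferentiable : ∀ γ ∈ Γ, MDifferentiable 𝓘(ℂ) 𝓘(ℂ) (J γ)
  mul : ∀ γ ∈ Γ, ∀ δ ∈ Γ, ∀ τ, J (γ * δ) τ = J γ (δ • τ) * J δ τ
  pow_four : ∀ γ ∈ Γ, ∀ τ, J γ τ ^ 4 = denom γ τ ^ (2 * w)

/-- `f` is a cusp form on `Γ` for the factors of automorphy `J`, of weight `w / 2`. -/
structure IsCuspFormFor (Γ : Subgroup SL(2, ℤ)) (w : ℕ) (J : SL(2, ℤ) → ℍ → ℂ) (f : ℍ → ℂ) :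
    Prop where
  mdifferentiable : MDifferentiable 𝓘(ℂ) 𝓘(ℂ) f
  smul_eq : ∀ γ ∈ Γ, ∀ τ, f (γ • τ) = J γ τ * f τ
  zero : ∀ σ : SL(2, ℤ),
    IsZeroAtImInfty fun τ ↦ ‖denom σ τ‖ ^ (-(w / 2 : ℝ)) * ‖f (σ • τ)‖

/-- The subgroup generated by `Γ` and `-1`. -/
abbrev plusMinus (Γ : Subgroup SL(2, ℤ)) : Subgroup SL(2, ℤ) := Γ ⊔ Subgroup.zpowers (-1)

lemma norm_denom_pos (σ : SL(2, ℤ)) (τ : ℍ) : 0 < ‖denom σ τ‖ :=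
  norm_pos_iff.mpr (denom_ne_zero σ τ)

lemma IsAutomorphyFactor.norm_eq {Γ : Subgroup SL(2, ℤ)} {w : ℕ} {J : SL(2, ℤ) → ℍ → ℂ}
    (hJ : IsAutomorphyFactor Γ w J) {γ : SL(2, ℤ)} (hγ : γ ∈ Γ) (τ : ℍ) :
    ‖J γ τ‖ = ‖denom γ τ‖ ^ (w / 2 : ℝ) := by
  have h1 := congrArg norm (hJ.pow_four γ hγ τ)
  rw [norm_pow, norm_pow] at h1
  refine (pow_left_inj₀ (norm_nonneg _) (by positivity) (by norm_num : 4 ≠ 0)).mp ?_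
  rw [h1, ← Real.rpow_natCast, ← Real.rpow_natCast, ← Real.rpow_mul (norm_nonneg _)]
  congr 1
  push_cast
  ring

lemma im_SL2Z_smul (σ : SL(2, ℤ)) (τ : ℍ) : (σ • τ).im = τ.im / ‖denom σ τ‖ ^ 2 := by
  rw [ModularGroup.im_smul_eq_div_normSq, Complex.normSq_eq_norm_sq]

lemma im_SL2Z_smul_rpow (σ : SL(2, ℤ)) (τ : ℍ) (s : ℝ) :
    (σ • τ).im ^ s = τ.im ^ s * ‖denom σ τ‖ ^ (-(2 * s)) := by
  rw [im_SL2Z_smul, Real.div_rpow τ.im_pos.le (by positivity), div_eq_mul_inv,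
    Real.rpow_neg (norm_nonneg _), Real.rpow_mul (norm_nonneg _)]
  norm_cast

lemma weightedNorm_eq_ofReal (s : ℝ) (f : ℍ → ℂ) (τ : ℍ) :
    weightedNorm s f τ = ENNReal.ofReal (‖f τ‖ * τ.im ^ s) := by
  rw [weightedNorm, ENNReal.ofReal_mul (norm_nonneg _), ofReal_norm]

lemma weightedNorm_sq (w : ℕ) (f : ℍ → ℂ) (τ : ℍ) :
    weightedNorm (w / 2) (f ^ 2) τ = weightedNorm (w / 4) f τ ^ 2 := by
  have := τ.im_pos
  rw [weightedNorm_eq_ofReal, weightedNorm_eq_ofReal, ← ENNReal.ofReal_pow (by positivity),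
    Pi.pow_apply, norm_pow, mul_pow, ← Real.rpow_natCast, ← Real.rpow_natCast (τ.im ^ _),
    ← Real.rpow_mul this.le]
  congr 3
  push_cast
  ring

lemma weightedNorm_SL2Z_smul (s : ℝ) (f : ℍ → ℂ) (σ : SL(2, ℤ)) (τ : ℍ) :
    weightedNorm s f (σ • τ) =
      ENNReal.ofReal (‖denom σ τ‖ ^ (-(2 * s)) * ‖f (σ • τ)‖ * τ.im ^ s) := by
  rw [weightedNorm_eq_ofReal, im_SL2Z_smul_rpow]
  congr 1
  ring

/-- The stabilizer of a function on the upper half-plane. -/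
def invarianceSubgroup (ψ : ℍ → ℝ≥0∞) : Subgroup SL(2, ℤ) where
  carrier := {γ | ∀ τ, ψ (γ • τ) = ψ τ}
  mul_mem' {γ δ} hγ hδ τ := by rw [mul_smul, hγ, hδ]
  one_mem' τ := by rw [one_smul]
  inv_mem' {γ} hγ τ := by rw [← hγ, smul_inv_smul]

lemma weightedNorm_smul_of_mem_plusMinus {Γ : Subgroup SL(2, ℤ)} {w : ℕ} {J : SL(2, ℤ) → ℍ → ℂ}
    (hJ : IsAutomorphyFactor Γ w J) {f : ℍ → ℂ} (hf : ∀ γ ∈ Γ, ∀ τ, f (γ • τ) = J γ τ * f τ)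
    {γ : SL(2, ℤ)} (hγ : γ ∈ plusMinus Γ) (τ : ℍ) :
    weightedNorm (w / 4) f (γ • τ) = weightedNorm (w / 4) f τ := by
  suffices plusMinus Γ ≤ invarianceSubgroup (weightedNorm (w / 4) f) from this hγ τ
  refine sup_le (fun γ hγ τ ↦ ?_) ((Subgroup.zpowers_le).mpr fun τ ↦ ?_)
  · have h := norm_denom_pos γ τ
    rw [weightedNorm_SL2Z_smul, hf γ hγ, norm_mul, hJ.norm_eq hγ, ← mul_assoc,
      ← Real.rpow_add h, weightedNorm_eq_ofReal,
      show -(2 * ((w : ℝ) / 4)) + w / 2 = 0 by ring, Real.rpow_zero, one_mul]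
  · rw [ModularGroup.SL_neg_smul, one_smul]

/-- The sub-mean value property on a unit ball, combined with the orbit count. It is applied with s
= w/2 to f² (a bound by the L² norm) and with s = w/4 to Poincaré series (a bound by the L¹ norm).
-/
lemma exists_weightedNorm_le_cosetSum (s : ℝ) :
    ∃ C : ℝ≥0∞, C ≠ ⊤ ∧ ∀ (G : Subgroup SL(2, ℤ)) (f : ℍ → ℂ), MDifferentiable 𝓘(ℂ) 𝓘(ℂ) f →
      (∀ γ ∈ G, ∀ τ, weightedNorm s f (γ • τ) = weightedNorm s f τ) →
      ∀ (σ : SL(2, ℤ)) (h : ℕ), 1 ≤ h →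
      (∀ j : ℤ, σ * ModularGroup.T ^ j * σ⁻¹ ∈ G → (h : ℤ) ∣ j) → ∀ z : ℍ, 1 / 2 ≤ z.im →
      weightedNorm s f (σ • z) ≤ C * ENNReal.ofReal (z.im / h + 1) *
        ∫⁻ z in 𝒟, cosetSum G (weightedNorm s f) z := by
  obtain ⟨C₁, hC₁, H₁⟩ := exists_weightedNorm_le_lintegral_ball s
  obtain ⟨C₂, hC₂, H₂⟩ := exists_encard_smul_mem_ball_le 1
  refine ⟨C₁ * ENNReal.ofReal C₂, ENNReal.mul_ne_top hC₁ ENNReal.ofReal_ne_top,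
    fun G f hf hG σ h hh hT z hz ↦ ?_⟩
  refine (H₁ f hf (σ • z)).trans ?_
  rw [mul_assoc, mul_assoc]
  refine mul_le_mul' le_rfl ?_
  rw [← mul_assoc, ← ENNReal.ofReal_mul hC₂]
  exact setLIntegral_le_mul_lintegral_fd_cosetSum (measurable_weightedNorm s hf.continuous) hG
    Metric.isOpen_ball.measurableSet (H₂ G σ h hh hT z hz)

open ModularGroup in
-- The exponents j form a subgroup of ℤ, nonzero by finite index; h is its positive generator.
lemma exists_width (G : Subgroup SL(2, ℤ)) [G.FiniteIndex] (σ : SL(2, ℤ)) :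
    ∃ h : ℕ, 1 ≤ h ∧ σ * T ^ h * σ⁻¹ ∈ G ∧ ∀ j : ℤ, σ * T ^ j * σ⁻¹ ∈ G → (h : ℤ) ∣ j := by
  let e : Multiplicative ℤ →* SL(2, ℤ) := (MulAut.conj σ).toMonoidHom.comp (zpowersHom _ T)
  let A : AddSubgroup ℤ := Subgroup.toAddSubgroup' (G.comap e)
  have hA : ∀ j : ℤ, j ∈ A ↔ σ * T ^ j * σ⁻¹ ∈ G := fun j ↦ Iff.rfl
  obtain ⟨a, ha⟩ := Int.subgroup_cyclic A
  rw [← AddSubgroup.zmultiples_eq_closure] at ha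
  obtain ⟨n, hn, hn'⟩ := G.exists_pow_mem_of_index_ne_zero Subgroup.FiniteIndex.index_ne_zero
    (σ * T * σ⁻¹)
  have hnA : (n : ℤ) ∈ A := by
    rw [hA, zpow_natCast, ← conj_pow]
    exact hn'.2
  refine ⟨a.natAbs, ?_, ?_, fun j hj ↦ ?_⟩
  · rw [Nat.one_le_iff_ne_zero, Int.natAbs_ne_zero]
    rintro rfl
    rw [ha, AddSubgroup.mem_zmultiples_iff] at hnA
    obtain ⟨k, hk⟩ := hnA
    simp at hk
    omega
  · rw [← zpow_natCast, ← hA, ha]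
    rcases Int.natAbs_eq a with h | h
    · rw [← h]
      exact AddSubgroup.mem_zmultiples a
    · rw [← neg_eq_iff_eq_neg.mpr h]
      exact neg_mem (AddSubgroup.mem_zmultiples a)
  · rw [← hA, ha, AddSubgroup.mem_zmultiples_iff] at hj
    obtain ⟨k, rfl⟩ := hj
    rw [Int.natAbs_dvd]
    exact ⟨k, by simp [mul_comm]⟩

namespace IsCuspFormFor

variable {Γ : Subgroup SL(2, ℤ)} {w : ℕ} {J : SL(2, ℤ) → ℍ → ℂ} {f : ℍ → ℂ}

/-- Passing to f⁴ removes the multiplier and the square root: J⁴ is an integral power of the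
denominator, and the weight 2w is even, so -1 acts trivially. -/
lemma pow_four_slash (hJ : IsAutomorphyFactor Γ w J) (hf : IsCuspFormFor Γ w J f)
    {γ : SL(2, ℤ)} (hγ : γ ∈ plusMinus Γ) : (f ^ 4) ∣[(2 * w : ℤ)] γ = f ^ 4 := by
  let X : Subgroup SL(2, ℤ) :=
    { carrier := {γ | (f ^ 4) ∣[(2 * w : ℤ)] γ = f ^ 4}
      mul_mem' := fun {γ δ} hγ hδ ↦ by
        change _ ∣[(2 * w : ℤ)] (γ * δ) = _
        rw [SlashAction.slash_mul, hγ, hδ]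
      one_mem' := SlashAction.slash_one _ _
      inv_mem' := fun {γ} hγ ↦ by
        change _ ∣[(2 * w : ℤ)] γ⁻¹ = _
        have h : (f ^ 4) ∣[(2 * w : ℤ)] γ = f ^ 4 := hγ
        conv_lhs => rw [← h]
        rw [← SlashAction.slash_mul, mul_inv_cancel, SlashAction.slash_one] }
  suffices plusMinus Γ ≤ X from this hγ
  refine sup_le (fun γ hγ ↦ ?_) ((Subgroup.zpowers_le).mpr ?_)
  · ext τ
    have h0 := denom_ne_zero γ τ
    rw [ModularForm.SL_slash_apply, Pi.pow_apply, Pi.pow_apply, hf.smul_eq γ hγ, mul_pow,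
      hJ.pow_four γ hγ, zpow_neg]
    have : denom γ τ ^ (2 * (w : ℤ)) = denom γ τ ^ (2 * w) := by norm_cast
    rw [this]
    field_simp
  · ext τ
    rw [ModularForm.SL_slash_apply, ModularGroup.SL_neg_smul, one_smul, ModularGroup.denom_apply]
    simp [zpow_mul]

lemma mdifferentiable_slash (hf : IsCuspFormFor Γ w J f) (σ : SL(2, ℤ)) :
    MDifferentiable 𝓘(ℂ) 𝓘(ℂ) ((f ^ 4) ∣[(2 * w : ℤ)] σ) :=
  MDifferentiable.slash (hf.mdifferentiable.pow 4) _ _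

lemma periodic_slash (hJ : IsAutomorphyFactor Γ w J) (hf : IsCuspFormFor Γ w J f)
    {σ : SL(2, ℤ)} {h : ℕ} (hσ : σ * ModularGroup.T ^ h * σ⁻¹ ∈ plusMinus Γ) :
    Function.Periodic (((f ^ 4) ∣[(2 * w : ℤ)] σ) ∘ ofComplex) (h : ℝ) := by
  have h1 : ((f ^ 4) ∣[(2 * w : ℤ)] σ) ∣[(2 * w : ℤ)] (ModularGroup.T ^ h) =
      (f ^ 4) ∣[(2 * w : ℤ)] σ := by
    rw [← SlashAction.slash_mul]
    conv_rhs => rw [← hf.pow_four_slash hJ hσ]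
    rw [← SlashAction.slash_mul, inv_mul_cancel_right]
  intro z
  by_cases hz : 0 < z.im
  · have hz' : 0 < (z + (h : ℝ)).im := by simpa using hz
    simp only [Function.comp_apply, ofComplex_apply_of_im_pos hz, ofComplex_apply_of_im_pos hz']
    have h2 := congrFun h1 ⟨z, hz⟩
    rw [ModularForm.SL_slash_apply] at h2
    have h3 : denom (ModularGroup.T ^ h : SL(2, ℤ)) (⟨z, hz⟩ : ℍ) = 1 := by
      rw [ModularGroup.denom_apply, ← zpow_natCast, ModularGroup.coe_T_zpow]
      simp
    rw [h3, one_zpow, mul_one] at h2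
    rw [← h2]
    change ((f ^ 4) ∣[(2 * w : ℤ)] σ) _ = ((f ^ 4) ∣[(2 * w : ℤ)] σ) _
    refine congrArg _ (UpperHalfPlane.ext ?_)
    rw [← zpow_natCast, ModularGroup.coe_T_zpow_smul_eq]
    simp
  · have hz' : ¬ 0 < (z + (h : ℝ)).im := by simpa using hz
    simp only [Function.comp_apply, ofComplex_apply_of_im_nonpos (not_lt.mp hz),
      ofComplex_apply_of_im_nonpos (not_lt.mp hz')]

lemma norm_slash (f : ℍ → ℂ) (w : ℕ) (σ : SL(2, ℤ)) (τ : ℍ) :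
    ‖((f ^ 4) ∣[(2 * w : ℤ)] σ) τ‖ = (‖denom σ τ‖ ^ (-(w / 2 : ℝ)) * ‖f (σ • τ)‖) ^ 4 := by
  rw [ModularForm.SL_slash_apply, norm_mul, Pi.pow_apply, norm_pow, norm_zpow, mul_pow, mul_comm]
  congr 1
  rw [← Real.rpow_natCast, ← Real.rpow_mul (norm_nonneg _), ← Real.rpow_intCast]
  congr 1
  push_cast
  ring

lemma zero_slash (hf : IsCuspFormFor Γ w J f) (σ : SL(2, ℤ)) :
    IsZeroAtImInfty ((f ^ 4) ∣[(2 * w : ℤ)] σ) := by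
  have h1 := (hf.zero σ).pow 4
  rw [zero_pow (by norm_num)] at h1
  rw [IsZeroAtImInfty, Filter.ZeroAtFilter, tendsto_zero_iff_norm_tendsto_zero]
  refine h1.congr fun τ ↦ ?_
  rw [norm_slash]

lemma weightedNorm_smul_sq (f : ℍ → ℂ) (w : ℕ) (σ : SL(2, ℤ)) (τ : ℍ) :
    weightedNorm (w / 2) (f ^ 2) (σ • τ) ^ 2 =
      ENNReal.ofReal (‖((f ^ 4) ∣[(2 * w : ℤ)] σ) τ‖ * τ.im ^ w) := by
  have hv := τ.im_pos
  rw [weightedNorm_SL2Z_smul, ← ENNReal.ofReal_pow (by positivity), norm_slash, Pi.pow_apply,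
    norm_pow]
  congr 1
  have h1 : ‖denom σ τ‖ ^ (-(2 * ((w : ℝ) / 2))) = (‖denom σ τ‖ ^ (-(w / 2 : ℝ))) ^ 2 := by
    rw [← Real.rpow_natCast, ← Real.rpow_mul (norm_nonneg _)]
    congr 1
    push_cast
    ring
  have h2 : τ.im ^ w = (τ.im ^ ((w : ℝ) / 2)) ^ 2 := by
    rw [← Real.rpow_natCast, ← Real.rpow_natCast, ← Real.rpow_mul hv.le]
    congr 1
    push_cast
    ring
  rw [h1, h2]
  ring

end IsCuspFormFor

/-! ### Cusp forms are bounded uniformly by their norm -/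

lemma pow_mul_exp_le (w : ℕ) {t : ℝ} (ht : 1 ≤ t) :
    t ^ w * Real.exp (-2 * Real.pi * (t - 1)) ≤ w.factorial * Real.exp 1 := by
  have h1 := Real.pow_div_factorial_le_exp t (by linarith) w
  rw [div_le_iff₀ (by positivity)] at h1
  -- t - 2π(t - 1) ≤ 1 for t ≥ 1, since 2π > 1.
  have h2 : Real.exp t * Real.exp (-2 * Real.pi * (t - 1)) ≤ Real.exp 1 := by
    rw [← Real.exp_add]
    refine Real.exp_le_exp.mpr ?_
    nlinarith [Real.pi_gt_three]
  calc _ ≤ Real.exp t * w.factorial * Real.exp (-2 * Real.pi * (t - 1)) := by gcongr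
    _ = w.factorial * (Real.exp t * Real.exp (-2 * Real.pi * (t - 1))) := by ring
    _ ≤ _ := by gcongr

/-- The square of the Petersson norm, as an extended real number. -/
def peterssonNormSq (Γ : Subgroup SL(2, ℤ)) (w : ℕ) (f : ℍ → ℂ) : ℝ≥0∞ :=
  ∫⁻ z in 𝒟, cosetSum (plusMinus Γ) (weightedNorm (w / 2) (f ^ 2)) z

instance (Γ : Subgroup SL(2, ℤ)) [Γ.FiniteIndex] : (plusMinus Γ).FiniteIndex :=
  Subgroup.finiteIndex_of_le le_sup_left

lemma IsCuspFormFor.weightedNorm_sq_smul {Γ : Subgroup SL(2, ℤ)} {w : ℕ}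
    {J : SL(2, ℤ) → ℍ → ℂ} {f : ℍ → ℂ} (hJ : IsAutomorphyFactor Γ w J)
    (hf : IsCuspFormFor Γ w J f) {γ : SL(2, ℤ)} (hγ : γ ∈ plusMinus Γ) (τ : ℍ) :
    weightedNorm (w / 2) (f ^ 2) (γ • τ) = weightedNorm (w / 2) (f ^ 2) τ := by
  rw [weightedNorm_sq, weightedNorm_sq, weightedNorm_smul_of_mem_plusMinus hJ hf.smul_eq hγ]

/-- Cusp forms are bounded by their Petersson norm, uniformly in the group. -/
theorem exists_weightedNorm_sq_le_peterssonNormSq (w : ℕ) :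
    ∃ C : ℝ≥0∞, C ≠ ⊤ ∧ ∀ (Γ : Subgroup SL(2, ℤ)) [Γ.FiniteIndex] (J : SL(2, ℤ) → ℍ → ℂ),
      IsAutomorphyFactor Γ w J → ∀ f, IsCuspFormFor Γ w J f → ∀ τ,
      weightedNorm (w / 2) (f ^ 2) τ ≤ C * peterssonNormSq Γ w f := by
  obtain ⟨C, hC, H⟩ := exists_weightedNorm_le_cosetSum (w / 2)
  set D : ℝ := w.factorial * Real.exp 1 with hD
  have hD1 : 1 ≤ D := by
    have h1 : (1 : ℝ) ≤ w.factorial := by exact_mod_cast Nat.factorial_pos w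
    have h2 := Real.add_one_le_exp (1 : ℝ)
    nlinarith
  refine ⟨ENNReal.ofReal D * (C * 2), ENNReal.mul_ne_top ENNReal.ofReal_ne_top
    (ENNReal.mul_ne_top hC (by norm_num)), fun Γ _ J hJ f hf τ ↦ ?_⟩
  obtain ⟨g, hg⟩ := ModularGroup.exists_smul_mem_fd τ
  obtain ⟨h, hh, hhG, hT⟩ := exists_width (plusMinus Γ) g⁻¹
  have hh0 : (0 : ℝ) < h := by exact_mod_cast hh
  have hh1 : (1 : ℝ) ≤ h := by exact_mod_cast hh
  -- Up to the height of the cusp width, the orbit count Im z/h + 1 is at most 2.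
  have low : ∀ z : ℍ, 1 / 2 ≤ z.im → z.im ≤ h → weightedNorm (w / 2) (f ^ 2) (g⁻¹ • z) ≤
      C * 2 * peterssonNormSq Γ w f := fun z hz hz' ↦ by
    refine (H (plusMinus Γ) (f ^ 2) (hf.mdifferentiable.pow 2)
      (fun γ hγ τ ↦ hf.weightedNorm_sq_smul hJ hγ τ) g⁻¹ h hh hT z hz).trans ?_
    rw [peterssonNormSq]
    gcongr
    rw [show (2 : ℝ≥0∞) = ENNReal.ofReal 2 by simp]
    refine ENNReal.ofReal_le_ofReal ?_
    have : z.im / h ≤ 1 := (div_le_one hh0).mpr hz'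
    linarith
  have hτ : τ = g⁻¹ • g • τ := by rw [inv_smul_smul]
  set z := g • τ with hz
  have hzim : 1 / 2 ≤ z.im := by
    have := ModularGroup.three_le_four_mul_im_sq_of_mem_fd hg
    nlinarith [z.im_pos]
  rw [hτ]
  have hD1' : 1 ≤ ENNReal.ofReal D := by
    rw [← ENNReal.ofReal_one]
    exact ENNReal.ofReal_le_ofReal hD1
  rcases le_total z.im h with hzh | hzh
  · refine (low z hzim hzh).trans ?_
    rw [mul_assoc (ENNReal.ofReal D)]
    exact le_mul_of_one_le_left' hD1'
  · by_cases htop : C * 2 * peterssonNormSq Γ w f = ⊤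
    · rw [mul_assoc (ENNReal.ofReal D), htop, ENNReal.mul_top]
      · exact le_top
      · exact (zero_lt_one.trans_le hD1').ne'
    obtain ⟨M, hM⟩ : ∃ M : NNReal, (M : ℝ≥0∞) = C * 2 * peterssonNormSq Γ w f :=
      ⟨_, ENNReal.coe_toNNReal htop⟩
    -- The bound on the line Im = h, rewritten for f⁴|σ, is the input of the Schwarz lemma. The
    -- denominator h^w will turn (Im z)^w into (Im z/h)^w, so the final constant does not depend on
    -- h.
    have hK : ∀ τ : ℍ, τ.im = h → ‖((f ^ 4) ∣[(2 * w : ℤ)] g⁻¹) τ‖ ≤ (M : ℝ) ^ 2 / h ^ w := by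
      intro τ hτ
      have h1 := low τ (by linarith) hτ.le
      have h2 : weightedNorm (w / 2) (f ^ 2) (g⁻¹ • τ) ^ 2 ≤ (M : ℝ≥0∞) ^ 2 := by
        rw [hM]
        gcongr
      rw [IsCuspFormFor.weightedNorm_smul_sq, hτ, ← ENNReal.coe_pow,
        ENNReal.ofReal_le_iff_le_toReal ENNReal.coe_ne_top] at h2
      rw [le_div_iff₀ (by positivity)]
      simpa using h2
    have h3 := norm_le_exp_mul_of_periodic hh0 (hf.periodic_slash hJ hhG)
      (hf.mdifferentiable_slash g⁻¹) (hf.zero_slash g⁻¹) hK hzh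
    have h4 : weightedNorm (w / 2) (f ^ 2) (g⁻¹ • z) ^ 2 ≤
        (ENNReal.ofReal D * (C * 2 * peterssonNormSq Γ w f)) ^ 2 := by
      rw [IsCuspFormFor.weightedNorm_smul_sq, ← hM, ← ENNReal.ofReal_coe_nnreal,
        ← ENNReal.ofReal_mul (by positivity), ← ENNReal.ofReal_pow (by positivity)]
      refine ENNReal.ofReal_le_ofReal ?_
      calc _ ≤ (M : ℝ) ^ 2 / h ^ w * Real.exp (-2 * Real.pi * (z.im / h - 1)) * z.im ^ w := by
            have := z.im_pos
            gcongr
        _ = (M : ℝ) ^ 2 * ((z.im / h) ^ w * Real.exp (-2 * Real.pi * (z.im / h - 1))) := by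
            rw [div_pow]
            ring
        _ ≤ (M : ℝ) ^ 2 * D := by
            gcongr
            exact pow_mul_exp_le w ((one_le_div hh0).mpr hzh)
        _ ≤ _ := by
            rw [mul_pow, mul_comm]
            gcongr
            nlinarith
    rw [mul_assoc (ENNReal.ofReal D)]
    exact (ENNReal.pow_le_pow_left_iff two_ne_zero).mp h4

/-- A bound depending on f and Γ, needed only to make Petersson products converge. It follows from
exponential decay high up and compactness of the truncated fundamental domain. -/
lemma IsCuspFormFor.exists_weightedNorm_smul_le {Γ : Subgroup SL(2, ℤ)} [Γ.FiniteIndex] {w : ℕ}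
    {J : SL(2, ℤ) → ℍ → ℂ} {f : ℍ → ℂ} (hJ : IsAutomorphyFactor Γ w J)
    (hf : IsCuspFormFor Γ w J f) (σ : SL(2, ℤ)) :
    ∃ K : ℝ≥0∞, K ≠ ⊤ ∧ ∀ z ∈ 𝒟, weightedNorm (w / 2) (f ^ 2) (σ • z) ≤ K := by
  obtain ⟨h, hh, hhG, -⟩ := exists_width (plusMinus Γ) σ
  have hh0 : (0 : ℝ) < h := by exact_mod_cast hh
  set g := (f ^ 4) ∣[(2 * w : ℤ)] σ with hg
  have hgd : MDifferentiable 𝓘(ℂ) 𝓘(ℂ) g := hf.mdifferentiable_slash σ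
  have h1 := (hf.zero_slash σ).exp_decay_atImInfty hh0 (hf.periodic_slash hJ hhG) hgd
    (hf.zero_slash σ).isBoundedAtImInfty
  have h2 : Filter.Tendsto (fun τ : ℍ ↦ ‖g τ‖ * τ.im ^ w) atImInfty (nhds 0) := by
    have h3 : Filter.Tendsto (fun t : ℝ ↦ t ^ w * Real.exp (-(2 * Real.pi / h) * t)) Filter.atTop
        (nhds 0) := by
      have := tendsto_rpow_mul_exp_neg_mul_atTop_nhds_zero w (2 * Real.pi / h) (by positivity)
      simpa [Real.rpow_natCast] using this
    have h4 := h1.norm_left.mul (Asymptotics.isBigO_refl (fun τ : ℍ ↦ τ.im ^ w) atImInfty)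
    refine h4.trans_tendsto ((h3.comp Filter.tendsto_comap).congr fun τ ↦ ?_)
    simp only [Function.comp_apply]
    rw [mul_comm]
    congr 2
    ring
  obtain ⟨A, hA⟩ := (atImInfty_mem _).mp (h2.eventually_le_const zero_lt_one)
  have hcont : Continuous fun τ : ℍ ↦ ‖g τ‖ * τ.im ^ w :=
    hgd.continuous.norm.mul (UpperHalfPlane.continuous_im.pow w)
  obtain ⟨B, hB⟩ := ((ModularGroup.isCompact_truncatedFundamentalDomain A).image
    hcont).isBounded.bddAbove
  refine ⟨ENNReal.ofReal (max 1 B) + 1, by simp, fun z hz ↦ ?_⟩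
  have h5 : ‖g z‖ * z.im ^ w ≤ max 1 B := by
    rcases le_total A z.im with h | h
    · exact (hA z h).trans (le_max_left _ _)
    · exact (hB ⟨z, ⟨hz, h⟩, rfl⟩).trans (le_max_right _ _)
  have h6 : weightedNorm (w / 2) (f ^ 2) (σ • z) ^ 2 ≤ (ENNReal.ofReal (max 1 B) + 1) ^ 2 := by
    rw [IsCuspFormFor.weightedNorm_smul_sq]
    refine (ENNReal.ofReal_le_ofReal h5).trans ?_
    rw [sq]
    exact le_self_add.trans (le_mul_of_one_le_left' le_add_self)
  exact (ENNReal.pow_le_pow_left_iff two_ne_zero).mp h6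

lemma lintegral_fd_cosetSum (Γ : Subgroup SL(2, ℤ)) [Γ.FiniteIndex] {ψ : ℍ → ℝ≥0∞}
    (hψ : Measurable ψ) : ∫⁻ z in 𝒟, cosetSum (plusMinus Γ) ψ z =
      ∑' q : SL(2, ℤ) ⧸ plusMinus Γ, ∫⁻ z in 𝒟, ψ (q.out⁻¹ • z) := by
  have : Countable (SL(2, ℤ) ⧸ plusMinus Γ) := Quotient.countable
  unfold cosetSum
  exact lintegral_tsum fun q ↦ (hψ.comp (measurable_SL2Z_smul _)).aemeasurable

lemma IsCuspFormFor.peterssonNormSq_ne_top {Γ : Subgroup SL(2, ℤ)} [Γ.FiniteIndex] {w : ℕ}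
    {J : SL(2, ℤ) → ℍ → ℂ} {f : ℍ → ℂ} (hJ : IsAutomorphyFactor Γ w J)
    (hf : IsCuspFormFor Γ w J f) : peterssonNormSq Γ w f ≠ ⊤ := by
  have : Finite (SL(2, ℤ) ⧸ plusMinus Γ) := Subgroup.finite_quotient_of_finiteIndex
  have := Fintype.ofFinite (SL(2, ℤ) ⧸ plusMinus Γ)
  have hfm : Measurable (weightedNorm (w / 2) (f ^ 2)) :=
    measurable_weightedNorm _ (hf.mdifferentiable.pow 2).continuous
  rw [peterssonNormSq, lintegral_fd_cosetSum Γ hfm, tsum_fintype]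
  refine ENNReal.sum_ne_top.mpr fun q _ ↦ ?_
  obtain ⟨K, hK, hK'⟩ := hf.exists_weightedNorm_smul_le hJ q.out⁻¹
  refine ne_top_of_le_ne_top (ENNReal.mul_ne_top hK volume_fd_ne_top) ?_
  rw [← setLIntegral_const]
  exact setLIntegral_mono' ModularGroup.isClosed_fd.measurableSet hK'

/-! ### Spaces of cusp forms as inner product spaces -/

lemma peterssonProduct_eq_sum {Γ : Subgroup SL(2, ℤ)}
    [Fintype (SL(2, ℤ) ⧸ plusMinus Γ)] (κ : ℝ)
    (f g : ℍ → ℂ) :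
    peterssonProduct κ Γ f g = ∑ q : SL(2, ℤ) ⧸ plusMinus Γ, ∫ τ in 𝒟,
      f (q.out⁻¹ • τ) * conj (g (q.out⁻¹ • τ)) * (((q.out⁻¹ • τ).im ^ κ : ℝ) : ℂ) :=
  finsum_eq_sum_of_fintype _

section Petersson

variable {Γ : Subgroup SL(2, ℤ)} [Γ.FiniteIndex] {w : ℕ} {J : SL(2, ℤ) → ℍ → ℂ}

lemma weightedNorm_pow_two_eq_ofReal (s : ℝ) (f : ℍ → ℂ) (τ : ℍ) :
    weightedNorm s (f ^ 2) τ = ENNReal.ofReal (τ.im ^ s * ‖f τ‖ ^ 2) := by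
  rw [weightedNorm_eq_ofReal, Pi.pow_apply, norm_pow, mul_comm]

lemma integrableOn_fd_mul_conj (hJ : IsAutomorphyFactor Γ w J) {f g : ℍ → ℂ}
    (hf : IsCuspFormFor Γ w J f) (hg : IsCuspFormFor Γ w J g) (σ : SL(2, ℤ)) :
    IntegrableOn (fun τ : ℍ ↦ f (σ • τ) * conj (g (σ • τ)) *
      (((σ • τ).im ^ (w / 2 : ℝ) : ℝ) : ℂ)) 𝒟 := by
  obtain ⟨K, hK, hK'⟩ := hf.exists_weightedNorm_smul_le hJ σ
  obtain ⟨L, hL, hL'⟩ := hg.exists_weightedNorm_smul_le hJ σ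
  have hc := continuous_SL2Z_smul σ
  have him : Continuous fun τ : ℍ ↦ (σ • τ).im ^ (w / 2 : ℝ) :=
    (UpperHalfPlane.continuous_im.comp hc).rpow_const fun τ ↦ .inr (by positivity)
  refine Measure.integrableOn_of_bounded (M := K.toReal + L.toReal) volume_fd_ne_top ?_ ?_
  · refine Continuous.aestronglyMeasurable ?_
    exact ((hf.mdifferentiable.continuous.comp hc).mul
      (Complex.continuous_conj.comp (hg.mdifferentiable.continuous.comp hc))).mul
      (Complex.continuous_ofReal.comp him)
  · filter_upwards [ae_restrict_mem ModularGroup.isClosed_fd.measurableSet] with τ hτ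
    have h1 := hK' τ hτ
    have h2 := hL' τ hτ
    rw [weightedNorm_pow_two_eq_ofReal, ENNReal.ofReal_le_iff_le_toReal hK] at h1
    rw [weightedNorm_pow_two_eq_ofReal, ENNReal.ofReal_le_iff_le_toReal hL] at h2
    have h3 : 0 ≤ (σ • τ).im ^ (w / 2 : ℝ) := Real.rpow_nonneg (σ • τ).im_pos.le _
    rw [norm_mul, norm_mul, RCLike.norm_conj, Complex.norm_real, Real.norm_of_nonneg h3]
    have h4 : ‖f (σ • τ)‖ * ‖g (σ • τ)‖ ≤ ‖f (σ • τ)‖ ^ 2 + ‖g (σ • τ)‖ ^ 2 := by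
      nlinarith [sq_nonneg (‖f (σ • τ)‖ - ‖g (σ • τ)‖), sq_nonneg ‖f (σ • τ)‖,
        sq_nonneg ‖g (σ • τ)‖]
    nlinarith [mul_le_mul_of_nonneg_left h4 h3]

lemma peterssonProduct_self (hJ : IsAutomorphyFactor Γ w J) {f : ℍ → ℂ}
    (hf : IsCuspFormFor Γ w J f) :
    peterssonProduct (w / 2) Γ f f = ((peterssonNormSq Γ w f).toReal : ℂ) := by
  have : Finite (SL(2, ℤ) ⧸ plusMinus Γ) := Subgroup.finite_quotient_of_finiteIndex
  have := Fintype.ofFinite (SL(2, ℤ) ⧸ plusMinus Γ)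
  have hfm : Measurable (weightedNorm (w / 2) (f ^ 2)) :=
    measurable_weightedNorm _ (hf.mdifferentiable.pow 2).continuous
  have htop := hf.peterssonNormSq_ne_top hJ
  rw [peterssonNormSq, lintegral_fd_cosetSum Γ hfm, tsum_fintype] at htop ⊢
  rw [ENNReal.toReal_sum (fun q hq ↦ ENNReal.sum_ne_top.mp htop q hq), peterssonProduct_eq_sum,
    Complex.ofReal_sum]
  refine Finset.sum_congr rfl fun q _ ↦ ?_
  have h1 : ∀ τ : ℍ, f (q.out⁻¹ • τ) * conj (f (q.out⁻¹ • τ)) *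
      (((q.out⁻¹ • τ).im ^ (w / 2 : ℝ) : ℝ) : ℂ) =
      (((q.out⁻¹ • τ).im ^ (w / 2 : ℝ) * ‖f (q.out⁻¹ • τ)‖ ^ 2 : ℝ) : ℂ) := fun τ ↦ by
    rw [Complex.mul_conj, Complex.normSq_eq_norm_sq]
    push_cast
    ring
  simp_rw [h1, weightedNorm_pow_two_eq_ofReal]
  rw [integral_complex_ofReal]
  congr 1
  rw [integral_eq_lintegral_of_nonneg_ae]
  · exact .of_forall fun τ ↦ mul_nonneg (Real.rpow_nonneg (q.out⁻¹ • τ).im_pos.le _) (sq_nonneg _)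
  · have := (integrableOn_fd_mul_conj hJ hf hf q.out⁻¹).aestronglyMeasurable
    simp_rw [h1] at this
    have h2 := Complex.continuous_re.comp_aestronglyMeasurable this
    simpa only [Complex.ofReal_re] using h2

variable {S : Submodule ℂ (ℍ → ℂ)}

/-- The Petersson inner product on a space of cusp forms. -/
@[reducible] def peterssonCore (hJ : IsAutomorphyFactor Γ w J)
    (hS : ∀ f ∈ S, IsCuspFormFor Γ w J f) : InnerProductSpace.Core ℂ S where
  -- The arguments are exchanged because the inner product is conjugate-linear in its first
  -- argument.
  inner x y := peterssonProduct (w / 2) Γ y x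
  conj_inner_symm x y := by
    have : Finite (SL(2, ℤ) ⧸ plusMinus Γ) := Subgroup.finite_quotient_of_finiteIndex
    have := Fintype.ofFinite (SL(2, ℤ) ⧸ plusMinus Γ)
    simp only [peterssonProduct_eq_sum, map_sum]
    refine Finset.sum_congr rfl fun q _ ↦ ?_
    rw [← integral_conj]
    congr 1
    ext τ
    simp only [map_mul, Complex.conj_conj, Complex.conj_ofReal]
    ring
  re_inner_nonneg x := by
    rw [peterssonProduct_self hJ (hS _ x.2)]
    simp
  add_left x y z := by
    have : Finite (SL(2, ℤ) ⧸ plusMinus Γ) := Subgroup.finite_quotient_of_finiteIndex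
    have := Fintype.ofFinite (SL(2, ℤ) ⧸ plusMinus Γ)
    simp only [peterssonProduct_eq_sum, ← Finset.sum_add_distrib]
    refine Finset.sum_congr rfl fun q _ ↦ ?_
    rw [← integral_add (integrableOn_fd_mul_conj hJ (hS _ z.2) (hS _ x.2) _)
      (integrableOn_fd_mul_conj hJ (hS _ z.2) (hS _ y.2) _)]
    congr 1
    ext τ
    simp only [Submodule.coe_add, Pi.add_apply, map_add]
    ring
  smul_left x y r := by
    have : Finite (SL(2, ℤ) ⧸ plusMinus Γ) := Subgroup.finite_quotient_of_finiteIndex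
    have := Fintype.ofFinite (SL(2, ℤ) ⧸ plusMinus Γ)
    simp only [peterssonProduct_eq_sum, Finset.mul_sum]
    refine Finset.sum_congr rfl fun q _ ↦ ?_
    rw [← integral_const_mul]
    congr 1
    ext τ
    simp only [Submodule.coe_smul, Pi.smul_apply, smul_eq_mul, map_mul]
    ring
  definite x hx := by
    have hx' := hS _ x.2
    rw [peterssonProduct_self hJ hx', Complex.ofReal_eq_zero, ENNReal.toReal_eq_zero_iff,
      or_iff_left (hx'.peterssonNormSq_ne_top hJ)] at hx
    -- The pointwise bound by the norm shows that a form of norm zero vanishes identically.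
    obtain ⟨C, -, hC⟩ := exists_weightedNorm_sq_le_peterssonNormSq w
    ext τ
    have h1 := hC Γ J hJ _ hx' τ
    rw [hx, mul_zero, weightedNorm_pow_two_eq_ofReal, nonpos_iff_eq_zero,
      ENNReal.ofReal_eq_zero] at h1
    have h2 : 0 < τ.im ^ (w / 2 : ℝ) := Real.rpow_pos_of_pos τ.im_pos _
    have h3 : ‖(x : ℍ → ℂ) τ‖ ^ 2 ≤ 0 := by
      by_contra h
      push Not at h
      exact absurd h1 (not_le.mpr (mul_pos h2 h))
    simpa using h3

end Petersson

lemma peterssonNormSq_eq_ofReal {Γ : Subgroup SL(2, ℤ)} [Γ.FiniteIndex] {w : ℕ}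
    {J : SL(2, ℤ) → ℍ → ℂ} (hJ : IsAutomorphyFactor Γ w J) {f : ℍ → ℂ}
    (hf : IsCuspFormFor Γ w J f) {r : ℝ} (h : peterssonProduct (w / 2) Γ f f = r) :
    peterssonNormSq Γ w f = ENNReal.ofReal r := by
  rw [peterssonProduct_self hJ hf, Complex.ofReal_inj] at h
  rw [← h, ENNReal.ofReal_toReal (hf.peterssonNormSq_ne_top hJ)]

/-- The Bergman kernel is the squared norm of evaluation at τ, so it inherits the uniform pointwise
bound. The last clause is Cauchy–Schwarz for the expansion of f in the basis. -/
theorem exists_bergmanKernel_le (w : ℕ) :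
    ∃ C : ℝ, ∀ (Γ : Subgroup SL(2, ℤ)) [Γ.FiniteIndex] (J : SL(2, ℤ) → ℍ → ℂ),
      IsAutomorphyFactor Γ w J → ∀ S : Submodule ℂ (ℍ → ℂ),
      (∀ f ∈ S, IsCuspFormFor Γ w J f) →
      (∃ B, IsPeterssonOrthonormalBasis (w / 2) Γ S B) ∧
      ∀ B, IsPeterssonOrthonormalBasis (w / 2) Γ S B →
        (∀ τ, bergmanKernel (w / 2) B τ ≤ C) ∧
        ∀ f ∈ S, ∀ τ, weightedNorm (w / 2) (f ^ 2) τ ≤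
          ENNReal.ofReal (bergmanKernel (w / 2) B τ) * peterssonNormSq Γ w f := by
  obtain ⟨C, hC, H⟩ := exists_weightedNorm_sq_le_peterssonNormSq w
  refine ⟨C.toReal, fun Γ _ J hJ S hS ↦ ?_⟩
  let core := peterssonCore hJ hS
  let _ : NormedAddCommGroup S := core.toNormedAddCommGroup
  let _ : InnerProductSpace ℂ S := InnerProductSpace.ofCore core.toCore
  have hinner : ∀ x y : S, inner ℂ x y = peterssonProduct (w / 2) Γ y x := fun _ _ ↦ rfl
  have hnorm : ∀ x : S, peterssonNormSq Γ w x = ENNReal.ofReal (‖x‖ ^ 2) := fun x ↦ by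
    refine peterssonNormSq_eq_ofReal hJ (hS _ x.2) ?_
    rw [← hinner, inner_self_eq_norm_sq_to_K]
    simp
  -- Stated for any finite orthonormal family, since finite dimension is derived from it.
  have hker : ∀ (ι : Type) [Fintype ι] (b : ι → S), Orthonormal ℂ b → ∀ τ : ℍ,
      ∑ i, τ.im ^ (w / 2 : ℝ) * ‖(b i : ℍ → ℂ) τ‖ ^ 2 ≤ C.toReal := by
    intro ι _ b hb τ
    -- This v represents evaluation at τ on the span of the family: v(τ) = ‖v‖² = A. The pointwise
    -- bound reads (Im τ)^κ A² ≤ C A, and A cancels.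
    set v : S := ∑ i, conj ((b i : ℍ → ℂ) τ) • b i with hv
    set A : ℝ := ∑ i, ‖(b i : ℍ → ℂ) τ‖ ^ 2 with hA
    have hA0 : 0 ≤ A := Finset.sum_nonneg fun _ _ ↦ by positivity
    have h1 : ‖v‖ ^ 2 = A := by
      have h2 : ((‖v‖ ^ 2 : ℝ) : ℂ) = A := by
        have h3 : inner ℂ v v = ((‖v‖ : ℝ) : ℂ) ^ 2 := inner_self_eq_norm_sq_to_K v
        rw [Complex.ofReal_pow, ← h3, hv, hb.inner_sum, hA, Complex.ofReal_sum]
        refine Finset.sum_congr rfl fun i _ ↦ ?_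
        rw [Complex.conj_conj, Complex.mul_conj, Complex.normSq_eq_norm_sq]
      exact_mod_cast h2
    have h4 : (v : ℍ → ℂ) τ = A := by
      rw [hv, hA, Submodule.coe_sum, Finset.sum_apply, Complex.ofReal_sum]
      refine Finset.sum_congr rfl fun i _ ↦ ?_
      rw [Submodule.coe_smul, Pi.smul_apply, smul_eq_mul, mul_comm, Complex.mul_conj,
        Complex.normSq_eq_norm_sq]
    have h5 := H Γ J hJ v (hS _ v.2) τ
    rw [weightedNorm_pow_two_eq_ofReal, hnorm, h4, h1, ← ENNReal.ofReal_toReal hC,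
      ← ENNReal.ofReal_mul ENNReal.toReal_nonneg, ENNReal.ofReal_le_ofReal_iff (by positivity),
      Complex.norm_real, Real.norm_of_nonneg hA0] at h5
    rw [← Finset.mul_sum, ← hA]
    rcases hA0.eq_or_lt with h | h
    · rw [← h, mul_zero]
      exact ENNReal.toReal_nonneg
    · have h6 : (τ.im ^ (w / 2 : ℝ) * A) * A ≤ C.toReal * A := by linarith
      exact le_of_mul_le_mul_right h6 h
  have hfin : FiniteDimensional ℂ S := by
    have : Finite (SL(2, ℤ) ⧸ plusMinus Γ) := Subgroup.finite_quotient_of_finiteIndex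
    have := Fintype.ofFinite (SL(2, ℤ) ⧸ plusMinus Γ)
    by_contra hfd
    -- Integrating the kernel of n orthonormal forms over a fundamental domain gives n, which is
    -- therefore at most index · C · vol(𝒟).
    set D : ℝ≥0∞ := Fintype.card (SL(2, ℤ) ⧸ plusMinus Γ) * (C * volume (𝒟 : Set ℍ)) with hD
    have hDtop : D ≠ ⊤ := ENNReal.mul_ne_top (by simp) (ENNReal.mul_ne_top hC volume_fd_ne_top)
    obtain ⟨n, hn⟩ := ENNReal.exists_nat_gt hDtop
    let u := Module.Basis.ofVectorSpace ℂ S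
    have : Infinite (Module.Basis.ofVectorSpaceIndex ℂ S) := by
      by_contra h
      rw [not_infinite_iff_finite] at h
      exact hfd (Module.Finite.of_basis u)
    let t : Fin n → S := fun i ↦ u (Infinite.natEmbedding _ i)
    have ht : LinearIndependent ℂ t := u.linearIndependent.comp _
      ((Infinite.natEmbedding _).injective.comp Fin.val_injective)
    let V := Submodule.span ℂ (Set.range t)
    have hV : Module.finrank ℂ V = n := by
      rw [finrank_span_eq_card ht, Fintype.card_fin]
    have : FiniteDimensional ℂ V := FiniteDimensional.span_of_finite ℂ (Set.finite_range t)
    let b : Fin (Module.finrank ℂ V) → S := fun i ↦ (stdOrthonormalBasis ℂ V i : S)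
    have hb : Orthonormal ℂ b :=
      (stdOrthonormalBasis ℂ V).orthonormal.comp_linearIsometry V.subtypeₗᵢ
    have hn' : (n : ℝ≥0∞) = ∑ i, peterssonNormSq Γ w (b i) := by
      simp [hnorm, hb.1, hV]
    refine absurd hn (not_lt.mpr ?_)
    have hm : ∀ i, Measurable (weightedNorm (w / 2) ((b i : ℍ → ℂ) ^ 2)) := fun i ↦
      measurable_weightedNorm _ ((hS _ (b i).2).mdifferentiable.pow 2).continuous
    rw [hn', hD]
    simp_rw [peterssonNormSq, lintegral_fd_cosetSum Γ (hm _), tsum_fintype]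
    rw [Finset.sum_comm, ← nsmul_eq_mul, ← Finset.card_univ]
    refine Finset.sum_le_card_nsmul _ _ _ fun q _ ↦ ?_
    have hm' : ∀ i, Measurable fun z : ℍ ↦
        weightedNorm (w / 2) ((b i : ℍ → ℂ) ^ 2) (q.out⁻¹ • z) := fun i ↦
      (hm i).comp (measurable_SL2Z_smul _)
    rw [← lintegral_finsetSum _ fun i _ ↦ hm' i, ← setLIntegral_const]
    refine lintegral_mono fun τ ↦ ?_
    simp only [weightedNorm_pow_two_eq_ofReal]
    rw [← ENNReal.ofReal_sum_of_nonneg fun i _ ↦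
      mul_nonneg (Real.rpow_nonneg (q.out⁻¹ • τ).im_pos.le _) (sq_nonneg _),
      ENNReal.ofReal_le_iff_le_toReal hC]
    exact hker _ b hb _
  refine ⟨?_, fun B hB ↦ ?_⟩
  · let b := stdOrthonormalBasis ℂ S
    have hinj : Function.Injective fun i ↦ (b i : ℍ → ℂ) :=
      Subtype.val_injective.comp b.orthonormal.linearIndependent.injective
    classical
    refine ⟨Finset.univ.image fun i ↦ (b i : ℍ → ℂ), ?_, ?_, ?_, ?_⟩
    · rw [Finset.coe_image, Finset.coe_univ, Set.image_univ]
      have h1 : Set.range (fun i ↦ (b i : ℍ → ℂ)) = S.subtype '' Set.range b := by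
        rw [← Set.range_comp]
        rfl
      have h2 : Submodule.span ℂ (Set.range b) = ⊤ := by
        simpa using b.toBasis.span_eq
      rw [h1, ← Submodule.map_span, h2, Submodule.map_top, Submodule.range_subtype]
    · have h1 : LinearIndependent ℂ (fun i ↦ (b i : ℍ → ℂ)) :=
        b.orthonormal.linearIndependent.map' S.subtype (Submodule.ker_subtype S)
      have h2 := h1.linearIndepOn_id
      have h3 : ((Finset.univ.image fun i ↦ (b i : ℍ → ℂ) : Finset (ℍ → ℂ)) : Set (ℍ → ℂ)) =
          Set.range fun i ↦ (b i : ℍ → ℂ) := by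
        rw [Finset.coe_image, Finset.coe_univ, Set.image_univ]
      rw [← h3] at h2
      exact h2
    · simp only [Finset.mem_image, Finset.mem_univ, true_and]
      rintro _ ⟨i, rfl⟩
      rw [← hinner, inner_self_eq_norm_sq_to_K, b.orthonormal.1 i]
      simp
    · simp only [Finset.mem_image, Finset.mem_univ, true_and]
      rintro _ ⟨i, rfl⟩ _ ⟨j, rfl⟩ hij
      rw [← hinner]
      exact b.orthonormal.2 fun h ↦ hij (by rw [h])
  · have hBS : ∀ f : B, (f : ℍ → ℂ) ∈ S := fun f ↦ by
      rw [← hB.span_eq]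
      exact Submodule.subset_span f.2
    let b : B → S := fun f ↦ ⟨f, hBS f⟩
    have hb : Orthonormal ℂ b := by
      classical
      rw [orthonormal_iff_ite]
      intro f g
      rw [hinner]
      split_ifs with h
      · rw [h]
        exact hB.product_self _ g.2
      · exact hB.product_ne _ g.2 _ f.2 fun h' ↦ h (Subtype.ext h').symm
    have hspan : ⊤ ≤ Submodule.span ℂ (Set.range b) := by
      rintro ⟨f, hf⟩ -
      have h1 : S.subtype '' Set.range b = (B : Set (ℍ → ℂ)) := by
        rw [← Set.range_comp]
        exact Subtype.range_coe
      have h2 : f ∈ Submodule.map S.subtype (Submodule.span ℂ (Set.range b)) := by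
        rw [Submodule.map_span, h1, hB.span_eq]
        exact hf
      obtain ⟨y, hy, hyf⟩ := h2
      have h3 : y = ⟨f, hf⟩ := Subtype.ext hyf
      rwa [← h3]
    let e := OrthonormalBasis.mk hb hspan
    have hsum : ∀ τ : ℍ, bergmanKernel (w / 2) B τ =
        ∑ i : B, τ.im ^ (w / 2 : ℝ) * ‖(b i : ℍ → ℂ) τ‖ ^ 2 := fun τ ↦
      (Finset.sum_coe_sort B fun f ↦ τ.im ^ (w / 2 : ℝ) * ‖f τ‖ ^ 2).symm
    refine ⟨fun τ ↦ ?_, fun f hf τ ↦ ?_⟩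
    · rw [hsum]
      exact hker B b hb τ
    · set x : S := ⟨f, hf⟩ with hx
      have h1 : f τ = ∑ i, inner ℂ (b i) x * (b i : ℍ → ℂ) τ := by
        have h2 := congrArg (fun y : S ↦ (y : ℍ → ℂ) τ) (e.sum_repr' x)
        simp only [Submodule.coe_sum, Finset.sum_apply, Submodule.coe_smul, Pi.smul_apply,
          smul_eq_mul, e, OrthonormalBasis.coe_mk] at h2
        exact h2.symm
      have h3 : ∑ i, ‖inner ℂ (b i) x‖ ^ 2 = ‖x‖ ^ 2 := by
        have := e.sum_sq_norm_inner_right x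
        simpa only [e, OrthonormalBasis.coe_mk] using this
      have h4 : ‖f τ‖ ^ 2 ≤ ‖x‖ ^ 2 * ∑ i, ‖(b i : ℍ → ℂ) τ‖ ^ 2 := by
        rw [← h3]
        refine le_trans ?_ (Finset.sum_mul_sq_le_sq_mul_sq _ _ _)
        rw [h1]
        gcongr
        refine (norm_sum_le _ _).trans (le_of_eq ?_)
        simp only [norm_mul]
      have h5 := hnorm x
      rw [hx] at h5
      have h6 : 0 ≤ τ.im ^ (w / 2 : ℝ) := Real.rpow_nonneg τ.im_pos.le _
      rw [h5, weightedNorm_pow_two_eq_ofReal, hsum, ← ENNReal.ofReal_mul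
        (Finset.sum_nonneg fun _ _ ↦ mul_nonneg h6 (sq_nonneg _))]
      refine ENNReal.ofReal_le_ofReal ?_
      rw [← Finset.mul_sum, mul_assoc, mul_comm (Finset.sum _ _)]
      gcongr

/-! ### Poincaré series -/

/-- The Poincaré series `∑_γ J(γ, z)⁻¹ h(γ z)` of a function `h` on the upper half-plane. -/
def poincareSeries (Γ : Subgroup SL(2, ℤ)) (J : SL(2, ℤ) → ℍ → ℂ) (h : ℍ → ℂ) (z : ℍ) : ℂ :=
  ∑' γ : Γ, (J γ z)⁻¹ * h ((γ : SL(2, ℤ)) • z)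

lemma exists_encard_smul_mem_ball_ne_top (τ : ℍ) (R : ℝ) :
    ∃ m : ℝ≥0∞, m ≠ ⊤ ∧ ∀ z, ({γ : SL(2, ℤ) | γ • z ∈ Metric.ball τ R}.encard : ℝ≥0∞) ≤ m := by
  obtain ⟨C, hC, H⟩ := exists_encard_smul_mem_ball_le R
  obtain ⟨g, hg⟩ := ModularGroup.exists_smul_mem_fd τ
  have hzim : 1 / 2 ≤ (g • τ).im := by
    have := ModularGroup.three_le_four_mul_im_sq_of_mem_fd hg
    nlinarith [(g • τ).im_pos]
  refine ⟨ENNReal.ofReal (C * ((g • τ).im / (1 : ℕ) + 1)), ENNReal.ofReal_ne_top, fun z ↦ ?_⟩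
  have := H ⊤ g⁻¹ 1 le_rfl (fun j _ ↦ by simp) (g • τ) hzim z
  simpa only [inv_smul_smul, Subgroup.mem_top, true_and] using this

/-- Locally uniform convergence of the sum of the translates of an integrable weighted norm. -/
lemma exists_weightedNorm_smul_le_summable {s : ℝ} {h : ℍ → ℂ}
    (hh : MDifferentiable 𝓘(ℂ) 𝓘(ℂ) h) (hI : ∫⁻ z, weightedNorm s h z ≠ ⊤) (z₀ : ℍ) :
    ∃ u : SL(2, ℤ) → ℝ≥0∞, ∑' γ, u γ ≠ ⊤ ∧ ∀ γ, ∀ z ∈ Metric.ball z₀ 1,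
      weightedNorm s h (γ • z) ≤ u γ := by
  obtain ⟨C, hC, H⟩ := exists_weightedNorm_le_lintegral_ball s
  obtain ⟨m, hm, hm'⟩ := exists_encard_smul_mem_ball_ne_top z₀ 2
  have hmeas := measurable_weightedNorm s hh.continuous
  -- Radius 2 covers the unit balls about all points of the ball of radius 1. The sum over γ is
  -- finite because each orbit meets the larger ball boundedly often.
  refine ⟨fun γ ↦ C * ∫⁻ z in Metric.ball z₀ 2, weightedNorm s h (γ • z), ?_, fun γ z hz ↦ ?_⟩
  · rw [ENNReal.tsum_mul_left]
    refine ENNReal.mul_ne_top hC ?_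
    rw [← (Equiv.inv SL(2, ℤ)).tsum_eq]
    exact ne_top_of_le_ne_top (ENNReal.mul_ne_top hm hI)
      (lintegral_tsum_inv_smul_le hmeas Metric.isOpen_ball.measurableSet hm')
  · refine (H h hh (γ • z)).trans (mul_le_mul' le_rfl ?_)
    rw [← lintegral_indicator Metric.isOpen_ball.measurableSet,
      ← lintegral_SL2Z_smul γ (hmeas.indicator Metric.isOpen_ball.measurableSet),
      ← lintegral_indicator Metric.isOpen_ball.measurableSet]
    refine lintegral_mono fun x ↦ ?_
    by_cases hx : γ • x ∈ Metric.ball (γ • z) 1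
    · have hx' : x ∈ Metric.ball z₀ 2 := by
        rw [Metric.mem_ball, dist_SL2Z_smul] at hx
        rw [Metric.mem_ball] at hz ⊢
        linarith [dist_triangle x z z₀]
      rw [Set.indicator_of_mem hx, Set.indicator_of_mem hx']
    · rw [Set.indicator_of_notMem hx]
      exact zero_le

section

variable {Γ : Subgroup SL(2, ℤ)} {w : ℕ} {J : SL(2, ℤ) → ℍ → ℂ} {h : ℍ → ℂ}

lemma IsAutomorphyFactor.mono (hJ : IsAutomorphyFactor Γ w J) {Γ' : Subgroup SL(2, ℤ)}
    (hΓ : Γ' ≤ Γ) : IsAutomorphyFactor Γ' w J :=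
  ⟨fun γ hγ ↦ hJ.mdifferentiable γ (hΓ hγ),
    fun γ hγ δ hδ ↦ hJ.mul γ (hΓ hγ) δ (hΓ hδ), fun γ hγ ↦ hJ.pow_four γ (hΓ hγ)⟩

lemma IsAutomorphyFactor.ne_zero (hJ : IsAutomorphyFactor Γ w J) {γ : SL(2, ℤ)} (hγ : γ ∈ Γ)
    (z : ℍ) : J γ z ≠ 0 := by
  have h1 := hJ.pow_four γ hγ z
  intro h2
  rw [h2, zero_pow (by norm_num)] at h1
  exact pow_ne_zero _ (denom_ne_zero γ z) h1.symm

lemma IsAutomorphyFactor.weightedNorm_inv_mul (hJ : IsAutomorphyFactor Γ w J) (h : ℍ → ℂ)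
    {γ : SL(2, ℤ)} (hγ : γ ∈ Γ) (z : ℍ) :
    weightedNorm (w / 4) (fun z ↦ (J γ z)⁻¹ * h (γ • z)) z = weightedNorm (w / 4) h (γ • z) := by
  rw [weightedNorm_SL2Z_smul, weightedNorm_eq_ofReal, norm_mul, norm_inv, hJ.norm_eq hγ,
    ← Real.rpow_neg (norm_nonneg _)]
  congr 4
  ring

lemma IsAutomorphyFactor.norm_inv_mul_le (hJ : IsAutomorphyFactor Γ w J) (h : ℍ → ℂ)
    {γ : SL(2, ℤ)} (hγ : γ ∈ Γ) {z : ℍ} {a : ℝ≥0∞} (ha : a ≠ ⊤)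
    (hz : weightedNorm (w / 4) h (γ • z) ≤ a) {v : ℝ} (hv : 0 < v) (hvz : v ≤ z.im) :
    ‖(J γ z)⁻¹ * h (γ • z)‖ ≤ a.toReal * (v ^ (w / 4 : ℝ))⁻¹ := by
  rw [← hJ.weightedNorm_inv_mul h hγ, weightedNorm_eq_ofReal,
    ENNReal.ofReal_le_iff_le_toReal ha] at hz
  rw [← div_eq_mul_inv, le_div_iff₀ (by positivity)]
  refine le_trans ?_ hz
  gcongr

lemma summable_poincareSeries (hJ : IsAutomorphyFactor Γ w J)
    (hh : MDifferentiable 𝓘(ℂ) 𝓘(ℂ) h) (hI : ∫⁻ z, weightedNorm (w / 4) h z ≠ ⊤) (z : ℍ) :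
    Summable fun γ : Γ ↦ ‖(J γ z)⁻¹ * h ((γ : SL(2, ℤ)) • z)‖ := by
  obtain ⟨u, hu, hu'⟩ := exists_weightedNorm_smul_le_summable hh hI z
  have hs : Summable fun γ : Γ ↦ (u γ).toReal * (z.im ^ (w / 4 : ℝ))⁻¹ :=
    ((ENNReal.summable_toReal hu).subtype _).mul_right _
  refine hs.of_nonneg_of_le (fun _ ↦ norm_nonneg _) fun γ ↦ ?_
  exact hJ.norm_inv_mul_le h γ.2 (ENNReal.ne_top_of_tsum_ne_top hu γ)
    (hu' γ z (Metric.mem_ball_self one_pos)) z.im_pos le_rfl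

lemma mdifferentiable_poincareSeries (hJ : IsAutomorphyFactor Γ w J)
    (hh : MDifferentiable 𝓘(ℂ) 𝓘(ℂ) h) (hI : ∫⁻ z, weightedNorm (w / 4) h z ≠ ⊤) :
    MDifferentiable 𝓘(ℂ) 𝓘(ℂ) (poincareSeries Γ J h) := by
  intro z₀
  rw [UpperHalfPlane.mdifferentiableAt_iff]
  obtain ⟨u, hu, hu'⟩ := exists_weightedNorm_smul_le_summable hh hI z₀
  have hv : 0 < 3 / 4 * z₀.im := by have := z₀.im_pos; positivity
  have hs : Summable fun γ : Γ ↦ (u γ).toReal * ((3 / 4 * z₀.im) ^ (w / 4 : ℝ))⁻¹ :=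
    ((ENNReal.summable_toReal hu).subtype _).mul_right _
  have hd := Complex.differentiableOn_tsum_of_summable_norm
    (F := fun (γ : Γ) z ↦ (J γ (ofComplex z))⁻¹ * h ((γ : SL(2, ℤ)) • ofComplex z))
    (U := Metric.ball (z₀ : ℂ) (z₀.im / 4)) hs (fun γ ↦ ?_) Metric.isOpen_ball fun γ z hz ↦ ?_
  · exact hd.differentiableAt (Metric.ball_mem_nhds _ (by have := z₀.im_pos; positivity))
  · have h1 : MDifferentiable 𝓘(ℂ) 𝓘(ℂ) fun z ↦ h ((γ : SL(2, ℤ)) • z) :=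
      hh.comp (UpperHalfPlane.mdifferentiable_smul (by simp))
    have h2 := UpperHalfPlane.mdifferentiable_iff.mp h1
    have h3 := UpperHalfPlane.mdifferentiable_iff.mp (hJ.mdifferentiable γ γ.2)
    have h4 := (h3.inv fun z _ ↦ hJ.ne_zero γ.2 _).mul h2
    refine h4.mono fun z hz ↦ ?_
    have := (coe_mem_ball_dist_lt_one hz).1
    change 0 < z.im
    linarith
  · obtain ⟨h1, -, h3⟩ := coe_mem_ball_dist_lt_one hz
    refine hJ.norm_inv_mul_le h γ.2 (ENNReal.ne_top_of_tsum_ne_top hu γ) (hu' γ _ h3) hv ?_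
    rwa [ofComplex_apply_of_im_pos (by linarith)]

lemma poincareSeries_smul (hJ : IsAutomorphyFactor Γ w J) {δ : SL(2, ℤ)} (hδ : δ ∈ Γ) (z : ℍ) :
    poincareSeries Γ J h (δ • z) = J δ z * poincareSeries Γ J h z := by
  rw [poincareSeries, poincareSeries, ← tsum_mul_left, ← (Equiv.mulRight (⟨δ, hδ⟩ : Γ)).tsum_eq
    (fun γ : Γ ↦ J δ z * ((J γ z)⁻¹ * h ((γ : SL(2, ℤ)) • z)))]
  refine tsum_congr fun γ ↦ ?_
  have h0 := hJ.ne_zero hδ z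
  rw [Equiv.coe_mulRight, Subgroup.coe_mul, hJ.mul γ γ.2 δ hδ, mul_smul, mul_inv]
  field_simp

lemma weightedNorm_poincareSeries_le (hJ : IsAutomorphyFactor Γ w J) (z : ℍ) :
    weightedNorm (w / 4) (poincareSeries Γ J h) z ≤
      ∑' γ : Γ, weightedNorm (w / 4) h ((γ : SL(2, ℤ)) • z) := by
  simp_rw [← hJ.weightedNorm_inv_mul h (Subtype.prop _)]
  unfold weightedNorm
  rw [ENNReal.tsum_mul_right]
  gcongr
  exact enorm_tsum_le_tsum_enorm

/-- Unfolding, with a constant independent of Γ; 20 is the bound for the number of γ that move a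
point into 𝒟. -/
lemma lintegral_cosetSum_poincareSeries_le (hJ : IsAutomorphyFactor Γ w J)
    (hh : MDifferentiable 𝓘(ℂ) 𝓘(ℂ) h) :
    ∫⁻ z in 𝒟, cosetSum (plusMinus Γ) (weightedNorm (w / 4) (poincareSeries Γ J h)) z ≤
      20 * ∫⁻ z, weightedNorm (w / 4) h z := by
  have hmeas := measurable_weightedNorm (w / 4) hh.continuous
  refine le_trans ?_ (lintegral_tsum_inv_smul_le hmeas ModularGroup.isClosed_fd.measurableSet
    encard_smul_mem_fd_le)
  have hm : ∀ β : SL(2, ℤ), Measurable fun z : ℍ ↦ weightedNorm (w / 4) h (β⁻¹ • z) := fun β ↦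
    hmeas.comp (measurable_SL2Z_smul _)
  rw [← lintegral_tsum fun β ↦ (hm β).aemeasurable]
  refine lintegral_mono fun z ↦ ?_
  rw [tsum_inv_smul_eq (plusMinus Γ)]
  refine ENNReal.tsum_le_tsum fun q ↦ (weightedNorm_poincareSeries_le hJ _).trans ?_
  have hle : Γ ≤ plusMinus Γ := le_sup_left
  exact ENNReal.tsum_comp_le_tsum_of_injective (Subgroup.inclusion_injective hle)
    fun γ : plusMinus Γ ↦ weightedNorm (w / 4) h ((γ : SL(2, ℤ)) • q.out⁻¹ • z)

/-- Vanishing at the cusps needs no Fourier expansion. The L¹ bound gives v^(w/4)|P|σ| = O(v + 1),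
hence P|σ = O(v^(1 - w/4)), which tends to 0 because w > 4. -/
theorem isCuspFormFor_poincareSeries [Γ.FiniteIndex] (hw : 5 ≤ w) (hJ : IsAutomorphyFactor Γ w J)
    (hh : MDifferentiable 𝓘(ℂ) 𝓘(ℂ) h) (hI : ∫⁻ z, weightedNorm (w / 4) h z ≠ ⊤) :
    IsCuspFormFor Γ w J (poincareSeries Γ J h) := by
  have hw' : (5 : ℝ) ≤ w := by exact_mod_cast hw
  refine ⟨mdifferentiable_poincareSeries hJ hh hI, fun γ hγ τ ↦ poincareSeries_smul hJ hγ τ,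
    fun σ ↦ ?_⟩
  obtain ⟨C, hC, H⟩ := exists_weightedNorm_le_cosetSum (w / 4)
  obtain ⟨n, hn, -, hT⟩ := exists_width (plusMinus Γ) σ
  have hn1 : (1 : ℝ) ≤ n := by exact_mod_cast hn
  set P := poincareSeries Γ J h
  set I := ∫⁻ z in 𝒟, cosetSum (plusMinus Γ) (weightedNorm (w / 4) P) z with hI'
  have hItop : I ≠ ⊤ := ne_top_of_le_ne_top (ENNReal.mul_ne_top (by norm_num) hI)
    (lintegral_cosetSum_poincareSeries_le hJ hh)
  set K := (C * I).toReal
  have hK : 0 ≤ K := ENNReal.toReal_nonneg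
  have hbound : ∀ z : ℍ, 1 ≤ z.im → ‖denom σ z‖ ^ (-(w / 2 : ℝ)) * ‖P (σ • z)‖ ≤
      2 * K * z.im ^ (-(w / 4 - 1 : ℝ)) := by
    intro z hz
    have h1 := H (plusMinus Γ) P (mdifferentiable_poincareSeries hJ hh hI)
      (fun γ hγ τ ↦ weightedNorm_smul_of_mem_plusMinus hJ
        (fun γ hγ τ ↦ poincareSeries_smul hJ hγ τ) hγ τ) σ n hn hT z (by linarith)
    rw [← hI', weightedNorm_SL2Z_smul, mul_right_comm C,
      ← ENNReal.ofReal_toReal (ENNReal.mul_ne_top hC hItop), ← ENNReal.ofReal_mul hK,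
      ENNReal.ofReal_le_ofReal_iff (by positivity),
      show -(2 * ((w : ℝ) / 4)) = -(w / 2) by ring] at h1
    have hz0 : 0 < z.im := by linarith
    rw [Real.rpow_neg hz0.le, Real.rpow_sub hz0, Real.rpow_one, inv_div, ← mul_div_assoc,
      le_div_iff₀ (by positivity)]
    refine h1.trans ?_
    have h2 : z.im / n ≤ z.im := div_le_self hz0.le hn1
    change K * (z.im / n + 1) ≤ _
    nlinarith
  have hlim : Filter.Tendsto (fun z : ℍ ↦ 2 * K * z.im ^ (-(w / 4 - 1 : ℝ))) atImInfty
      (nhds 0) := by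
    have h1 := (tendsto_rpow_neg_atTop (show (0 : ℝ) < w / 4 - 1 by linarith)).const_mul (2 * K)
    rw [mul_zero] at h1
    exact h1.comp Filter.tendsto_comap
  refine squeeze_zero' (.of_forall fun z ↦ by positivity) ?_ hlim
  exact (atImInfty_mem _).mpr ⟨1, hbound⟩

/-- The Bergman kernel is bounded below in terms of the values of Poincaré series. -/
theorem weightedNorm_poincareSeries_le_bergmanSup [Γ.FiniteIndex] (hw : 5 ≤ w)
    (hJ : IsAutomorphyFactor Γ w J) (hh : MDifferentiable 𝓘(ℂ) 𝓘(ℂ) h)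
    (hI : ∫⁻ z, weightedNorm (w / 4) h z ≠ ⊤) {B : Finset (ℍ → ℂ)}
    (hB : ∀ f, IsCuspFormFor Γ w J f → ∀ τ, weightedNorm (w / 2) (f ^ 2) τ ≤
          ENNReal.ofReal (bergmanKernel (w / 2) B τ) * peterssonNormSq Γ w f)
    (hBtop : bergmanSup (w / 2) B ≠ ⊤) (z : ℍ) :
    weightedNorm (w / 4) (poincareSeries Γ J h) z ≤
      bergmanSup (w / 2) B * (20 * ∫⁻ z, weightedNorm (w / 4) h z) := by
  have hP := isCuspFormFor_poincareSeries hw hJ hh hI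
  set P := poincareSeries Γ J h
  set A : ℝ≥0∞ := ⨆ τ, weightedNorm (w / 4) P τ
  have hPm := measurable_weightedNorm (w / 4) hP.mdifferentiable.continuous
  have h1 : A ^ 2 ≤ bergmanSup (w / 2) B * peterssonNormSq Γ w P := by
    rw [ENNReal.iSup_pow]
    refine iSup_le fun τ ↦ ?_
    rw [← weightedNorm_sq]
    refine (hB P hP τ).trans ?_
    gcongr
    exact le_iSup (fun τ ↦ ENNReal.ofReal (bergmanKernel (w / 2) B τ)) τ
  have h2 : peterssonNormSq Γ w P ≤ A * (20 * ∫⁻ z, weightedNorm (w / 4) h z) := by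
    refine le_trans ?_ (mul_le_mul' le_rfl (lintegral_cosetSum_poincareSeries_le hJ hh))
    rw [peterssonNormSq, ← lintegral_const_mul _ (measurable_cosetSum _ hPm)]
    refine lintegral_mono fun τ ↦ ?_
    unfold cosetSum
    rw [← ENNReal.tsum_mul_left]
    refine ENNReal.tsum_le_tsum fun q ↦ ?_
    rw [weightedNorm_sq, sq]
    gcongr
    exact le_iSup (weightedNorm (w / 4) P) _
  -- Finiteness of the sup norm A is needed in order to cancel one factor A in A² ≤ sup(S) · A ·
  -- 20‖h‖₁.
  have h3 : A ≠ ⊤ := by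
    intro h
    rw [h, ENNReal.top_pow two_ne_zero, top_le_iff] at h1
    exact ENNReal.mul_ne_top hBtop (hP.peterssonNormSq_ne_top hJ) h1
  refine (le_iSup (weightedNorm (w / 4) P) z).trans ?_
  change A ≤ _
  by_cases h4 : A = 0
  · rw [h4]
    exact zero_le
  · have h5 : A * A ≤ A * (bergmanSup (w / 2) B * (20 * ∫⁻ z, weightedNorm (w / 4) h z)) := by
      rw [← sq]
      refine h1.trans ((mul_le_mul' le_rfl h2).trans (le_of_eq ?_))
      ring
    exact (ENNReal.mul_le_mul_iff_right h4 h3).mp h5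

/-- The values of the Poincaré series for a sequence of groups with a limit. -/
lemma tendsto_poincareSeries (hJ : IsAutomorphyFactor Γ w J)
    (hh : MDifferentiable 𝓘(ℂ) 𝓘(ℂ) h) (hI : ∫⁻ z, weightedNorm (w / 4) h z ≠ ⊤)
    {G : ℕ → Subgroup SL(2, ℤ)} {L : Subgroup SL(2, ℤ)} (hG : ∀ n, G n ≤ Γ)
    (hL : ∀ n, L ≤ G n) (hlim : ∀ γ ∉ L, ∀ᶠ n in Filter.atTop, γ ∉ G n) (z : ℍ) :
    Filter.Tendsto (fun n ↦ poincareSeries (G n) J h z) Filter.atTop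
      (nhds (poincareSeries L J h z)) := by
  have hsub : ∀ G : Subgroup SL(2, ℤ), poincareSeries G J h z =
      ∑' γ, (G : Set SL(2, ℤ)).indicator (fun γ ↦ (J γ z)⁻¹ * h (γ • z)) γ := fun G ↦
    tsum_subtype (G : Set SL(2, ℤ)) fun γ ↦ (J γ z)⁻¹ * h (γ • z)
  simp_rw [hsub]
  -- All the groups lie in Γ, whose absolutely convergent series dominates.
  refine tendsto_tsum_of_dominated_convergence
    (bound := (Γ : Set SL(2, ℤ)).indicator fun γ ↦ ‖(J γ z)⁻¹ * h (γ • z)‖) ?_ (fun γ ↦ ?_)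
    (.of_forall fun n γ ↦ ?_)
  · exact summable_subtype_iff_indicator.mp (summable_poincareSeries hJ hh hI z)
  · by_cases hγ : γ ∈ L
    · rw [Set.indicator_of_mem hγ]
      simp_rw [Set.indicator_of_mem (show γ ∈ (G _ : Set SL(2, ℤ)) from hL _ hγ)]
      exact tendsto_const_nhds
    · rw [Set.indicator_of_notMem hγ]
      refine tendsto_const_nhds.congr' ?_
      filter_upwards [hlim γ hγ] with n hn
      rw [Set.indicator_of_notMem hn]
  · rw [norm_indicator_eq_indicator_norm]
    exact Set.indicator_le_indicator_of_subset (hG n) (fun _ ↦ norm_nonneg _) γ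

end

/-! ### Bounds for families of groups -/

/-- Downward induction on N: each exceptional n is absorbed by taking a minimum. -/
lemma exists_pos_forall_of_eventually {p : ℕ → ℝ → Prop}
    (hp : ∀ n, ∀ a b, b ≤ a → p n a → p n b) (h : ∀ n, ∃ c, 0 < c ∧ p n c)
    (h' : ∃ c, 0 < c ∧ ∃ N, ∀ n, N ≤ n → p n c) : ∃ c, 0 < c ∧ ∀ n, p n c := by
  obtain ⟨c, hc, N, hN⟩ := h'
  induction N generalizing c with
  | zero => exact ⟨c, hc, fun n ↦ hN n n.zero_le⟩
  | succ N ih =>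
    obtain ⟨d, hd, hd'⟩ := h N
    refine ih (min c d) (lt_min hc hd) fun n hn ↦ ?_
    rcases hn.eq_or_lt with rfl | hn
    exacts [hp _ _ _ (min_le_right _ _) hd', hp _ _ _ (min_le_left _ _) (hN n hn)]

/-- The added 1 keeps the denominator positive even when I = 0. -/
lemma ofReal_div_le_of_le_mul {a : ℝ} {I M : ℝ≥0∞} (hI : I ≠ ⊤)
    (h : ENNReal.ofReal a ≤ M * I) : ENNReal.ofReal (a / (I.toReal + 1)) ≤ M := by
  have h0 : 0 < I.toReal + 1 := by positivity
  rw [ENNReal.ofReal_div_of_pos h0]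
  refine ENNReal.div_le_of_le_mul (h.trans (mul_le_mul' le_rfl ?_))
  rw [← ENNReal.ofReal_toReal hI, ENNReal.toReal_ofReal ENNReal.toReal_nonneg]
  exact ENNReal.ofReal_le_ofReal (by linarith)

lemma exists_bergmanSup_le (w : ℕ) : ∃ C : ℝ, ∀ (Γ : Subgroup SL(2, ℤ)) [Γ.FiniteIndex]
    (J : SL(2, ℤ) → ℍ → ℂ), IsAutomorphyFactor Γ w J →
    ∀ S : Submodule ℂ (ℍ → ℂ), (∀ f ∈ S, IsCuspFormFor Γ w J f) →
    (∃ B, IsPeterssonOrthonormalBasis (w / 2) Γ S B) ∧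
    ∀ B, IsPeterssonOrthonormalBasis (w / 2) Γ S B →
      bergmanSup (w / 2) B ≤ ENNReal.ofReal C ∧
      ∀ f ∈ S, ∀ τ, weightedNorm (w / 2) (f ^ 2) τ ≤
        ENNReal.ofReal (bergmanKernel (w / 2) B τ) * peterssonNormSq Γ w f := by
  obtain ⟨C, hC⟩ := exists_bergmanKernel_le w
  refine ⟨C, fun Γ _ J hJ S hS ↦ ⟨(hC Γ J hJ S hS).1, fun B hB ↦ ?_⟩⟩
  obtain ⟨h1, h2⟩ := (hC Γ J hJ S hS).2 B hB
  exact ⟨iSup_le fun τ ↦ ENNReal.ofReal_le_ofReal (h1 τ), h2⟩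

/-- A nonzero space of cusp forms has a positive lower bound for the Bergman kernels. -/
lemma exists_le_bergmanSup {Γ : Subgroup SL(2, ℤ)} [Γ.FiniteIndex] {w : ℕ}
    {J : SL(2, ℤ) → ℍ → ℂ} (hJ : IsAutomorphyFactor Γ w J) {S : Submodule ℂ (ℍ → ℂ)}
    (hS : ∀ f ∈ S, IsCuspFormFor Γ w J f) (hS0 : S ≠ ⊥) :
    ∃ c : ℝ, 0 < c ∧ ∀ B, IsPeterssonOrthonormalBasis (w / 2) Γ S B →
      ENNReal.ofReal c ≤ bergmanSup (w / 2) B := by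
  obtain ⟨C, hC⟩ := exists_bergmanSup_le w
  obtain ⟨f, hf, hf0⟩ := Submodule.exists_mem_ne_zero_of_ne_bot hS0
  obtain ⟨τ, hτ⟩ := Function.ne_iff.mp hf0
  have hI := (hS f hf).peterssonNormSq_ne_top hJ
  have hτ' : 0 < ‖f τ‖ := norm_pos_iff.mpr hτ
  have him := τ.im_pos
  refine ⟨‖(f ^ 2) τ‖ * τ.im ^ (w / 2 : ℝ) / ((peterssonNormSq Γ w f).toReal + 1), ?_,
    fun B hB ↦ ofReal_div_le_of_le_mul hI ?_⟩
  · rw [Pi.pow_apply, norm_pow]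
    positivity
  · rw [← weightedNorm_eq_ofReal]
    refine (((hC Γ J hJ S hS).2 B hB).2 f hf τ).trans (mul_le_mul' ?_ le_rfl)
    exact le_iSup (fun τ ↦ ENNReal.ofReal (bergmanKernel (w / 2) B τ)) τ

/-- The supremum of the Bergman kernel is bounded above and below in a family of groups with a
limit for which a Poincaré series does not vanish. -/
theorem exists_bergmanSup_bounds {Γ : Subgroup SL(2, ℤ)} {w : ℕ} {J : SL(2, ℤ) → ℍ → ℂ}
    {h : ℍ → ℂ} (hw : 5 ≤ w) (hJ : IsAutomorphyFactor Γ w J)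
    (hh : MDifferentiable 𝓘(ℂ) 𝓘(ℂ) h) (hI : ∫⁻ z, weightedNorm (w / 4) h z ≠ ⊤)
    {G : ℕ → Subgroup SL(2, ℤ)} {L : Subgroup SL(2, ℤ)} (hG : ∀ n, G n ≤ Γ)
    (hfin : ∀ n, 1 ≤ n → (G n).FiniteIndex)
    (hL : ∀ n, L ≤ G n) (hlim : ∀ γ ∉ L, ∀ᶠ n in Filter.atTop, γ ∉ G n)
    {S : ℕ → Submodule ℂ (ℍ → ℂ)} (hS : ∀ n, 1 ≤ n → ∀ f, f ∈ S n ↔ IsCuspFormFor (G n) w J f)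
    {z : ℍ} (hz : poincareSeries L J h z ≠ 0) :
    (∃ c C : ℝ, 0 < c ∧ ∀ n, 1 ≤ n →
      (∃ B, IsPeterssonOrthonormalBasis (w / 2) (G n) (S n) B) ∧
      ∀ B, IsPeterssonOrthonormalBasis (w / 2) (G n) (S n) B →
        bergmanSup (w / 2) B ≤ ENNReal.ofReal C ∧
        (S n ≠ ⊥ → ENNReal.ofReal c ≤ bergmanSup (w / 2) B)) ∧
    ∃ N₀, ∀ n, N₀ ≤ n → S n ≠ ⊥ := by
  obtain ⟨C, hC⟩ := exists_bergmanSup_le w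
  set ℓ := poincareSeries L J h z
  have hℓ : 0 < ‖ℓ‖ := norm_pos_iff.mpr hz
  -- From some level on, the Poincaré series at z keeps half the size of its limit. This yields both
  -- a nonzero form and the uniform lower bound.
  have hev : ∀ᶠ n in Filter.atTop, 1 ≤ n ∧ ‖ℓ‖ / 2 < ‖poincareSeries (G n) J h z‖ :=
    (Filter.eventually_ge_atTop 1).and
      ((tendsto_poincareSeries hJ hh hI hG hL hlim z).norm.eventually_const_lt (half_lt_self hℓ))
  obtain ⟨N, hN⟩ := Filter.eventually_atTop.mp hev
  have hmem : ∀ n, N ≤ n → poincareSeries (G n) J h ∈ S n := fun n hn ↦ by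
    have := hfin n (hN n hn).1
    exact (hS n (hN n hn).1 _).mpr (isCuspFormFor_poincareSeries hw (hJ.mono (hG n)) hh hI)
  have hlow : ∃ c, 0 < c ∧ ∀ n, 1 ≤ n → S n ≠ ⊥ →
      ∀ B, IsPeterssonOrthonormalBasis (w / 2) (G n) (S n) B →
        ENNReal.ofReal c ≤ bergmanSup (w / 2) B := by
    refine exists_pos_forall_of_eventually
      (p := fun n c ↦ 1 ≤ n → S n ≠ ⊥ → ∀ B, IsPeterssonOrthonormalBasis (w / 2) (G n) (S n) B →
        ENNReal.ofReal c ≤ bergmanSup (w / 2) B)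
      (fun n a b hab ha hn hS0 B hB ↦ (ENNReal.ofReal_le_ofReal hab).trans (ha hn hS0 B hB))
      (fun n ↦ ?_) ?_
    · by_cases hn : 1 ≤ n ∧ S n ≠ ⊥
      · have := hfin n hn.1
        obtain ⟨c, hc, hc'⟩ := exists_le_bergmanSup (hJ.mono (hG n))
          (fun f ↦ (hS n hn.1 f).mp) hn.2
        exact ⟨c, hc, fun _ _ ↦ hc'⟩
      · exact ⟨1, one_pos, fun h1 h2 ↦ absurd ⟨h1, h2⟩ hn⟩
    · have him := z.im_pos
      have hI' : 20 * ∫⁻ z, weightedNorm (w / 4) h z ≠ ⊤ := ENNReal.mul_ne_top (by norm_num) hI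
      refine ⟨‖ℓ‖ / 2 * z.im ^ (w / 4 : ℝ) /
        ((20 * ∫⁻ z, weightedNorm (w / 4) h z).toReal + 1), by positivity, N,
        fun n hn hn1 _ B hB ↦ ofReal_div_le_of_le_mul hI' ?_⟩
      have := hfin n hn1
      obtain ⟨hB1, hB2⟩ := (hC (G n) J (hJ.mono (hG n)) (S n) fun f ↦ (hS n hn1 f).mp).2 B hB
      refine le_trans ?_ (weightedNorm_poincareSeries_le_bergmanSup hw (hJ.mono (hG n)) hh hI
        (fun f hf ↦ hB2 f ((hS n hn1 f).mpr hf)) (ne_top_of_le_ne_top ENNReal.ofReal_ne_top hB1) z)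
      rw [weightedNorm_eq_ofReal]
      refine ENNReal.ofReal_le_ofReal ?_
      have := (hN n hn).2.le
      gcongr
  obtain ⟨c, hc, hc'⟩ := hlow
  refine ⟨⟨c, C, hc, fun n hn ↦ ?_⟩, N, fun n hn h0 ↦ ?_⟩
  · have := hfin n hn
    obtain ⟨h1, h2⟩ := hC (G n) J (hJ.mono (hG n)) (S n) fun f ↦ (hS n hn f).mp
    exact ⟨h1, fun B hB ↦ ⟨(h2 B hB).1, fun h0 ↦ hc' n hn h0 B hB⟩⟩
  · have h1 := hmem n hn
    rw [h0, Submodule.mem_bot] at h1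
    have h2 := (hN n hn).2
    rw [h1, Pi.zero_apply, norm_zero] at h2
    linarith

/-! ### Integral weight -/

/-- Cusp forms of integral weight in terms of the factor of automorphy `(cτ + d)ᵏ`. -/
lemma mem_cuspSpace_iff {Γ : Subgroup SL(2, ℤ)} [Γ.FiniteIndex] {k : ℕ} {f : ℍ → ℂ} :
    f ∈ cuspSpace Γ k ↔ IsCuspFormFor Γ (2 * k) (fun γ τ ↦ denom γ τ ^ k) f := by
  have hnorm : ∀ (σ : SL(2, ℤ)), IsZeroAtImInfty (f ∣[(k : ℤ)] σ) ↔ IsZeroAtImInfty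
      fun τ ↦ ‖denom σ τ‖ ^ (-((2 * k : ℕ) / 2 : ℝ)) * ‖f (σ • τ)‖ := fun σ ↦ by
    rw [IsZeroAtImInfty, IsZeroAtImInfty, Filter.ZeroAtFilter, Filter.ZeroAtFilter,
      tendsto_zero_iff_norm_tendsto_zero]
    refine Filter.tendsto_congr fun τ ↦ ?_
    rw [ModularForm.SL_slash_apply, norm_mul, norm_zpow, mul_comm, ← Real.rpow_intCast]
    congr 2
    push_cast
    ring
  constructor
  · rintro ⟨F, rfl⟩
    refine ⟨F.holo', fun γ hγ τ ↦ ?_, fun σ ↦ ?_⟩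
    · have h1 := F.slash_action_eq' γ ⟨γ, hγ, rfl⟩
      have h2 := (ModularForm.slash_action_eq'_iff k F γ τ).mp (congrFun h1 τ)
      rw [zpow_natCast] at h2
      exact h2
    · exact (hnorm σ).mp (CuspFormClass.zero_at_infty_slash F σ)
  · intro hf
    refine ⟨⟨⟨f, ?_⟩, hf.mdifferentiable, ?_⟩, rfl⟩
    · rintro _ ⟨γ, hγ, rfl⟩
      ext τ
      refine (ModularForm.slash_action_eq'_iff k f γ τ).mpr ?_
      rw [zpow_natCast]
      exact hf.smul_eq γ hγ τ
    · intro c hc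
      rw [Subgroup.IsArithmetic.isCusp_iff_isCusp_SL2Z] at hc
      rw [OnePoint.isZeroAt_iff_forall_SL2Z hc]
      exact fun σ _ ↦ (hnorm σ).mpr (hf.zero σ)

lemma denom_SL2Z_mul (γ δ : SL(2, ℤ)) (τ : ℍ) :
    denom (γ * δ : SL(2, ℤ)) τ = denom γ (δ • τ : ℍ) * denom δ τ := by
  have := denom_cocycle (γ : GL (Fin 2) ℝ) δ τ.im_ne_zero
  rw [← coe_smul_of_det_pos (by simp)] at this
  rw [map_mul, map_mul]
  exact this

lemma isAutomorphyFactor_denom_pow (Γ : Subgroup SL(2, ℤ)) (k : ℕ) :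
    IsAutomorphyFactor Γ (2 * k) fun γ τ ↦ denom γ τ ^ k := by
  refine ⟨fun γ _ ↦ ?_, fun γ _ δ _ τ ↦ ?_, fun γ _ τ ↦ ?_⟩
  · exact (UpperHalfPlane.mdifferentiable_denom γ).pow k
  · rw [← mul_pow]
    rw [denom_SL2Z_mul]
  · rw [← pow_mul]
    ring

/-- The upper triangular matrices in `SL(2, ℤ)`. -/
def upperTriangular : Subgroup SL(2, ℤ) := Gamma0 0

/-- Congruence modulo 0 is equality in ℤ. -/
lemma mem_upperTriangular {γ : SL(2, ℤ)} : γ ∈ upperTriangular ↔ γ 1 0 = 0 := by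
  rw [upperTriangular, Gamma0_mem]
  exact Iff.rfl

lemma upperTriangular_le_Gamma0 (N : ℕ) : upperTriangular ≤ Gamma0 N := fun γ hγ ↦ by
  rw [Gamma0_mem, mem_upperTriangular.mp hγ, Int.cast_zero]

/-- A nonzero c is not divisible by any N > |c|: the groups shrink to their intersection. -/
lemma eventually_notMem_Gamma0 {γ : SL(2, ℤ)} (hγ : γ ∉ upperTriangular) :
    ∀ᶠ N in Filter.atTop, γ ∉ Gamma0 N := by
  rw [mem_upperTriangular] at hγ
  filter_upwards [Filter.eventually_gt_atTop (γ 1 0).natAbs] with N hN h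
  rw [Gamma0_mem, ZMod.intCast_zmod_eq_zero_iff_dvd] at h
  exact hγ (Int.eq_zero_of_abs_lt_dvd h (by rw [Int.abs_eq_natAbs]; omega))

lemma eventually_notMem_Gamma {γ : SL(2, ℤ)} (hγ : γ ∉ (⊥ : Subgroup SL(2, ℤ))) :
    ∀ᶠ N in Filter.atTop, γ ∉ Gamma N := by
  have h (a b : ℤ) : ∀ᶠ N : ℕ in Filter.atTop, (a : ZMod N) = b → a = b := by
    filter_upwards [Filter.eventually_gt_atTop (a - b).natAbs] with N hN h
    rw [← sub_eq_zero, ← Int.cast_sub, ZMod.intCast_zmod_eq_zero_iff_dvd] at h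
    exact sub_eq_zero.mp (Int.eq_zero_of_abs_lt_dvd h (by rw [Int.abs_eq_natAbs]; omega))
  filter_upwards [h (γ 0 0) 1, h (γ 0 1) 0, h (γ 1 0) 0, h (γ 1 1) 1] with N h1 h2 h3 h4 hN
  rw [Gamma_mem] at hN
  refine hγ (Subgroup.mem_bot.mpr ?_)
  push_cast at h1 h2 h3 h4
  ext i j
  fin_cases i <;> fin_cases j
  exacts [h1 hN.1, h2 hN.2.1, h3 hN.2.2.1, h4 hN.2.2.2]

/-- Translations up to sign, as matrices. -/
def signedTranslation (p : ℤˣ × ℤ) : SL(2, ℤ) :=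
  ⟨!![(p.1 : ℤ), p.1 * p.2; 0, p.1], by
    rw [Matrix.det_fin_two_of]; simp⟩

/-- Upper triangular matrices are signed translations. -/
def signedTranslationEquiv : ℤˣ × ℤ ≃ upperTriangular :=
  Equiv.ofBijective (fun p ↦ ⟨signedTranslation p, mem_upperTriangular.mpr rfl⟩) <| by
    constructor
    · rintro ⟨a, m⟩ ⟨b, n⟩ h
      have h1 : ∀ i j, signedTranslation (a, m) i j = signedTranslation (b, n) i j := fun i j ↦
        congrArg (fun γ : SL(2, ℤ) ↦ γ i j) (Subtype.ext_iff.mp h)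
      have h2 : a = b := Units.ext (h1 0 0)
      subst h2
      have h3 : (a : ℤ) * m = a * n := h1 0 1
      rw [Units.mul_right_inj] at h3
      rw [h3]
    · rintro ⟨γ, hγ⟩
      rw [mem_upperTriangular] at hγ
      have hdet := Matrix.SpecialLinearGroup.det_coe γ
      rw [Matrix.det_fin_two, hγ, mul_zero, sub_zero] at hdet
      let a : ℤˣ := ⟨γ 0 0, γ 1 1, hdet, by rw [mul_comm]; exact hdet⟩
      have ha : γ 0 0 = γ 1 1 := by
        rcases Int.mul_eq_one_iff_eq_one_or_neg_one.mp hdet with h | h <;> rw [h.1, h.2]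
      refine ⟨(a, γ 1 1 * γ 0 1), Subtype.ext ?_⟩
      ext i j
      fin_cases i <;> fin_cases j
      · rfl
      · change γ 0 0 * (γ 1 1 * γ 0 1) = γ 0 1
        rw [← mul_assoc, hdet, one_mul]
      · exact hγ.symm
      · exact ha

lemma coe_signedTranslation_smul (p : ℤˣ × ℤ) (z : ℍ) :
    ((signedTranslation p • z : ℍ) : ℂ) = z + p.2 := by
  have h : ((p.1 : ℤ) : ℂ) ≠ 0 := by exact_mod_cast p.1.ne_zero
  rw [coe_specialLinearGroup_apply]
  simp only [signedTranslation, Matrix.SpecialLinearGroup.coe_mk, Matrix.of_apply,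
    Matrix.cons_val_zero, Matrix.cons_val_one, algebraMap_int_eq, eq_intCast,
    Complex.ofReal_intCast]
  push_cast
  field_simp
  ring

/-- The term n = 0 is 1/0 = 0, so the sum is 2ζ(2). -/
lemma hasSum_int_inv_sq : HasSum (fun n : ℤ ↦ 1 / (n : ℝ) ^ 2) (Real.pi ^ 2 / 3) := by
  have h1 : HasSum (fun n : ℕ ↦ 1 / (((n : ℕ) : ℤ) : ℝ) ^ 2) (Real.pi ^ 2 / 6) := by
    simpa using hasSum_zeta_two
  have h2 : HasSum (fun n : ℕ ↦ 1 / ((-((n : ℕ) : ℤ) : ℤ) : ℝ) ^ 2) (Real.pi ^ 2 / 6) := by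
    simpa using hasSum_zeta_two
  have h3 := HasSum.of_nat_of_neg (f := fun n : ℤ ↦ 1 / (n : ℝ) ^ 2) h1 h2
  have h4 : Real.pi ^ 2 / 6 + Real.pi ^ 2 / 6 - 1 / ((0 : ℤ) : ℝ) ^ 2 = Real.pi ^ 2 / 3 := by
    norm_num
    ring
  rwa [h4] at h3

/-- The term n = 0 has absolute value 2^m ≥ 4, while the others add up to at most π²/3 < 4. -/
lemma tsum_int_add_inv_pow_ne_zero {m : ℕ} (hm : 2 ≤ m) :
    ∑' n : ℤ, ((n : ℂ) + Complex.I / 2)⁻¹ ^ m ≠ 0 := by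
  have h0 : ∀ n : ℤ, n ≠ 0 → ‖((n : ℂ) + Complex.I / 2)⁻¹ ^ m‖ ≤ 1 / (n : ℝ) ^ 2 := by
    intro n hn
    have h1 : |(n : ℝ)| ≤ ‖(n : ℂ) + Complex.I / 2‖ := by
      simpa using Complex.abs_re_le_norm ((n : ℂ) + Complex.I / 2)
    have h2 : (1 : ℝ) ≤ |(n : ℝ)| := by exact_mod_cast Int.one_le_abs hn
    rw [norm_pow, norm_inv, inv_pow, ← one_div, ← sq_abs (n : ℝ)]
    gcongr
    calc |(n : ℝ)| ^ 2 ≤ ‖(n : ℂ) + Complex.I / 2‖ ^ 2 := by gcongr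
      _ ≤ _ := pow_le_pow_right₀ (h2.trans h1) hm
  have hs : Summable fun n : ℤ ↦ ((n : ℂ) + Complex.I / 2)⁻¹ ^ m := by
    refine Summable.of_norm_bounded_eventually hasSum_int_inv_sq.summable ?_
    filter_upwards [(Set.finite_singleton (0 : ℤ)).compl_mem_cofinite] with n hn using h0 n hn
  rw [hs.tsum_eq_add_tsum_ite 0]
  have h1 : ‖∑' n : ℤ, ite (n = 0) 0 (((n : ℂ) + Complex.I / 2)⁻¹ ^ m)‖ ≤ Real.pi ^ 2 / 3 := by
    refine tsum_of_norm_bounded hasSum_int_inv_sq fun n ↦ ?_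
    split_ifs with h
    · rw [norm_zero]
      positivity
    · exact h0 n h
  have h2 : ‖(((0 : ℤ) : ℂ) + Complex.I / 2)⁻¹ ^ m‖ = 2 ^ m := by simp
  have h3 : (2 : ℝ) ^ 2 ≤ 2 ^ m := pow_le_pow_right₀ (by norm_num) hm
  intro h
  rw [eq_neg_of_add_eq_zero_left h, norm_neg] at h2
  nlinarith [Real.pi_lt_d2, Real.pi_pos]

/-- Nonvanishing of the Poincaré series for the stabilizer of the cusp `∞`. -/
lemma poincareSeries_upperTriangular_ne_zero {w : ℕ} (hw : 5 ≤ w) {J : SL(2, ℤ) → ℍ → ℂ}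
    (hJ : IsAutomorphyFactor upperTriangular w J)
    (hJ1 : ∀ γ ∈ upperTriangular, ∀ z, J γ z = 1) :
    poincareSeries upperTriangular J (poincareSeed w) ⟨Complex.I / 4, by simp⟩ ≠ 0 := by
  set z : ℍ := ⟨Complex.I / 4, by simp⟩ with hz
  have hsum := (summable_poincareSeries hJ (mdifferentiable_poincareSeed w)
    (lintegral_weightedNorm_poincareSeed_ne_top hw) z).of_norm
  have hterm : ∀ p, (J (signedTranslationEquiv p) z)⁻¹ *
      poincareSeed w ((signedTranslationEquiv p : SL(2, ℤ)) • z) =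
        ((p.2 : ℂ) + Complex.I / 2)⁻¹ ^ (w + 2) := fun p ↦ by
    rw [hJ1 _ (signedTranslationEquiv p).2, inv_one, one_mul, poincareSeed]
    change ((signedTranslation p • z : ℍ) + Complex.I / 4 : ℂ)⁻¹ ^ _ = _
    rw [coe_signedTranslation_smul]
    congr 2
    change Complex.I / 4 + p.2 + Complex.I / 4 = _
    ring
  rw [← signedTranslationEquiv.summable_iff] at hsum
  unfold poincareSeries
  rw [← signedTranslationEquiv.tsum_eq]
  -- At z = i/4 the translate by n contributes (n + i/2)^(-w-2) for either sign of the matrix, so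
  -- the series is twice the sum over ℤ.
  refine ne_of_eq_of_ne hsum.tsum_prod ?_
  rw [tsum_fintype]
  simp only [Function.comp_apply, hterm, Finset.sum_const, Finset.card_univ]
  exact smul_ne_zero (by simp) (tsum_int_add_inv_pow_ne_zero (by omega))

/-- The case of the groups `Γ(N)`. -/
theorem exists_bergmanSup_bounds_Gamma {k : ℕ} (hk : 2 < k) :
    (∃ c C : ℝ, 0 < c ∧ ∀ N : ℕ, 1 ≤ N →
      (∃ B, IsPeterssonOrthonormalBasis k (Gamma N) (cuspSpace (Gamma N) k) B) ∧
      ∀ B, IsPeterssonOrthonormalBasis k (Gamma N) (cuspSpace (Gamma N) k) B →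
        bergmanSup k B ≤ ENNReal.ofReal C ∧
        (cuspSpace (Gamma N) k ≠ ⊥ → ENNReal.ofReal c ≤ bergmanSup k B)) ∧
    (∃ N₀ : ℕ, ∀ N : ℕ, N₀ ≤ N → cuspSpace (Gamma N) k ≠ ⊥) := by
  have hw : ((2 * k : ℕ) / 2 : ℝ) = k := by push_cast; ring
  have hfin : ∀ N, 1 ≤ N → (Gamma N).FiniteIndex := fun N hN ↦ by
    have : NeZero N := ⟨by omega⟩
    infer_instance
  have := exists_bergmanSup_bounds (w := 2 * k) (by omega) (isAutomorphyFactor_denom_pow ⊤ k)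
    (mdifferentiable_poincareSeed _) (lintegral_weightedNorm_poincareSeed_ne_top (by omega))
    (G := fun N ↦ Gamma N) (L := ⊥) (fun _ ↦ le_top) hfin (fun _ ↦ bot_le)
    (fun γ hγ ↦ eventually_notMem_Gamma hγ) (S := fun N ↦ cuspSpace (Gamma N) k)
    (fun N hN f ↦ by have := hfin N hN; exact mem_cuspSpace_iff) (z := I) (by
      -- Over the trivial group the series has a single term, which vanishes nowhere.
      rw [poincareSeries, tsum_fintype, Fintype.sum_unique]
      refine mul_ne_zero (inv_ne_zero (pow_ne_zero _ (denom_ne_zero _ _))) ?_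
      exact pow_ne_zero _ (inv_ne_zero (add_I_div_four_ne_zero _)))
  rwa [hw] at this

/-- The case of the groups `Γ₀(N)`. -/
theorem exists_bergmanSup_bounds_Gamma0 {k : ℕ} (hk : 2 < k) :
    (∃ c C : ℝ, 0 < c ∧ ∀ N : ℕ, 1 ≤ N →
      (∃ B, IsPeterssonOrthonormalBasis k (Gamma0 N) (cuspSpace (Gamma0 N) k) B) ∧
      ∀ B, IsPeterssonOrthonormalBasis k (Gamma0 N) (cuspSpace (Gamma0 N) k) B →
        bergmanSup k B ≤ ENNReal.ofReal C ∧
        (cuspSpace (Gamma0 N) k ≠ ⊥ → ENNReal.ofReal c ≤ bergmanSup k B)) ∧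
    (Even k → ∃ N₀ : ℕ, ∀ N : ℕ, N₀ ≤ N → cuspSpace (Gamma0 N) k ≠ ⊥) := by
  have hw : ((2 * k : ℕ) / 2 : ℝ) = k := by push_cast; ring
  have hfin : ∀ N, 1 ≤ N → (Gamma0 N).FiniteIndex := fun N hN ↦ by
    have : NeZero N := ⟨by omega⟩
    infer_instance
  by_cases hk2 : Even k
  · have := exists_bergmanSup_bounds (w := 2 * k) (by omega) (isAutomorphyFactor_denom_pow ⊤ k)
      (mdifferentiable_poincareSeed _) (lintegral_weightedNorm_poincareSeed_ne_top (by omega))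
      (G := fun N ↦ Gamma0 N) (L := upperTriangular) (fun _ ↦ le_top) hfin
      upperTriangular_le_Gamma0
      (fun γ hγ ↦ eventually_notMem_Gamma0 hγ) (S := fun N ↦ cuspSpace (Gamma0 N) k)
      (fun N hN f ↦ by have := hfin N hN; exact mem_cuspSpace_iff)
      (poincareSeries_upperTriangular_ne_zero (by omega) (isAutomorphyFactor_denom_pow _ k) (by
        intro γ hγ z
        rw [mem_upperTriangular] at hγ
        have hdet := Matrix.SpecialLinearGroup.det_coe γ
        rw [Matrix.det_fin_two, hγ, mul_zero, sub_zero] at hdet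
        rw [ModularGroup.denom_apply, hγ]
        rcases Int.mul_eq_one_iff_eq_one_or_neg_one.mp hdet with h | h <;>
          simp [h.2, hk2.neg_one_pow]))
    rw [hw] at this
    exact ⟨this.1, fun _ ↦ this.2⟩
  -- For odd k the matrix -1 gives f = -f, so the space is zero and any c serves.
  · obtain ⟨C, hC⟩ := exists_bergmanSup_le (2 * k)
    rw [hw] at hC
    refine ⟨⟨1, C, one_pos, fun N hN ↦ ?_⟩, fun h ↦ absurd h hk2⟩
    have := hfin N hN
    obtain ⟨h1, h2⟩ := hC (Gamma0 N) _ (isAutomorphyFactor_denom_pow _ k) (cuspSpace (Gamma0 N) k)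
      fun f ↦ mem_cuspSpace_iff.mp
    refine ⟨h1, fun B hB ↦ ⟨(h2 B hB).1, fun h0 ↦ absurd ?_ h0⟩⟩
    refine (Submodule.eq_bot_iff _).mpr fun f hf ↦ funext fun τ ↦ ?_
    have h3 := (mem_cuspSpace_iff.mp hf).smul_eq (-1) (by
      rw [Gamma0_mem]
      simp) τ
    rw [ModularGroup.SL_neg_smul, one_smul, ModularGroup.denom_apply] at h3
    simpa [(Nat.not_even_iff_odd.mp hk2).neg_one_pow, self_eq_neg] using h3

/-! ### The theta multiplier -/

section Symbol

lemma jacobiSym_neg_eq_of_mod_four_eq {m n : ℕ} (hn : Odd n) (h : m % 4 = n % 4) :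
    jacobiSym (-m) n = jacobiSym n m := by
  rw [jacobiSym.neg _ hn]
  rcases Nat.odd_mod_four_iff.mp (Nat.odd_iff.mp hn) with h1 | h1
  · rw [ZMod.χ₄_nat_one_mod_four h1, one_mul,
      jacobiSym.quadratic_reciprocity_one_mod_four (h.trans h1) hn]
  · rw [ZMod.χ₄_nat_three_mod_four h1,
      jacobiSym.quadratic_reciprocity_three_mod_four (h.trans h1) h1]
    simp

lemma jacobiSym_eq_of_add_mod_four {m n : ℕ} (hm : Odd m) (hn : Odd n) (h : (m + n) % 4 = 0) :
    jacobiSym m n = jacobiSym n m := by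
  rcases Nat.odd_mod_four_iff.mp (Nat.odd_iff.mp hn) with h1 | h1
  · exact (jacobiSym.quadratic_reciprocity_one_mod_four h1 hm).symm
  · exact jacobiSym.quadratic_reciprocity_one_mod_four (by omega) hn

lemma jacobiSym_neg_eq_of_add_mod_four {m n : ℕ} (hm : Odd m) (hn : Odd n)
    (h : (m + n) % 4 = 0) : jacobiSym (-m) n = -jacobiSym (-n) m := by
  rw [jacobiSym.neg _ hn, jacobiSym.neg _ hm, jacobiSym_eq_of_add_mod_four hm hn h]
  rcases Nat.odd_mod_four_iff.mp (Nat.odd_iff.mp hn) with h1 | h1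
  · rw [ZMod.χ₄_nat_one_mod_four h1, ZMod.χ₄_nat_three_mod_four (show m % 4 = 3 by omega)]
    simp
  · rw [ZMod.χ₄_nat_three_mod_four h1, ZMod.χ₄_nat_one_mod_four (show m % 4 = 1 by omega)]
    simp

lemma jacobiSym_eq_of_dvd_sub {a b : ℤ} {n : ℕ} (h : (n : ℤ) ∣ b - a) :
    jacobiSym a n = jacobiSym b n :=
  jacobiSym.mod_left' (Int.modEq_iff_dvd.mpr h)

/-- With e = c + d one has c ≡ -d mod e and c ≡ e mod d, so the claim is quadratic reciprocity for
|d| and |e|. The sign convention for negative entries matches the four sign cases. -/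
lemma thetaSymbol_add_right {c d : ℤ} (hc : 4 ∣ c) (hd : Odd d) :
    thetaSymbol c (c + d) = thetaSymbol c d := by
  obtain ⟨e, he⟩ : ∃ e, e = c + d := ⟨_, rfl⟩
  rw [← he]
  obtain rfl : c = e - d := by omega
  have hd' := Int.odd_iff.mp hd
  unfold thetaSymbol
  obtain ⟨n, rfl | rfl⟩ := Int.eq_nat_or_neg d <;> obtain ⟨m, rfl | rfl⟩ := Int.eq_nat_or_neg e
  · have hn : Odd n := Nat.odd_iff.mpr (by omega)
    have hm : Odd m := Nat.odd_iff.mpr (by omega)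
    rw [if_neg (by omega), if_neg (by omega), Int.natAbs_natCast, Int.natAbs_natCast,
      jacobiSym_eq_of_dvd_sub (n := m) (b := -n) ⟨-1, by ring⟩,
      jacobiSym_eq_of_dvd_sub (n := n) (b := m) ⟨1, by ring⟩]
    exact jacobiSym_neg_eq_of_mod_four_eq hm (by omega)
  · have hn : Odd n := Nat.odd_iff.mpr (by omega)
    have hm : Odd m := Nat.odd_iff.mpr (by omega)
    have := hm.pos
    rw [if_pos (by omega), if_neg (by omega), Int.natAbs_neg, Int.natAbs_natCast,
      Int.natAbs_natCast,
      jacobiSym_eq_of_dvd_sub (n := m) (b := -n) ⟨1, by ring⟩,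
      jacobiSym_eq_of_dvd_sub (n := n) (b := -m) ⟨1, by ring⟩]
    exact (jacobiSym_neg_eq_of_add_mod_four hm hn (by omega)).symm
  · have hn : Odd n := Nat.odd_iff.mpr (by omega)
    have hm : Odd m := Nat.odd_iff.mpr (by omega)
    rw [if_neg (by omega), if_neg (by omega), Int.natAbs_neg, Int.natAbs_natCast,
      Int.natAbs_natCast,
      jacobiSym_eq_of_dvd_sub (n := m) (b := n) ⟨-1, by ring⟩,
      jacobiSym_eq_of_dvd_sub (n := n) (b := m) ⟨-1, by ring⟩]
    exact jacobiSym_eq_of_add_mod_four hn hm (by omega)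
  · have hn : Odd n := Nat.odd_iff.mpr (by omega)
    have hm : Odd m := Nat.odd_iff.mpr (by omega)
    have := hm.pos
    have := hn.pos
    have key : jacobiSym (-m - -n) m = jacobiSym (-m - -n) n := by
      rw [jacobiSym_eq_of_dvd_sub (n := m) (b := n) ⟨1, by ring⟩,
        jacobiSym_eq_of_dvd_sub (n := n) (b := -m) ⟨-1, by ring⟩]
      exact (jacobiSym_neg_eq_of_mod_four_eq hn (by omega)).symm
    simp only [Int.natAbs_neg, Int.natAbs_natCast, key]
    split_ifs <;> first | rfl | omega

/-- The residue of c modulo d is unchanged; only the sign convention can react. The resulting sign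
later cancels a jump of the square root. -/
lemma thetaSymbol_add_left (c d : ℤ) :
    thetaSymbol (c + 4 * d) d =
      if d < 0 ∧ 0 ≤ c ∧ c + 4 * d < 0 then -thetaSymbol c d else thetaSymbol c d := by
  unfold thetaSymbol
  rw [← jacobiSym_eq_of_dvd_sub (a := c) (b := c + 4 * d) (n := d.natAbs)
    (by rw [Int.natAbs_dvd, add_sub_cancel_left]; exact dvd_mul_left d 4)]
  split_ifs <;> first | rfl | omega

lemma thetaSymbol_sq {c d : ℤ} (h : IsCoprime c d) : thetaSymbol c d ^ 2 = 1 := by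
  have h1 : jacobiSym c d.natAbs ^ 2 = 1 := by
    refine jacobiSym.sq_one ?_
    rw [← Int.isCoprime_iff_gcd_eq_one]
    exact IsCoprime.of_isCoprime_of_dvd_right h (Int.natAbs_dvd.mpr dvd_rfl)
  unfold thetaSymbol
  split_ifs
  · rwa [neg_sq]
  · exact h1

lemma thetaEpsilon_pow_four (d : ℤ) : thetaEpsilon d ^ 4 = 1 := by
  unfold thetaEpsilon
  split_ifs
  · rw [one_pow]
  · exact Complex.I_pow_four

lemma thetaEpsilon_add {c : ℤ} (hc : 4 ∣ c) (d : ℤ) : thetaEpsilon (c + d) = thetaEpsilon d := by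
  unfold thetaEpsilon
  rw [show (c + d) % 4 = d % 4 by omega]

/-- The factor -i is what the principal square root of cτ + d acquires under γ ↦ -γ when c > 0. -/
lemma thetaSymbol_neg_mul_thetaEpsilon_neg {c d : ℤ} (hc : 0 < c) (hd : Odd d) :
    (thetaSymbol (-c) (-d) : ℂ) * (thetaEpsilon (-d))⁻¹ * -Complex.I =
      thetaSymbol c d * (thetaEpsilon d)⁻¹ := by
  have hd' := Int.odd_iff.mp hd
  unfold thetaSymbol thetaEpsilon
  have hn : Odd d.natAbs := Int.natAbs_odd.mpr hd
  rw [Int.natAbs_neg, jacobiSym.neg _ hn, if_neg (show ¬ (c < 0 ∧ d < 0) by omega)]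
  rcases lt_or_ge d 0 with h0 | h0 <;> rcases (by omega : d % 4 = 1 ∨ d % 4 = 3) with h | h
  · rw [ZMod.χ₄_nat_three_mod_four (by omega), if_neg (by omega), if_neg (by omega), if_pos h]
    simp [mul_assoc]
  · rw [ZMod.χ₄_nat_one_mod_four (by omega), if_neg (by omega), if_pos (by omega),
      if_neg (by omega)]
    simp
  · rw [ZMod.χ₄_nat_one_mod_four (by omega), if_pos (by omega), if_neg (by omega), if_pos h]
    simp [mul_assoc]
  · rw [ZMod.χ₄_nat_three_mod_four (by omega), if_pos (by omega), if_pos (by omega),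
      if_neg (by omega)]
    simp

end Symbol

/-! ### The principal square root and its branch cut -/

section SquareRoot

lemma cpow_half_sq (z : ℂ) : (z ^ (1 / 2 : ℂ)) ^ 2 = z := by
  simp

lemma neg_cpow_half {z : ℂ} (hz : 0 < z.im) :
    (-z) ^ (1 / 2 : ℂ) = -Complex.I * z ^ (1 / 2 : ℂ) := by
  have h0 : z ≠ 0 := by rintro rfl; simp at hz
  rw [Complex.cpow_def_of_ne_zero (neg_ne_zero.mpr h0), Complex.cpow_def_of_ne_zero h0,
    Complex.log, Complex.log, norm_neg, Complex.arg_neg_eq_arg_sub_pi_of_im_pos hz,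
    ← Complex.exp_neg_pi_div_two_mul_I, ← Complex.exp_add]
  congr 1
  push_cast
  ring

lemma cpow_half_mul {x y : ℂ} (hx : x ≠ 0) (hy : y ≠ 0)
    (h : Complex.arg x + Complex.arg y ∈ Set.Ioc (-Real.pi) Real.pi) :
    (x * y) ^ (1 / 2 : ℂ) = x ^ (1 / 2 : ℂ) * y ^ (1 / 2 : ℂ) := by
  rw [Complex.cpow_def_of_ne_zero (mul_ne_zero hx hy), Complex.cpow_def_of_ne_zero hx,
    Complex.cpow_def_of_ne_zero hy, Complex.log_mul hx hy h, ← Complex.exp_add]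
  congr 1
  ring

/-- The only obstruction is arg x + arg y > π. Then -xy would have argument arg x + arg y - π in (0,
π), against Im(xy) ≥ 0. -/
lemma cpow_half_mul_of_im_nonneg {x y : ℂ} (hx : 0 < x.im) (hy : y ≠ 0) (hy' : 0 ≤ y.arg)
    (hxy : 0 ≤ (x * y).im) :
    (x * y) ^ (1 / 2 : ℂ) = x ^ (1 / 2 : ℂ) * y ^ (1 / 2 : ℂ) := by
  have h0 : x ≠ 0 := by rintro rfl; simp at hx
  have hx' : 0 ≤ x.arg := Complex.arg_nonneg_iff.mpr hx.le
  refine cpow_half_mul h0 hy ⟨by linarith [Real.pi_pos], ?_⟩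
  by_contra! h
  have hneg := Complex.arg_neg_eq_arg_sub_pi_of_im_pos hx
  have h1 : (-x * y).arg = x.arg - Real.pi + y.arg := by
    rw [← hneg]
    refine Complex.arg_mul (neg_ne_zero.mpr h0) hy ?_
    rw [hneg]
    exact ⟨by linarith [Real.pi_pos], by linarith [Complex.arg_le_pi x, Complex.arg_le_pi y]⟩
  have h2 : (-x * y).im ≤ 0 := by
    rw [neg_mul, Complex.neg_im]
    linarith
  have h3 : x.arg < Real.pi := Complex.arg_lt_pi_iff.mpr (.inr hx.ne')
  have h4 := Real.sin_pos_of_pos_of_lt_pi (x := (-x * y).arg) (by linarith)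
    (by linarith [Complex.arg_le_pi y])
  rw [← Complex.norm_mul_sin_arg (-x * y)] at h2
  have h5 : 0 < ‖-x * y‖ := norm_pos_iff.mpr (mul_ne_zero (neg_ne_zero.mpr h0) hy)
  nlinarith

/-- Here the arguments add up to more than π, so the product crosses the cut and the root changes
sign. -/
lemma cpow_half_mul_of_im_neg {x y : ℂ} (hx : 0 < x.im) (hy : y ≠ 0) (hy' : 0 ≤ y.arg)
    (hxy : (x * y).im < 0) :
    (x * y) ^ (1 / 2 : ℂ) = -(x ^ (1 / 2 : ℂ) * y ^ (1 / 2 : ℂ)) := by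
  have h0 : x ≠ 0 := by rintro rfl; simp at hx
  have hx' : 0 ≤ x.arg := Complex.arg_nonneg_iff.mpr hx.le
  have hneg := Complex.arg_neg_eq_arg_sub_pi_of_im_pos hx
  have h1 : Real.pi < x.arg + y.arg := by
    by_contra! h
    have h2 := Complex.arg_mul h0 hy ⟨by linarith [Real.pi_pos], h⟩
    linarith [Complex.arg_neg_iff.mpr hxy]
  have h2 : (-x * y) ^ (1 / 2 : ℂ) = (-x) ^ (1 / 2 : ℂ) * y ^ (1 / 2 : ℂ) := by
    refine cpow_half_mul (neg_ne_zero.mpr h0) hy ?_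
    rw [hneg]
    exact ⟨by linarith [Real.pi_pos], by linarith [Complex.arg_le_pi x, Complex.arg_le_pi y]⟩
  have h3 : 0 < (-x * y).im := by
    rw [neg_mul, Complex.neg_im]
    linarith
  have h4 := neg_cpow_half h3
  rw [h2, neg_cpow_half hx, neg_mul, neg_neg] at h4
  rw [h4]
  linear_combination x ^ (1 / 2 : ℂ) * y ^ (1 / 2 : ℂ) * Complex.I_sq

end SquareRoot


/-! ### The theta factor on Γ₀(4) and half-integral weight -/

section Factor

/-- The factor of automorphy of weight `1 / 2`. -/
def thetaRoot (γ : SL(2, ℤ)) (τ : ℍ) : ℂ :=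
  (thetaSymbol (γ 1 0) (γ 1 1) : ℂ) * (thetaEpsilon (γ 1 1))⁻¹ * (denom γ τ) ^ (1 / 2 : ℂ)

lemma thetaFactor_eq (k : ℕ) (γ : SL(2, ℤ)) (τ : ℍ) :
    thetaFactor k γ τ = thetaRoot γ τ ^ (2 * k + 1) := by
  rw [thetaRoot, mul_pow, mul_pow, ← Complex.cpow_nat_mul, thetaFactor,
    ModularGroup.denom_apply]
  congr 2
  push_cast
  ring

lemma Gamma0_four_apply {γ : SL(2, ℤ)} (hγ : γ ∈ Gamma0 4) :
    4 ∣ γ 1 0 ∧ Odd (γ 1 1) ∧ IsCoprime (γ 1 0) (γ 1 1) := by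
  have h1 : 4 ∣ γ 1 0 := by
    rw [Gamma0_mem, ZMod.intCast_zmod_eq_zero_iff_dvd] at hγ
    exact_mod_cast hγ
  have hdet := Matrix.SpecialLinearGroup.det_coe γ
  rw [Matrix.det_fin_two] at hdet
  refine ⟨h1, ?_, -γ 0 1, γ 0 0, by linarith⟩
  obtain ⟨c, hc⟩ := h1
  by_contra! h
  rw [Int.not_odd_iff_even] at h
  obtain ⟨d, hd⟩ := h
  rw [hc, hd] at hdet
  have : 2 * (γ 0 0 * d - γ 0 1 * (2 * c)) = 1 := by linarith
  omega

lemma thetaRoot_pow_four {γ : SL(2, ℤ)} (hγ : γ ∈ Gamma0 4) (τ : ℍ) :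
    thetaRoot γ τ ^ 4 = denom γ τ ^ 2 := by
  have h1 : (thetaSymbol (γ 1 0) (γ 1 1) : ℂ) ^ 2 = 1 := by
    exact_mod_cast thetaSymbol_sq (Gamma0_four_apply hγ).2.2
  rw [thetaRoot, mul_pow, mul_pow, inv_pow, thetaEpsilon_pow_four, pow_mul _ 2 2, h1,
    pow_mul _ 2 2, cpow_half_sq]
  simp

lemma thetaRoot_of_mem_upperTriangular {γ : SL(2, ℤ)} (hγ : γ ∈ upperTriangular) (τ : ℍ) :
    thetaRoot γ τ = 1 := by
  rw [mem_upperTriangular] at hγ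
  have hdet := Matrix.SpecialLinearGroup.det_coe γ
  rw [Matrix.det_fin_two, hγ, mul_zero, sub_zero] at hdet
  rw [thetaRoot, ModularGroup.denom_apply, hγ]
  rcases Int.mul_eq_one_iff_eq_one_or_neg_one.mp hdet with h | h
  · simp [h.2, thetaSymbol, thetaEpsilon]
  · have h1 : (-1 : ℂ) ^ (1 / 2 : ℂ) = Complex.I := by
      rw [Complex.cpow_def_of_ne_zero (by simp), Complex.log_neg_one,
        show (Real.pi : ℂ) * Complex.I * (1 / 2) = Real.pi / 2 * Complex.I by ring,
        Complex.exp_pi_div_two_mul_I]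
    rw [h.2]
    norm_num [thetaSymbol, thetaEpsilon]
    rw [h1, Complex.I_mul_I, neg_neg]

lemma SL2Z_mul_apply (γ δ : SL(2, ℤ)) (i j : Fin 2) :
    (γ * δ) i j = γ i 0 * δ 0 j + γ i 1 * δ 1 j := by
  rw [Matrix.SpecialLinearGroup.coe_mul, Matrix.mul_apply, Fin.sum_univ_two]

lemma neg_one_mem_upperTriangular : -1 ∈ upperTriangular := mem_upperTriangular.mpr (by decide)

/-- The cocycle relation for one factor on the right. -/
def IsThetaCocycle (δ : SL(2, ℤ)) : Prop :=
  ∀ γ ∈ Gamma0 4, ∀ τ, thetaRoot (γ * δ) τ = thetaRoot γ (δ • τ) * thetaRoot δ τ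

/-- The denominators agree, so all the content is the invariance of the symbol under d ↦ c + d, that
is, quadratic reciprocity. -/
lemma isThetaCocycle_T : IsThetaCocycle ModularGroup.T := by
  intro γ hγ τ
  have hT : ModularGroup.T ∈ upperTriangular := mem_upperTriangular.mpr rfl
  obtain ⟨h1, h2, -⟩ := Gamma0_four_apply hγ
  have h10 : (γ * ModularGroup.T) 1 0 = γ 1 0 := by
    rw [SL2Z_mul_apply]
    change γ 1 0 * 1 + γ 1 1 * 0 = _
    ring
  have h11 : (γ * ModularGroup.T) 1 1 = γ 1 0 + γ 1 1 := by
    rw [SL2Z_mul_apply]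
    change γ 1 0 * 1 + γ 1 1 * 1 = _
    ring
  have hden : denom ModularGroup.T τ = 1 := by
    rw [ModularGroup.denom_apply]
    change ((0 : ℤ) : ℂ) * τ + ((1 : ℤ) : ℂ) = 1
    simp
  rw [thetaRoot_of_mem_upperTriangular hT, mul_one, thetaRoot, thetaRoot, h10, h11,
    thetaSymbol_add_right h1 h2, thetaEpsilon_add h1, denom_SL2Z_mul, hden, mul_one]

lemma thetaRoot_neg_of_pos {γ : SL(2, ℤ)} (hd : Odd (γ 1 1)) (hc : 0 < γ 1 0) (τ : ℍ) :
    thetaRoot (-γ) τ = thetaRoot γ τ := by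
  have hden : denom (-γ : SL(2, ℤ)) τ = -denom γ τ := by
    rw [ModularGroup.denom_apply, ModularGroup.denom_apply, Matrix.SpecialLinearGroup.coe_neg,
      Matrix.neg_apply, Matrix.neg_apply]
    push_cast
    ring
  have him : 0 < (denom γ τ).im := by
    rw [ModularGroup.denom_apply]
    have : (0 : ℝ) < γ 1 0 := by exact_mod_cast hc
    simpa using mul_pos this τ.im_pos
  rw [thetaRoot, thetaRoot, hden, neg_cpow_half him, ← mul_assoc]
  congr 1
  exact thetaSymbol_neg_mul_thetaEpsilon_neg hc hd

lemma thetaRoot_neg {γ : SL(2, ℤ)} (hγ : γ ∈ Gamma0 4) (τ : ℍ) :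
    thetaRoot (-γ) τ = thetaRoot γ τ := by
  have hd := (Gamma0_four_apply hγ).2.1
  rcases lt_trichotomy (γ 1 0) 0 with h | h | h
  · have := thetaRoot_neg_of_pos (γ := -γ) (by simpa using hd) (by simpa using h) τ
    rwa [neg_neg, eq_comm] at this
  · rw [thetaRoot_of_mem_upperTriangular (mem_upperTriangular.mpr h),
      thetaRoot_of_mem_upperTriangular (mem_upperTriangular.mpr (by simpa using h))]
  · exact thetaRoot_neg_of_pos hd h τ

lemma isThetaCocycle_neg_one : IsThetaCocycle (-1) := by
  intro γ hγ τ
  rw [mul_neg_one, thetaRoot_neg hγ, ModularGroup.SL_neg_smul, one_smul,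
    thetaRoot_of_mem_upperTriangular neg_one_mem_upperTriangular, mul_one]

/-- The matrix `(1, 0; 4, 1)`. -/
def lowerFour : SL(2, ℤ) := ⟨!![1, 0; 4, 1], by simp⟩

/-- For c < 0 the two arguments have opposite signs and the roots multiply. For c ≥ 0 the root
changes sign exactly if c + 4d < 0, and so does the symbol. -/
lemma isThetaCocycle_lowerFour : IsThetaCocycle lowerFour := by
  intro γ hγ τ
  obtain ⟨h1, h2, -⟩ := Gamma0_four_apply hγ
  have h10 : (γ * lowerFour) 1 0 = γ 1 0 + 4 * γ 1 1 := by
    rw [SL2Z_mul_apply]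
    change γ 1 0 * 1 + γ 1 1 * 4 = _
    ring
  have h11 : (γ * lowerFour) 1 1 = γ 1 1 := by
    rw [SL2Z_mul_apply]
    change γ 1 0 * 0 + γ 1 1 * 1 = _
    ring
  have hV : thetaRoot lowerFour τ = denom lowerFour τ ^ (1 / 2 : ℂ) := by
    have h4 : jacobiSym 4 1 = 1 := jacobiSym.one_right 4
    simp [thetaRoot, lowerFour, thetaSymbol, thetaEpsilon]
  have hVim : 0 < (denom lowerFour τ).im := by
    rw [ModularGroup.denom_apply]
    change 0 < (((4 : ℤ) : ℂ) * τ + ((1 : ℤ) : ℂ)).im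
    simpa using τ.im_pos
  have hBim : (denom γ (lowerFour • τ : ℍ)).im = γ 1 0 * (lowerFour • τ).im := by
    simp [ModularGroup.denom_apply]
  have hABim : (denom lowerFour τ * denom γ (lowerFour • τ : ℍ)).im =
      (γ 1 0 + 4 * γ 1 1 : ℤ) * τ.im := by
    rw [mul_comm, ← denom_SL2Z_mul, ModularGroup.denom_apply, h10]
    simp
  have hτ := τ.im_pos
  have hτ' := (lowerFour • τ).im_pos
  have hB0 := denom_ne_zero γ (lowerFour • τ)
  rw [hV, thetaRoot, thetaRoot, h10, h11, thetaSymbol_add_left, denom_SL2Z_mul,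
    mul_comm (denom γ _)]
  rcases lt_or_ge (γ 1 0) 0 with hc | hc
  · have hc' : (γ 1 0 : ℝ) < 0 := by exact_mod_cast hc
    have h3 : (denom γ (lowerFour • τ : ℍ)).arg < 0 :=
      Complex.arg_neg_iff.mpr (by rw [hBim]; exact mul_neg_of_neg_of_pos hc' hτ')
    have h4 := Complex.arg_nonneg_iff.mpr hVim.le
    rw [if_neg (by omega), cpow_half_mul (denom_ne_zero _ _) hB0
      ⟨by linarith [Complex.neg_pi_lt_arg (denom γ (lowerFour • τ : ℍ))],
        by linarith [Complex.arg_le_pi (denom lowerFour τ)]⟩]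
    ring
  · have hc' : (0 : ℝ) ≤ γ 1 0 := by exact_mod_cast hc
    have h3 : 0 ≤ (denom γ (lowerFour • τ : ℍ)).arg :=
      Complex.arg_nonneg_iff.mpr (by rw [hBim]; exact mul_nonneg hc' hτ'.le)
    rcases lt_or_ge (γ 1 0 + 4 * γ 1 1) 0 with hcd | hcd
    · have hcd' : ((γ 1 0 + 4 * γ 1 1 : ℤ) : ℝ) < 0 := by exact_mod_cast hcd
      rw [if_pos ⟨by omega, hc, hcd⟩, cpow_half_mul_of_im_neg hVim hB0 h3
        (by rw [hABim]; exact mul_neg_of_neg_of_pos hcd' hτ)]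
      push_cast
      ring
    · have hcd' : (0 : ℝ) ≤ ((γ 1 0 + 4 * γ 1 1 : ℤ) : ℝ) := by exact_mod_cast hcd
      rw [if_neg (by omega), cpow_half_mul_of_im_nonneg hVim hB0 h3
        (by rw [hABim]; exact mul_nonneg hcd' hτ.le)]
      ring

/-- The elements of `Γ₀(4)` satisfying the cocycle relation. -/
def thetaCocycleSubgroup : Subgroup SL(2, ℤ) where
  carrier := {δ | δ ∈ Gamma0 4 ∧ IsThetaCocycle δ}
  mul_mem' {δ δ'} h h' := by
    refine ⟨mul_mem h.1 h'.1, fun γ hγ τ ↦ ?_⟩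
    rw [← mul_assoc, h'.2 _ (mul_mem hγ h.1), h.2 γ hγ, h'.2 δ h.1, mul_smul, mul_assoc]
  one_mem' := ⟨one_mem _, fun γ hγ τ ↦ by
    rw [mul_one, one_smul, thetaRoot_of_mem_upperTriangular (one_mem _), mul_one]⟩
  inv_mem' {δ} h := by
    refine ⟨inv_mem h.1, fun γ hγ τ ↦ ?_⟩
    have h1 := h.2 (γ * δ⁻¹) (mul_mem hγ (inv_mem h.1)) (δ⁻¹ • τ)
    have h2 := h.2 δ⁻¹ (inv_mem h.1) (δ⁻¹ • τ)
    rw [inv_mul_cancel, thetaRoot_of_mem_upperTriangular (one_mem _), smul_inv_smul] at h2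
    rw [inv_mul_cancel_right, smul_inv_smul] at h1
    rw [h1, mul_assoc, mul_comm (thetaRoot δ _), ← h2, mul_one]

lemma exists_two_mul_abs_add_mul_le (d : ℤ) {c : ℤ} (hc : c ≠ 0) :
    ∃ n : ℤ, 2 * |c * n + d| ≤ |c| := by
  have h1 := Int.emod_nonneg d hc
  have h2 := Int.emod_lt_abs d hc
  have h3 := Int.mul_ediv_add_emod d c
  rcases le_or_gt (2 * (d % c)) |c| with h | h
  · refine ⟨-(d / c), ?_⟩
    rw [show c * -(d / c) + d = d % c by linarith, abs_of_nonneg h1]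
    exact h
  · refine ⟨-(d / c) - c.sign, ?_⟩
    rw [show c * (-(d / c) - c.sign) + d = d % c - |c| by
      rw [mul_sub, Int.mul_sign_self, Int.abs_eq_natAbs]; linarith, abs_of_nonpos (by omega)]
    omega

lemma coe_lowerFour_zpow (n : ℤ) :
    ((lowerFour ^ n : SL(2, ℤ)) : Matrix (Fin 2) (Fin 2) ℤ) = !![1, 0; 4 * n, 1] := by
  induction n with
  | zero => rw [zpow_zero, Matrix.SpecialLinearGroup.coe_one, Matrix.one_fin_two, mul_zero]
  | succ n h =>
    rw [zpow_add, zpow_one, Matrix.SpecialLinearGroup.coe_mul, h, lowerFour,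
      Matrix.SpecialLinearGroup.coe_mk, Matrix.mul_fin_two]
    congr! 3
    ring_nf
  | pred n h =>
    rw [zpow_sub, zpow_one, Matrix.SpecialLinearGroup.coe_mul, h,
      Matrix.SpecialLinearGroup.coe_inv, lowerFour, Matrix.SpecialLinearGroup.coe_mk,
      Matrix.adjugate_fin_two_of, Matrix.mul_fin_two]
    congr! 3
    ring_nf

/-- `Γ₀(4)` is generated by `-1`, `(1, 1; 0, 1)` and `(1, 0; 4, 1)`. -/
lemma Gamma0_four_le {H : Subgroup SL(2, ℤ)} (h1 : -1 ∈ H) (hT : ModularGroup.T ∈ H)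
    (hV : lowerFour ∈ H) : Gamma0 4 ≤ H := by
  have hV4 : lowerFour ∈ Gamma0 4 := by
    rw [Gamma0_mem]
    rfl
  have hT4 : ModularGroup.T ∈ Gamma0 4 := by
    rw [Gamma0_mem]
    rfl
  suffices ∀ n : ℕ, ∀ γ ∈ Gamma0 4, (γ 1 0).natAbs = n → γ ∈ H from fun γ hγ ↦ this _ γ hγ rfl
  intro n
  induction n using Nat.strong_induction_on with
  | _ n ih =>
    intro γ hγ hn
    by_cases hc : γ 1 0 = 0
    · obtain ⟨⟨a, m⟩, hp⟩ := signedTranslationEquiv.surjective ⟨γ, mem_upperTriangular.mpr hc⟩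
      have hγ' : γ = signedTranslation (a, m) := (congrArg Subtype.val hp).symm
      have hTm : signedTranslation (1, m) = ModularGroup.T ^ m := by
        refine Subtype.ext ?_
        rw [ModularGroup.coe_T_zpow]
        simp [signedTranslation]
      rcases Int.units_eq_one_or a with rfl | rfl
      · rw [hγ', hTm]
        exact zpow_mem hT m
      · have : signedTranslation (-1, m) = -1 * signedTranslation (1, m) := by
          refine Subtype.ext ?_
          rw [neg_one_mul, Matrix.SpecialLinearGroup.coe_neg]
          simp [signedTranslation]
        rw [hγ', this, hTm]
        exact mul_mem h1 (zpow_mem hT m)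
    · obtain ⟨m, hm⟩ := exists_two_mul_abs_add_mul_le (γ 1 1) hc
      set δ := γ * ModularGroup.T ^ m with hδ
      have hδ4 : δ ∈ Gamma0 4 := mul_mem hγ (zpow_mem hT4 m)
      have hδ10 : δ 1 0 = γ 1 0 := by
        simp [hδ, Matrix.mul_apply, ModularGroup.coe_T_zpow, Fin.sum_univ_two]
      have hδ11 : δ 1 1 = γ 1 0 * m + γ 1 1 := by
        simp [hδ, Matrix.mul_apply, ModularGroup.coe_T_zpow, Fin.sum_univ_two]
      obtain ⟨h4, hodd, -⟩ := Gamma0_four_apply hδ4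
      have hodd' := Int.odd_iff.mp hodd
      -- Descent on |c|: first 2|d| ≤ |c| through T, then |c'| ≤ 2|d| through (1, 0; 4, 1). The
      -- decrease is strict, since 2|d| = |c| is impossible for d odd and 4 ∣ c.
      obtain ⟨l, hl⟩ := exists_two_mul_abs_add_mul_le (δ 1 0) (c := 4 * δ 1 1) (by omega)
      have hε10 : (δ * lowerFour ^ l) 1 0 = 4 * δ 1 1 * l + δ 1 0 := by
        simp [Matrix.mul_apply, coe_lowerFour_zpow, Fin.sum_univ_two]
        ring
      rw [← hδ11] at hm
      have hmem : δ * lowerFour ^ l ∈ H := by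
        refine ih _ ?_ _ (mul_mem hδ4 (zpow_mem hV4 l)) rfl
        rw [← hn, hε10]
        rw [hδ10] at h4 hl ⊢
        generalize 4 * δ 1 1 * l + γ 1 0 = x at hl ⊢
        simp only [Int.abs_eq_natAbs, Int.natAbs_mul, show Int.natAbs 4 = 4 from rfl] at hm hl
        omega
      rw [hδ] at hmem
      rwa [H.mul_mem_cancel_right (zpow_mem hV l), H.mul_mem_cancel_right (zpow_mem hT m)] at hmem

lemma thetaRoot_mul {γ δ : SL(2, ℤ)} (hγ : γ ∈ Gamma0 4) (hδ : δ ∈ Gamma0 4) (τ : ℍ) :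
    thetaRoot (γ * δ) τ = thetaRoot γ (δ • τ) * thetaRoot δ τ := by
  have h : Gamma0 4 ≤ thetaCocycleSubgroup := Gamma0_four_le
    ⟨by rw [Gamma0_mem]; simp, isThetaCocycle_neg_one⟩ ⟨by rw [Gamma0_mem]; rfl, isThetaCocycle_T⟩
    ⟨by rw [Gamma0_mem]; rfl, isThetaCocycle_lowerFour⟩
  exact (h hδ).2 γ hγ τ

lemma mdifferentiable_thetaFactor (k : ℕ) (γ : SL(2, ℤ)) :
    MDifferentiable 𝓘(ℂ) 𝓘(ℂ) (thetaFactor k γ) := by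
  rw [UpperHalfPlane.mdifferentiable_iff]
  have : DifferentiableOn ℂ (fun z : ℂ ↦
      ((γ 1 0 : ℂ) * z + (γ 1 1 : ℂ)) ^ ((k : ℂ) + 1 / 2)) {z | 0 < z.im} := by
    -- For c = 0 the power is constant; otherwise cz + d is not real on ℍ and avoids the cut.
    by_cases hc : γ 1 0 = 0
    · simp only [hc, Int.cast_zero, zero_mul]
      exact differentiableOn_const _
    · intro z hz
      refine DifferentiableAt.differentiableWithinAt ?_
      refine DifferentiableAt.cpow (by fun_prop) (by fun_prop) (.inr ?_)
      have hc' : (γ 1 0 : ℝ) ≠ 0 := by exact_mod_cast hc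
      simpa using ⟨hc, (show 0 < z.im from hz).ne'⟩
  refine (this.const_mul ((thetaSymbol (γ 1 0) (γ 1 1) : ℂ) ^ (2 * k + 1) *
    (thetaEpsilon (γ 1 1))⁻¹ ^ (2 * k + 1))).congr fun z hz ↦ ?_
  simp [thetaFactor, ofComplex_apply_of_im_pos hz]

lemma isAutomorphyFactor_thetaFactor (k : ℕ) :
    IsAutomorphyFactor (Gamma0 4) (2 * k + 1) (thetaFactor k) := by
  refine ⟨fun γ _ ↦ mdifferentiable_thetaFactor k γ, fun γ hγ δ hδ τ ↦ ?_, fun γ hγ τ ↦ ?_⟩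
  · rw [thetaFactor_eq, thetaFactor_eq, thetaFactor_eq, thetaRoot_mul hγ hδ, mul_pow]
  · rw [thetaFactor_eq, ← pow_mul, mul_comm _ 4, pow_mul, thetaRoot_pow_four hγ, ← pow_mul]

lemma mem_halfCuspSpace_iff {k N : ℕ} {f : ℍ → ℂ} :
    f ∈ halfCuspSpace k N ↔ IsCuspFormFor (Gamma0 (4 * N)) (2 * k + 1) (thetaFactor k) f := by
  have hnorm : ∀ σ : SL(2, ℤ), (IsZeroAtImInfty fun τ : ℍ ↦
      ((σ 1 0 : ℂ) * (τ : ℂ) + (σ 1 1 : ℂ)) ^ (-((k : ℂ) + 1 / 2)) * f (σ • τ)) ↔ IsZeroAtImInfty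
      fun τ ↦ ‖denom σ τ‖ ^ (-((2 * k + 1 : ℕ) / 2 : ℝ)) * ‖f (σ • τ)‖ := fun σ ↦ by
    rw [IsZeroAtImInfty, IsZeroAtImInfty, Filter.ZeroAtFilter, Filter.ZeroAtFilter,
      tendsto_zero_iff_norm_tendsto_zero]
    refine Filter.tendsto_congr fun τ ↦ ?_
    rw [norm_mul, ModularGroup.denom_apply, show -((k : ℂ) + 1 / 2) =
      ((-((2 * k + 1 : ℕ) / 2 : ℝ) : ℝ) : ℂ) by push_cast; ring, Complex.norm_cpow_real]
  exact ⟨fun h ↦ ⟨h.1, h.2.1, fun σ ↦ (hnorm σ).mp (h.2.2 σ)⟩,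
    fun h ↦ ⟨h.1, h.2, fun σ ↦ (hnorm σ).mpr (h.3 σ)⟩⟩

lemma Gamma0_le_Gamma0_of_dvd {M N : ℕ} (h : M ∣ N) : Gamma0 N ≤ Gamma0 M := fun γ hγ ↦ by
  rw [Gamma0_mem, ZMod.intCast_zmod_eq_zero_iff_dvd] at hγ ⊢
  exact (Int.natCast_dvd_natCast.mpr h).trans hγ

/-- The case of half-integral weight. -/
theorem exists_bergmanSup_bounds_halfCuspSpace {k : ℕ} (hk : 2 ≤ k) :
    (∃ c C : ℝ, 0 < c ∧ ∀ N : ℕ, 1 ≤ N →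
      (∃ B, IsPeterssonOrthonormalBasis (k + 1 / 2) (Gamma0 (4 * N)) (halfCuspSpace k N) B) ∧
      ∀ B, IsPeterssonOrthonormalBasis (k + 1 / 2) (Gamma0 (4 * N)) (halfCuspSpace k N) B →
        bergmanSup (k + 1 / 2) B ≤ ENNReal.ofReal C ∧
        (halfCuspSpace k N ≠ ⊥ → ENNReal.ofReal c ≤ bergmanSup (k + 1 / 2) B)) ∧
    (∃ N₀ : ℕ, ∀ N : ℕ, N₀ ≤ N → halfCuspSpace k N ≠ ⊥) := by
  have hw : ((2 * k + 1 : ℕ) / 2 : ℝ) = k + 1 / 2 := by push_cast; ring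
  have hfin : ∀ N, 1 ≤ N → (Gamma0 (4 * N)).FiniteIndex := fun N hN ↦ by
    have : NeZero (4 * N) := ⟨by omega⟩
    infer_instance
  have := exists_bergmanSup_bounds (w := 2 * k + 1) (by omega) (isAutomorphyFactor_thetaFactor k)
    (mdifferentiable_poincareSeed _) (lintegral_weightedNorm_poincareSeed_ne_top (by omega))
    (G := fun N ↦ Gamma0 (4 * N)) (L := upperTriangular)
    (fun N ↦ Gamma0_le_Gamma0_of_dvd (dvd_mul_right 4 N)) hfin
    (fun _ ↦ upperTriangular_le_Gamma0 _)
    (fun γ hγ ↦ (Filter.tendsto_id.const_mul_atTop' four_pos).eventually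
      (eventually_notMem_Gamma0 hγ)) (S := fun N ↦ halfCuspSpace k N)
    (fun N hN f ↦ mem_halfCuspSpace_iff)
    (poincareSeries_upperTriangular_ne_zero (by omega)
      ((isAutomorphyFactor_thetaFactor k).mono (upperTriangular_le_Gamma0 4)) fun γ hγ z ↦ by
        rw [thetaFactor_eq, thetaRoot_of_mem_upperTriangular hγ, one_pow])
  rwa [hw] at this

end Factor

end

/-- Finite dimension is contained in the existence of `B`, a finite set spanning the space. -/
theorem theorem1p5 :
    -- integral weight `k > 2` and `Γ₀(N)`, for all `N ≥ 1`
    (∀ k : ℕ, 2 < k →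
      (∃ c C : ℝ, 0 < c ∧ ∀ N : ℕ, 1 ≤ N →
        (∃ B, IsPeterssonOrthonormalBasis k (Gamma0 N) (cuspSpace (Gamma0 N) k) B) ∧
        ∀ B, IsPeterssonOrthonormalBasis k (Gamma0 N) (cuspSpace (Gamma0 N) k) B →
          bergmanSup k B ≤ ENNReal.ofReal C ∧
          (cuspSpace (Gamma0 N) k ≠ ⊥ → ENNReal.ofReal c ≤ bergmanSup k B)) ∧
      (Even k → ∃ N₀ : ℕ, ∀ N : ℕ, N₀ ≤ N → cuspSpace (Gamma0 N) k ≠ ⊥)) ∧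
    -- integral weight `k > 2` and `Γ(N)`, for all `N ≥ 1`
    (∀ k : ℕ, 2 < k →
      (∃ c C : ℝ, 0 < c ∧ ∀ N : ℕ, 1 ≤ N →
        (∃ B, IsPeterssonOrthonormalBasis k (Gamma N) (cuspSpace (Gamma N) k) B) ∧
        ∀ B, IsPeterssonOrthonormalBasis k (Gamma N) (cuspSpace (Gamma N) k) B →
          bergmanSup k B ≤ ENNReal.ofReal C ∧
          (cuspSpace (Gamma N) k ≠ ⊥ → ENNReal.ofReal c ≤ bergmanSup k B)) ∧
      (∃ N₀ : ℕ, ∀ N : ℕ, N₀ ≤ N → cuspSpace (Gamma N) k ≠ ⊥)) ∧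
    -- weight `κ = k + 1/2 ≥ 5/2` and `Γ₀(4N)`, for all square-free `N ≥ 1`
    (∀ k : ℕ, 2 ≤ k →
      (∃ c C : ℝ, 0 < c ∧ ∀ N : ℕ, 1 ≤ N → Squarefree N →
        (∃ B, IsPeterssonOrthonormalBasis (k + 1 / 2) (Gamma0 (4 * N)) (halfCuspSpace k N) B) ∧
        ∀ B, IsPeterssonOrthonormalBasis (k + 1 / 2) (Gamma0 (4 * N)) (halfCuspSpace k N) B →
          bergmanSup (k + 1 / 2) B ≤ ENNReal.ofReal C ∧
          (halfCuspSpace k N ≠ ⊥ → ENNReal.ofReal c ≤ bergmanSup (k + 1 / 2) B)) ∧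
      (∃ N₀ : ℕ, ∀ N : ℕ, N₀ ≤ N → Squarefree N → halfCuspSpace k N ≠ ⊥)) :=
  ⟨fun _ hk ↦ exists_bergmanSup_bounds_Gamma0 hk, fun _ hk ↦ exists_bergmanSup_bounds_Gamma hk,
    fun _ hk ↦ by
      obtain ⟨⟨c, C, hc, h⟩, N₀, h₀⟩ := exists_bergmanSup_bounds_halfCuspSpace hk
      exact ⟨⟨c, C, hc, fun N hN _ ↦ h N hN⟩, N₀, fun N hN _ ↦ h₀ N hN⟩⟩
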